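/- Let $p,q\in(1,\infty)$ and $r\in(1/2,\infty)$ satisfy $1/p+1/q=1/r$. For real-valued discrete-time processes $f=(f_n)_{n\ge0}$, $g=(g_n)_{n\ge0}$ write $df_n=f_n-f_{n-1}$, $dg_n=g_n-g_{n-1}$ for $n\ge1$, and define the truncated paraproducts $$\Pi_{n,n'}(f,g)=\sum_{n<i<j\le n'}df_i\,dg_j\qquad(0\le n<n').$$ For a random variable $h$ with values in $[-\infty,\infty]$ and $s\in(0,\infty)$ put $\|h\|_{L^s}=(\mathbb E|h|^s)^{1/s}\in[0,\infty]$, and for a martingale $f$ put $\|f\|_{L^s}=\sup_{n\ge0}\|f_n\|_{L^s}\in[0,\infty]$. In products below, $0\cdot\infty=0$. (i) For every $\varrho\in(1,\infty)$ there is a constant $C_{p,q,\varrho}\in[0,\infty)$, depending only on $p,q,\varrho$, such that for every probability space, every filtration $(\mathcal F_n)_{n\ge0}$ on it, and all real-valued martingales $f,g$ with respect to $(\mathcal F_n)_{n\ge0}$, $$\Bigg\|\sup_{m\in\mathbb N,\ n_0<n_1<\cdots<n_m}\Big(\sum_{k=1}^m|\Pi_{n_{k-1},n_k}(f,g)|^\varrho\Big)^{1/\varrho}\Bigg\|_{L^r}\le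 C_{p,q,\varrho}\,\|f\|_{L^p}\|g\|_{L^q}.$$ (ii) There is a constant $C_{p,q}\in[0,\infty)$, depending only on $p,q$, such that for every probability space, every filtration $(\mathcal F_n)_{n\ge0}$ on it, all real-valued martingales $f,g$ with respect to $(\mathcal F_n)_{n\ge0}$, and every $\lambda\in(0,\infty)$, $$\Bigg\|\sup_{m\in\mathbb N,\ n_0<n_1<\cdots<n_m}\operatorname{card}\big\{k\in\{1,\dots,m\}:|\Pi_{n_{k-1},n_k}(f,g)|\ge\lambda\big\}\Bigg\|_{L^r}\le C_{p,q}\,\lambda^{-1}\|f\|_{L^p}\|g\|_{L^q}.$$ In both parts the suprema are taken over all $m$ and all integers $0\le n_0<n_1<\cdots<n_m$. -/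

import Mathlib

open MeasureTheory
open scoped ENNReal NNReal

/-- The difference `df_n = f_n - f_{n-1}` of a process, meaningful for `n ≥ 1`. -/
def procDiff {Ω : Type*} (f : ℕ → Ω → ℝ) (n : ℕ) (ω : Ω) : ℝ :=
  f n ω - f (n - 1) ω

/-- The truncated paraproduct `Π_{n,n'}(f,g) = ∑_{n < i < j ≤ n'} df_i dg_j`. Only indices
`i, j ≥ 1` occur in the sum. -/
def truncParaproduct {Ω : Type*} (f g : ℕ → Ω → ℝ) (n n' : ℕ) (ω : Ω) : ℝ :=
  ∑ j ∈ Finset.Ioc n n', ∑ i ∈ Finset.Ioo n j, procDiff f i ω * procDiff g j ω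

/-- The `ϱ`-variation of the truncated paraproducts: the supremum over all `m` and all
`n_0 < n_1 < ⋯ < n_m` of `(∑_{k=1}^m |Π_{n_{k-1},n_k}(f,g)|^ϱ)^{1/ϱ}`, with values in `[0,∞]`. -/
noncomputable def paraproductVariation {Ω : Type*} (ϱ : ℝ) (f g : ℕ → Ω → ℝ) (ω : Ω) : ℝ≥0∞ :=
  ⨆ (m : ℕ) (n : Fin (m + 1) → ℕ) (_ : StrictMono n),
    (∑ k : Fin m, ENNReal.ofReal |truncParaproduct f g (n k.castSucc) (n k.succ) ω| ^ ϱ) ^ (1 / ϱ)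

/-- The `lam`-jump counting function of the truncated paraproducts: the supremum over all `m` and
all `n_0 < n_1 < ⋯ < n_m` of the number of `k ∈ {1,…,m}` with `|Π_{n_{k-1},n_k}(f,g)| ≥ lam`,
with values in `[0,∞]`. -/
noncomputable def paraproductJumpCount {Ω : Type*} (lam : ℝ) (f g : ℕ → Ω → ℝ) (ω : Ω) : ℝ≥0∞ :=
  ⨆ (m : ℕ) (n : Fin (m + 1) → ℕ) (_ : StrictMono n),
    ((Finset.univ.filter fun k : Fin m =>
      lam ≤ |truncParaproduct f g (n k.castSucc) (n k.succ) ω|).card : ℝ≥0∞)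

/-- The norm `‖f‖_{L^p} = sup_{n ≥ 0} ‖f_n‖_{L^p}` of a martingale, with values in `[0,∞]`. -/
noncomputable def martingaleLpNorm {Ω : Type*} [MeasurableSpace Ω] (μ : Measure Ω) (p : ℝ)
    (f : ℕ → Ω → ℝ) : ℝ≥0∞ :=
  ⨆ n : ℕ, eLpNorm (f n) (ENNReal.ofReal p) μ

/-! Time is cut into blocks at adapted reset times: `σ n` is the last reset not after `n`, and it
labels the increment from `n` to `n + 1`. A reset happens at `n + 1` as soon as some paraproduct
started inside the current block reaches a threshold at `n + 1`. Any interval whose paraproduct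
reaches the threshold must then contain a reset, and the value that triggers this reset is at most
the maximal paraproduct over the block being closed (`exists_reset`, `sum_le_sum_of_resets`).
Different intervals close different blocks, so `λ` times the number of jumps is at most a sum over
blocks of maximal paraproducts. Everything reduces to bounding that sum in `L^r`, uniformly in `σ`
(`exists_eLpNorm_totalWeight_le`).

By Chasles' relation (`truncParaproduct_chasles`) a paraproduct inside a block is controlled by
those started at the beginning of the block and by products of the block maxima of `f` and `g`. The
products are handled by Cauchy–Schwarz over blocks and the `L^p` bound for the ℓ²-norm `F` of the
block maxima (`IsMartingaleDiff.eLpNorm_blockNorm_le`). For the paraproducts started at block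
beginnings, Davis' inequality in each block and the Garsia–Neveu lemma bound the sum of block maxima
by the sum of block square functions, but only for exponents at least 1. To reach `r > 1/2`, the
increments are divided by the predictable factor `F ^ s`, which leaves an exponent `t ≥ 1`; the
factor is monotone in time, so summation by parts puts it back, and Hölder combines the two
(`exists_eLpNorm_blockTotal_paraproduct_le`). The `L^1` inequalities come from pathwise ones with a
bounded predictable integrand, whose martingale transform has mean zero.

For the variation, thresholds `2 ^ (-l)` times an adapted increasing majorant are used for every
`l`. Since `ϱ > 1`, the level sums may grow like `κ ^ l` with `κ = 2 ^ ((ϱ - 1) / 2)`; the supremum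
over `l` of the level sums weighted by `κ ^ (-l)` is bounded in `L^r` by summing a geometric series
of `r`-th powers. -/

/-! ### Running maxima and the pathwise Davis inequality -/

/-- The running maximum of the absolute values of a sequence. -/
noncomputable def runMax (x : ℕ → ℝ) : ℕ → ℝ
  | 0 => |x 0|
  | n + 1 => max (runMax x n) |x (n + 1)|

lemma abs_le_runMax (x : ℕ → ℝ) {i n : ℕ} (h : i ≤ n) : |x i| ≤ runMax x n := by
  induction n with
  | zero => obtain rfl : i = 0 := by omega
            exact le_rfl
  | succ n ih =>
    rcases Nat.lt_or_ge n i with h' | h'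
    · obtain rfl : i = n + 1 := by omega
      exact le_max_right _ _
    · exact (ih h').trans (le_max_left _ _)

lemma runMax_nonneg (x : ℕ → ℝ) (n : ℕ) : 0 ≤ runMax x n :=
  (abs_nonneg _).trans (abs_le_runMax x (Nat.zero_le n))

lemma runMax_le {x : ℕ → ℝ} {n : ℕ} {c : ℝ} (h : ∀ i ≤ n, |x i| ≤ c) : runMax x n ≤ c := by
  induction n with
  | zero => exact h 0 le_rfl
  | succ n ih => exact max_le (ih fun i hi => h i (by omega)) (h _ le_rfl)

lemma runMax_mono (x : ℕ → ℝ) : Monotone (runMax x) :=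
  monotone_nat_of_le_succ fun _ => le_max_left _ _

/-- The potential is `x ^ 2 / c + c` with `c = max m S`. A jump `|d| ≥ c` raises `S` by at least
`|d| / 3`, and `18 * (S' - S)` pays for every term. For `|d| < c` one has `S' + S ≤ 3 * c`, hence `d
^ 2 / c ≤ 3 * (S' - S)`; when the new maximum is `c' = |x + d|`, the potential becomes `2 * c' ≤ c'
^ 2 / c + c`, so raising `c` costs nothing. -/
lemma davis_step {x m S d : ℝ} (hxm : |x| ≤ m) (hS : 0 ≤ S) :
    (x + d) ^ 2 / max (max m |x + d|) √(S ^ 2 + d ^ 2) + max (max m |x + d|) √(S ^ 2 + d ^ 2)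
      ≤ x ^ 2 / max m S + max m S + 2 * (x / max m S * d) + 18 * (√(S ^ 2 + d ^ 2) - S) := by
  set c := max m S with hc
  set S' := √(S ^ 2 + d ^ 2) with hS'
  set c' := max (max m |x + d|) S' with hc'
  have hm0 : 0 ≤ m := (abs_nonneg _).trans hxm
  have hc0 : 0 ≤ c := hm0.trans (le_max_left _ _)
  have hmc : m ≤ c := le_max_left _ _
  have hSc : S ≤ c := le_max_right _ _
  have hS'sq : S' ^ 2 = S ^ 2 + d ^ 2 := Real.sq_sqrt (by positivity)
  have hS'0 : 0 ≤ S' := Real.sqrt_nonneg _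
  have hSS' : S ≤ S' := Real.le_sqrt_of_sq_le (by nlinarith [sq_nonneg d])
  have hS'le : S' ≤ S + |d| := by
    apply Real.sqrt_le_iff.2 ⟨by positivity, ?_⟩
    nlinarith [sq_abs d, mul_nonneg hS (abs_nonneg d)]
  have hcc' : c ≤ c' := max_le_max (le_max_left _ _) hSS'
  have hx'c' : |x + d| ≤ c' := (le_max_right _ _).trans (le_max_left _ _)
  have hx' : |x + d| ≤ |x| + |d| := abs_add_le _ _
  have hxc : |x| ≤ c := hxm.trans hmc
  have hc'le : c' ≤ c + |d| := by
    refine max_le (max_le ?_ ?_) ?_ <;> linarith [abs_nonneg d]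
  have hc'0 : 0 ≤ c' := hc0.trans hcc'
  rcases le_or_gt c |d| with hd | hd
  · have h1 : (x + d) ^ 2 / c' ≤ c' := by
      apply div_le_of_le_mul₀ hc'0 hc'0
      nlinarith [sq_abs (x + d), abs_nonneg (x + d)]
    have h2 : 0 ≤ x ^ 2 / c := by positivity
    have h3 : -|d| ≤ x / c * d := by
      have : |x / c * d| ≤ 1 * |d| := by
        rw [abs_mul]
        gcongr
        rw [abs_div, abs_of_nonneg hc0]
        exact div_le_one_of_le₀ hxc hc0
      linarith [neg_abs_le (x / c * d)]
    have h4 : S + |d| / 3 ≤ S' := by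
      apply Real.le_sqrt_of_sq_le
      nlinarith [sq_abs d, abs_nonneg d]
    linarith
  · have hcpos : 0 < c := (abs_nonneg d).trans_lt hd
    have hc'pos : 0 < c' := hcpos.trans_le hcc'
    have h1 : d ^ 2 / c ≤ 3 * (S' - S) := by
      rw [div_le_iff₀ hcpos]
      have : d ^ 2 = (S' - S) * (S' + S) := by linarith [hS'sq, show (S' - S) * (S' + S) = S' ^ 2 - S ^ 2 by ring]
      rw [this]
      nlinarith
    have h2 : (x + d) ^ 2 / c = x ^ 2 / c + 2 * (x / c * d) + d ^ 2 / c := by ring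
    have h3 : (x + d) ^ 2 / c' ≤ (x + d) ^ 2 / c := by gcongr
    have h4 : 0 ≤ d ^ 2 / c := by positivity
    have key : c' ≤ c ∨ c' ≤ S' ∨ c' ≤ |x + d| := by
      rcases le_max_iff.1 hc'.le with h | h
      · rcases le_max_iff.1 h with h | h
        · exact Or.inl (h.trans hmc)
        · exact Or.inr (Or.inr h)
      · exact Or.inr (Or.inl h)
    rcases key with h | h | h
    · linarith
    · linarith
    · have h5 : c' = |x + d| := le_antisymm h hx'c'
      have h6 : (x + d) ^ 2 = c' ^ 2 := by rw [h5, sq_abs]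
      have h7 : c' ^ 2 / c' = c' := by field_simp
      have h8 : 2 * c' ≤ c' ^ 2 / c + c := by
        rw [← sub_nonneg]
        have : c' ^ 2 / c + c - 2 * c' = (c' - c) ^ 2 / c := by field_simp; ring
        rw [this]; positivity
      rw [h6] at h2 ⊢
      linarith

/-- The bounded predictable integrand in the pathwise Davis inequality. -/
noncomputable def davisIntegrand (d : ℕ → ℝ) (n : ℕ) : ℝ :=
  (∑ i ∈ Finset.range n, d i) /
    max (runMax (fun k => ∑ i ∈ Finset.range k, d i) n) √(∑ i ∈ Finset.range n, d i ^ 2)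

lemma abs_davisIntegrand_le (d : ℕ → ℝ) (n : ℕ) : |davisIntegrand d n| ≤ 1 := by
  unfold davisIntegrand
  have h := abs_le_runMax (fun k => ∑ i ∈ Finset.range k, d i) (le_refl n)
  have h0 : 0 ≤ max (runMax (fun k => ∑ i ∈ Finset.range k, d i) n)
      √(∑ i ∈ Finset.range n, d i ^ 2) := (runMax_nonneg _ _).trans (le_max_left _ _)
  rw [abs_div, abs_of_nonneg h0]
  exact div_le_one_of_le₀ (h.trans (le_max_left _ _)) h0

/-- Pathwise form of Davis' inequality. -/
lemma runMax_le_davis (d : ℕ → ℝ) (N : ℕ) :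
    runMax (fun k => ∑ i ∈ Finset.range k, d i) N ≤
      2 * ∑ n ∈ Finset.range N, davisIntegrand d n * d n
        + 18 * √(∑ i ∈ Finset.range N, d i ^ 2) := by
  set x : ℕ → ℝ := fun k => ∑ i ∈ Finset.range k, d i with hx
  set S : ℕ → ℝ := fun n => √(∑ i ∈ Finset.range n, d i ^ 2) with hS
  have key : ∀ n, x n ^ 2 / max (runMax x n) (S n) + max (runMax x n) (S n) ≤
      2 * ∑ k ∈ Finset.range n, davisIntegrand d k * d k + 18 * S n := by
    intro n
    induction n with
    | zero => simp [hx, hS, runMax]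
    | succ n ih =>
      have h1 : x (n + 1) = x n + d n := Finset.sum_range_succ _ _
      have h2 : S (n + 1) = √(S n ^ 2 + d n ^ 2) := by
        simp only [hS]
        rw [Real.sq_sqrt (Finset.sum_nonneg fun _ _ => sq_nonneg _), Finset.sum_range_succ]
      have h3 := davis_step (d := d n) (abs_le_runMax x (le_refl n))
        (show 0 ≤ S n from Real.sqrt_nonneg _)
      rw [Finset.sum_range_succ]
      have h4 : davisIntegrand d n = x n / max (runMax x n) (S n) := rfl
      have h5 : runMax x (n + 1) = max (runMax x n) |x n + d n| := by rw [runMax, h1]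
      rw [h1, h5, h2, h4]
      linarith
  have h := key N
  have h1 : 0 ≤ x N ^ 2 / max (runMax x N) (S N) :=
    div_nonneg (sq_nonneg _) ((runMax_nonneg _ _).trans (le_max_left _ _))
  linarith [le_max_left (runMax x N) (S N)]

/-! ### A pathwise maximal inequality for the ℓ²-norm of block maxima -/

/-- The block potential dominating half the squared maximum. -/
noncomputable def blockPot (u M : ℝ) : ℝ := (M - |u|) ^ 2 + u ^ 2

lemma blockPot_ge (u M : ℝ) : M ^ 2 / 2 ≤ blockPot u M := by
  unfold blockPot
  nlinarith [sq_nonneg (M - 2 * |u|), sq_abs u]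

lemma blockPot_le {u M : ℝ} (h : |u| ≤ M) : blockPot u M ≤ M ^ 2 := by
  unfold blockPot
  nlinarith [sq_abs u, abs_nonneg u]

/-- The modulus is convex with subgradient `u / |u|`; at `u = 0` the quotient is `0`, which is still
a subgradient. The potential therefore grows by a term linear in `d`, fit for a predictable
integrand, plus `2 * d ^ 2`, which subtracting `2 * x ^ 2` later cancels. -/
lemma blockPot_step {u M d : ℝ} (h : |u| ≤ M) :
    blockPot (u + d) (max M |u + d|) ≤
      blockPot u M + (4 * u - 2 * M * (u / |u|)) * d + 2 * d ^ 2 := by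
  have hM : 0 ≤ M := (abs_nonneg _).trans h
  have h1 : |u| + u / |u| * d ≤ |u + d| := by
    rcases eq_or_ne u 0 with rfl | hu
    · simp
    have h2 : |u| + u / |u| * d = (u / |u|) * (u + d) := by
      have : |u| ≠ 0 := abs_ne_zero.2 hu
      field_simp
      rw [sq_abs]
      ring
    have h3 : abs (u / |u|) = 1 := by
      rw [abs_div, abs_abs, div_self (abs_ne_zero.2 hu)]
    calc |u| + u / |u| * d ≤ abs (u / |u| * (u + d)) := h2 ▸ le_abs_self _
      _ = |u + d| := by rw [abs_mul, h3, one_mul]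
  unfold blockPot
  set v := |u + d| with hv
  have hv0 : 0 ≤ v := abs_nonneg _
  have e1 : (u + d) ^ 2 = v ^ 2 := by rw [hv, sq_abs]
  have e2 : v ^ 2 = u ^ 2 + 2 * u * d + d ^ 2 := by rw [← e1]; ring
  have e3 : |u| ^ 2 = u ^ 2 := sq_abs u
  have h4 : M * (|u| + u / |u| * d) ≤ M * v := mul_le_mul_of_nonneg_left h1 hM
  rcases max_cases M v with ⟨hh, h5⟩ | ⟨hh, h5⟩
  · rw [hh, e1]
    nlinarith
  · rw [hh, e1]
    nlinarith

/-- Here `G` is the sum of the block potentials, `F` the ℓ²-norm of the block maxima, `x` the scalar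
sum and `Q` its running maximum. The normalization `c = max F (4 * Q)` is raised either by `F`, paid
for by the decrease of `(G - 2 * x ^ 2) / c`, or by `Q`, paid for by `Q' - Q`. If `|d| ≥ c`, then
`Q` itself jumps by at least `|d| / 2`. -/
lemma vector_max_step {F F' G G' x Q d H : ℝ} (hF : 0 ≤ F) (hxQ : |x| ≤ Q)
    (hFF' : F ≤ F') (hF'le : F' ≤ F + |d|) (hG : F ^ 2 / 2 ≤ G) (hG' : F' ^ 2 / 2 ≤ G')
    (hG'le : G' ≤ F' ^ 2) (hH : |H| ≤ 7 * max F (4 * Q))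
    (hstep : G' - 2 * (x + d) ^ 2 ≤ G - 2 * x ^ 2 + H * d) :
    (G' - 2 * (x + d) ^ 2) / max F' (4 * max Q |x + d|) + 3 / 8 * max F' (4 * max Q |x + d|)
      ≤ (G - 2 * x ^ 2) / max F (4 * Q) + 3 / 8 * max F (4 * Q) + H / max F (4 * Q) * d
        + 36 * (max Q |x + d| - Q) := by
  set c := max F (4 * Q) with hc
  set Q' := max Q |x + d| with hQ'
  set c' := max F' (4 * Q') with hc'
  set L := G - 2 * x ^ 2 with hL
  set L' := G' - 2 * (x + d) ^ 2 with hL'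
  have hQ0 : 0 ≤ Q := (abs_nonneg _).trans hxQ
  have hFc : F ≤ c := le_max_left _ _
  have hQc : 4 * Q ≤ c := le_max_right _ _
  have hc0 : 0 ≤ c := hF.trans hFc
  have hQQ' : Q ≤ Q' := le_max_left _ _
  have hxQ' : |x + d| ≤ Q' := le_max_right _ _
  have hcc' : c ≤ c' := max_le_max hFF' (by linarith)
  have hF'c' : F' ≤ c' := le_max_left _ _
  have hQ'c' : 4 * Q' ≤ c' := le_max_right _ _
  have hc'0 : 0 ≤ c' := hc0.trans hcc'
  have hd0 := abs_nonneg d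
  have hQ'le : Q' ≤ Q + |d| :=
    max_le (by linarith) ((abs_add_le _ _).trans (by linarith))
  have hc'le : c' ≤ c + 4 * |d| := max_le (by linarith) (by linarith)
  have hxsq : x ^ 2 ≤ Q ^ 2 := by rw [← sq_abs]; gcongr
  have hx'sq : (x + d) ^ 2 ≤ Q' ^ 2 := by rw [← sq_abs (x + d)]; gcongr
  have hF'0 : 0 ≤ F' := hF.trans hFF'
  rcases le_or_gt c |d| with hd | hd
  · have h1 : L' / c' ≤ c' := by
      apply div_le_of_le_mul₀ hc'0 hc'0
      nlinarith [sq_nonneg (x + d)]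
    have h2 : -c ≤ L / c := by
      rcases hc0.eq_or_lt with h | h
      · rw [← h]; simp
      rw [le_div_iff₀ h]
      nlinarith [sq_nonneg F]
    have h3 : -(7 * |d|) ≤ H / c * d := by
      have : |H / c * d| ≤ 7 * |d| := by
        rw [abs_mul]
        gcongr
        rw [abs_div, abs_of_nonneg hc0]
        exact div_le_of_le_mul₀ hc0 (by norm_num) hH
      linarith [neg_abs_le (H / c * d)]
    have h4 : |d| ≤ |x + d| + |x| := by
      have := abs_sub (x + d) x
      rwa [add_sub_cancel_left] at this
    linarith
  · have hcpos : 0 < c := hd0.trans_lt hd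
    have hc'pos : 0 < c' := hcpos.trans_le hcc'
    have e1 : L' / c' = L' / c - L' * (c' - c) / (c * c') := by
      field_simp
      ring
    have e2 : L' / c ≤ L / c + H / c * d := by
      have : L / c + H / c * d = (L + H * d) / c := by ring
      rw [this]
      gcongr
    have hdiff : 0 ≤ c' - c := by linarith
    rcases le_max_iff.1 hc'.le with h | h
    · have h5 : c' = F' := le_antisymm h hF'c'
      have h6 : 3 / 8 * (c' - c) ≤ L' * (c' - c) / (c * c') := by
        rw [le_div_iff₀ (by positivity)]
        -- `L' ≥ F' ^ 2 / 2 - 2 * Q' ^ 2` and `Q' ≤ c' / 4`, so the coefficient is `1/2 - 2/16 =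
        -- 3/8`, the weight of `c` in the potential.
        have h7 : 3 / 8 * (c * c') ≤ L' := by
          have h8 : c * c' ≤ c' * c' := mul_le_mul_of_nonneg_right hcc' hc'0
          have h9 : (4 * Q') ^ 2 ≤ c' ^ 2 := by gcongr
          have h10 : F' ^ 2 = c' ^ 2 := by rw [h5]
          linarith
        nlinarith
      linarith
    · have h5 : c' = 4 * Q' := le_antisymm h hQ'c'
      have h6 : -(5 / 8 * (c' - c)) ≤ L' * (c' - c) / (c * c') := by
        rw [le_div_iff₀ (by positivity)]
        -- `L' ≥ -2 * Q' ^ 2 = -c' ^ 2 / 8`, and `c' ≤ 5 * c` because `|d| < c`.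
        have h7 : -(5 / 8 * (c * c')) ≤ L' := by
          have h8 : c' * c' ≤ (5 * c) * c' := mul_le_mul_of_nonneg_right (by linarith) hc'0
          have h9 : c' ^ 2 = (4 * Q') ^ 2 := by rw [h5]
          have h10 := sq_nonneg F'
          linarith
        nlinarith
      linarith

/-! ### Labelled blocks and their maxima -/

/-- The partial sum of the increments `d i` whose label `σ i` equals `a`. -/
def blockSum (σ : ℕ → ℕ) (d : ℕ → ℝ) (a n : ℕ) : ℝ :=
  ∑ i ∈ Finset.range n, if σ i = a then d i else 0

/-- The running maximum of the block `a`. -/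
noncomputable def blockMax (σ : ℕ → ℕ) (d : ℕ → ℝ) (a n : ℕ) : ℝ := runMax (blockSum σ d a) n

/-- The sum of the maxima of the first `K` blocks. -/
noncomputable def blockTotal (K : ℕ) (σ : ℕ → ℕ) (d : ℕ → ℝ) (n : ℕ) : ℝ :=
  ∑ a ∈ Finset.range K, blockMax σ d a n

/-- The square root of the sum of the squared maxima of the first `K` blocks. -/
noncomputable def blockNorm (K : ℕ) (σ : ℕ → ℕ) (d : ℕ → ℝ) (n : ℕ) : ℝ :=
  √(∑ a ∈ Finset.range K, blockMax σ d a n ^ 2)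

section Blocks

variable (K : ℕ) (σ : ℕ → ℕ) (d e : ℕ → ℝ)

lemma blockSum_succ (a n : ℕ) :
    blockSum σ d a (n + 1) = blockSum σ d a n + if σ n = a then d n else 0 :=
  Finset.sum_range_succ _ _

lemma blockMax_nonneg (a n : ℕ) : 0 ≤ blockMax σ d a n := runMax_nonneg _ _

lemma abs_blockSum_le (a : ℕ) {i n : ℕ} (h : i ≤ n) : |blockSum σ d a i| ≤ blockMax σ d a n :=
  abs_le_runMax _ h

lemma blockMax_mono (a : ℕ) : Monotone (blockMax σ d a) := runMax_mono _

lemma blockMax_zero (a : ℕ) : blockMax σ d a 0 = 0 := by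
  simp [blockMax, runMax, blockSum]

lemma blockMax_succ_of_ne {a n : ℕ} (h : σ n ≠ a) : blockMax σ d a (n + 1) = blockMax σ d a n := by
  have : blockSum σ d a (n + 1) = blockSum σ d a n := by rw [blockSum_succ, if_neg h, add_zero]
  change max (runMax _ n) |blockSum σ d a (n + 1)| = _
  rw [this]
  exact max_eq_left (abs_blockSum_le σ d a le_rfl)

lemma blockMax_succ_self (n : ℕ) :
    blockMax σ d (σ n) (n + 1) = max (blockMax σ d (σ n) n) |blockSum σ d (σ n) n + d n| := by
  change max (runMax _ n) |blockSum σ d (σ n) (n + 1)| = _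
  rw [blockSum_succ, if_pos rfl]
  rfl

lemma blockNorm_nonneg (n : ℕ) : 0 ≤ blockNorm K σ d n := Real.sqrt_nonneg _

lemma blockNorm_sq (n : ℕ) : blockNorm K σ d n ^ 2 = ∑ a ∈ Finset.range K, blockMax σ d a n ^ 2 :=
  Real.sq_sqrt (Finset.sum_nonneg fun _ _ => sq_nonneg _)

lemma blockNorm_mono : Monotone (blockNorm K σ d) := fun _ _ h =>
  Real.sqrt_le_sqrt (Finset.sum_le_sum fun a _ =>
    pow_le_pow_left₀ (blockMax_nonneg σ d a _) (blockMax_mono σ d a h) 2)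

lemma blockNorm_zero : blockNorm K σ d 0 = 0 := by simp [blockNorm, blockMax_zero]

lemma blockTotal_nonneg (n : ℕ) : 0 ≤ blockTotal K σ d n :=
  Finset.sum_nonneg fun _ _ => blockMax_nonneg _ _ _ _

lemma blockTotal_mono : Monotone (blockTotal K σ d) := fun _ _ h =>
  Finset.sum_le_sum fun a _ => blockMax_mono σ d a h

lemma blockTotal_zero : blockTotal K σ d 0 = 0 := by simp [blockTotal, blockMax_zero]

lemma blockMax_le_blockNorm {a : ℕ} (ha : a < K) (n : ℕ) : blockMax σ d a n ≤ blockNorm K σ d n :=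
  Real.le_sqrt_of_sq_le (Finset.single_le_sum (f := fun a => blockMax σ d a n ^ 2)
    (fun _ _ => sq_nonneg _) (Finset.mem_range.2 ha))

variable {K σ d e}

/-- At each time only the block `σ n` moves, so a sum over blocks changes in a single term. -/
lemma sum_block_succ (φ : ℝ → ℝ → ℝ) {n : ℕ} (hn : σ n < K) :
    ∑ a ∈ Finset.range K, φ (blockSum σ d a (n + 1)) (blockMax σ d a (n + 1)) =
      ∑ a ∈ Finset.range K, φ (blockSum σ d a n) (blockMax σ d a n)
        + φ (blockSum σ d (σ n) n + d n)
            (max (blockMax σ d (σ n) n) |blockSum σ d (σ n) n + d n|)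
        - φ (blockSum σ d (σ n) n) (blockMax σ d (σ n) n) := by
  have hm := Finset.mem_range.2 hn
  rw [← Finset.add_sum_erase _ _ hm, ← Finset.add_sum_erase _ (fun a =>
    φ (blockSum σ d a n) (blockMax σ d a n)) hm, blockMax_succ_self, blockSum_succ, if_pos rfl]
  have : ∀ a ∈ (Finset.range K).erase (σ n),
      φ (blockSum σ d a (n + 1)) (blockMax σ d a (n + 1)) =
        φ (blockSum σ d a n) (blockMax σ d a n) := by
    intro a ha
    have h : σ n ≠ a := (Finset.ne_of_mem_erase ha).symm
    rw [blockMax_succ_of_ne σ d h, blockSum_succ, if_neg h, add_zero]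
  rw [Finset.sum_congr rfl this]
  ring

lemma max_abs_add_le {u M d : ℝ} (h : |u| ≤ M) : max M |u + d| ≤ M + |d| :=
  max_le (by linarith [abs_nonneg d]) ((abs_add_le _ _).trans (by linarith))

lemma blockTotal_succ_le {n : ℕ} (hn : σ n < K) :
    blockTotal K σ d (n + 1) ≤ blockTotal K σ d n + |d n| := by
  unfold blockTotal
  rw [sum_block_succ (fun _ M => M) hn]
  linarith [max_abs_add_le (d := d n) (abs_blockSum_le σ d (σ n) (le_refl n))]

lemma blockNorm_succ_le {n : ℕ} (hn : σ n < K) :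
    blockNorm K σ d (n + 1) ≤ blockNorm K σ d n + |d n| := by
  apply Real.sqrt_le_iff.2 ⟨add_nonneg (blockNorm_nonneg _ _ _ _) (abs_nonneg _), ?_⟩
  rw [sum_block_succ (fun _ M => M ^ 2) hn, ← blockNorm_sq]
  have h := max_abs_add_le (d := d n) (abs_blockSum_le σ d (σ n) (le_refl n))
  have h1 := blockMax_le_blockNorm K σ d hn n
  have h2 := blockMax_nonneg σ d (σ n) n
  have h3 : (max (blockMax σ d (σ n) n) |blockSum σ d (σ n) n + d n|) ^ 2
      ≤ (blockMax σ d (σ n) n + |d n|) ^ 2 := by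
    gcongr
  have h4 := mul_le_mul_of_nonneg_right h1 (abs_nonneg (d n))
  linarith

variable (K σ d)

/-- The bounded predictable integrand in the pathwise maximal inequality for `blockNorm`. -/
noncomputable def blockIntegrand (n : ℕ) : ℝ :=
  (4 * blockSum σ d (σ n) n
      - 2 * blockMax σ d (σ n) n * (blockSum σ d (σ n) n / |blockSum σ d (σ n) n|)
      - 4 * ∑ i ∈ Finset.range n, d i) /
    max (blockNorm K σ d n) (4 * runMax (fun k => ∑ i ∈ Finset.range k, d i) n)

variable {K σ d}

/-- The numerator is at most `6 * M + 4 * |x|`; here `M` is at most the block norm and `4 * |x|` at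
most four times the running maximum, each bounded by the normalization. -/
lemma abs_blockIntegrand_num_le {n : ℕ} (hn : σ n < K) :
    abs (4 * blockSum σ d (σ n) n
      - 2 * blockMax σ d (σ n) n * (blockSum σ d (σ n) n / |blockSum σ d (σ n) n|)
      - 4 * ∑ i ∈ Finset.range n, d i) ≤
    7 * max (blockNorm K σ d n) (4 * runMax (fun k => ∑ i ∈ Finset.range k, d i) n) := by
  set u := blockSum σ d (σ n) n
  set M := blockMax σ d (σ n) n
  set x : ℕ → ℝ := fun k => ∑ i ∈ Finset.range k, d i
  have h1 : |u| ≤ M := abs_blockSum_le σ d (σ n) (le_refl n)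
  have h2 : M ≤ blockNorm K σ d n := blockMax_le_blockNorm K σ d hn n
  have h3 : |x n| ≤ runMax x n := abs_le_runMax x le_rfl
  have h4 : abs (u / |u|) ≤ 1 := by
    rw [abs_div, abs_abs]; exact div_self_le_one _
  have h5 : abs (M * (u / |u|)) ≤ M * 1 := by
    have hM : 0 ≤ M := blockMax_nonneg _ _ _ _
    rw [abs_mul, abs_of_nonneg hM]
    exact mul_le_mul_of_nonneg_left h4 hM
  have h6 := le_max_left (blockNorm K σ d n) (4 * runMax x n)
  have h7 := le_max_right (blockNorm K σ d n) (4 * runMax x n)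
  rw [abs_le] at h1 h3 h5 ⊢
  change _ ≤ _ - 4 * x n ∧ _ - 4 * x n ≤ _
  constructor <;> linarith [h1.1, h1.2, h3.1, h3.2, h5.1, h5.2]

lemma abs_blockIntegrand_le {n : ℕ} (hn : σ n < K) : |blockIntegrand K σ d n| ≤ 7 := by
  unfold blockIntegrand
  have h0 : 0 ≤ max (blockNorm K σ d n) (4 * runMax (fun k => ∑ i ∈ Finset.range k, d i) n) :=
    (blockNorm_nonneg _ _ _ _).trans (le_max_left _ _)
  rw [abs_div, abs_of_nonneg h0]
  exact div_le_of_le_mul₀ h0 (by norm_num) (abs_blockIntegrand_num_le hn)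

/-- A pathwise maximal inequality for vector-valued sequences moving one coordinate at a time. -/
lemma blockNorm_le_runMax {N : ℕ} (hN : ∀ n < N, σ n < K) :
    blockNorm K σ d N ≤
      4 * ∑ n ∈ Finset.range N, blockIntegrand K σ d n * d n
        + 144 * runMax (fun k => ∑ i ∈ Finset.range k, d i) N := by
  set x : ℕ → ℝ := fun k => ∑ i ∈ Finset.range k, d i with hx
  set F := blockNorm K σ d with hF
  set Q := runMax x with hQ
  set G : ℕ → ℝ := fun n => ∑ a ∈ Finset.range K, blockPot (blockSum σ d a n) (blockMax σ d a n)
    with hG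
  have hG1 : ∀ n, F n ^ 2 / 2 ≤ G n := by
    intro n
    rw [hF, blockNorm_sq, Finset.sum_div]
    exact Finset.sum_le_sum fun a _ => blockPot_ge _ _
  have hG2 : ∀ n, G n ≤ F n ^ 2 := by
    intro n
    rw [hF, blockNorm_sq]
    exact Finset.sum_le_sum fun a _ => blockPot_le (abs_blockSum_le _ _ _ le_rfl)
  have key : ∀ n ≤ N, (G n - 2 * x n ^ 2) / max (F n) (4 * Q n) + 3 / 8 * max (F n) (4 * Q n) ≤
      ∑ k ∈ Finset.range n, blockIntegrand K σ d k * d k + 36 * Q n := by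
    intro n
    induction n with
    | zero =>
      intro _
      have : G 0 = 0 := by simp [hG, blockSum, blockMax_zero, blockPot]
      simp [hF, this, hQ, runMax, hx, blockNorm_zero]
    | succ n ih =>
      intro hn
      have hσ := hN n (by omega)
      have h1 : x (n + 1) = x n + d n := Finset.sum_range_succ _ _
      have h2 : Q (n + 1) = max (Q n) |x n + d n| := by rw [hQ, runMax, h1]
      have h3 := vector_max_step (x := x n) (d := d n) (blockNorm_nonneg K σ d n)
        (abs_le_runMax x (le_refl n)) (blockNorm_mono K σ d n.le_succ) (blockNorm_succ_le hσ)
        (hG1 n) (hG1 (n + 1)) (hG2 (n + 1)) (abs_blockIntegrand_num_le hσ) (by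
          have h4 : G (n + 1) = G n + _ - _ := sum_block_succ blockPot hσ
          have h5 := blockPot_step (d := d n) (abs_blockSum_le σ d (σ n) (le_refl n))
          rw [h4]
          change _ ≤ _ + (_ - 4 * x n) * d n
          linarith)
      rw [Finset.sum_range_succ, h1, h2]
      have h6 := ih (by omega)
      rw [h1] at *
      have h7 : blockIntegrand K σ d n = _ / max (F n) (4 * Q n) := rfl
      rw [h7]
      linarith
  have h := key N le_rfl
  set c := max (F N) (4 * Q N) with hc
  have h1 : F N ≤ c := le_max_left _ _
  have h2 : 4 * Q N ≤ c := le_max_right _ _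
  have hQ0 : 0 ≤ Q N := runMax_nonneg _ _
  have hc0 : 0 ≤ c := by linarith
  -- At the final time `3/8 - 1/8 = 1/4` of `c` remains, hence the factor `4` and `144 = 4 * 36`.
  have h3 : -(c / 8) ≤ (G N - 2 * x N ^ 2) / c := by
    rcases hc0.eq_or_lt with h | h
    · rw [← h]; simp
    rw [le_div_iff₀ h]
    have h4 : x N ^ 2 ≤ Q N ^ 2 := by
      rw [← sq_abs]
      exact pow_le_pow_left₀ (abs_nonneg _) (abs_le_runMax x le_rfl) 2
    have h5 : (4 * Q N) ^ 2 ≤ c ^ 2 := by gcongr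
    have h6 := hG1 N
    have h7 := sq_nonneg (F N)
    linarith
  linarith

lemma blockMax_add_le (a n : ℕ) :
    blockMax σ (d + e) a n ≤ blockMax σ d a n + blockMax σ e a n := by
  refine runMax_le fun i hi => ?_
  have : blockSum σ (d + e) a i = blockSum σ d a i + blockSum σ e a i := by
    simp only [blockSum, ← Finset.sum_add_distrib]
    refine Finset.sum_congr rfl fun j _ => ?_
    split_ifs <;> simp
  rw [this]
  exact (abs_add_le _ _).trans (add_le_add (abs_blockSum_le _ _ _ hi) (abs_blockSum_le _ _ _ hi))

lemma blockTotal_add_le (n : ℕ) :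
    blockTotal K σ (d + e) n ≤ blockTotal K σ d n + blockTotal K σ e n := by
  unfold blockTotal
  rw [← Finset.sum_add_distrib]
  exact Finset.sum_le_sum fun a _ => blockMax_add_le a n

lemma blockNorm_add_le (n : ℕ) :
    blockNorm K σ (d + e) n ≤ blockNorm K σ d n + blockNorm K σ e n := by
  refine Real.sqrt_le_iff.2 ⟨add_nonneg (blockNorm_nonneg _ _ _ _) (blockNorm_nonneg _ _ _ _), ?_⟩
  have h1 : ∑ a ∈ Finset.range K, blockMax σ (d + e) a n ^ 2 ≤
      ∑ a ∈ Finset.range K, (blockMax σ d a n + blockMax σ e a n) ^ 2 :=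
    Finset.sum_le_sum fun a _ =>
      pow_le_pow_left₀ (blockMax_nonneg _ _ _ _) (blockMax_add_le a n) 2
  refine h1.trans ?_
  have h2 := Real.sum_mul_le_sqrt_mul_sqrt (Finset.range K) (fun a => blockMax σ d a n)
    (fun a => blockMax σ e a n)
  simp only [add_sq, Finset.sum_add_distrib, ← blockNorm_sq, mul_assoc, ← Finset.mul_sum]
  change _ ≤ blockNorm K σ d n * blockNorm K σ e n at h2
  linarith

lemma blockMax_truncate_le (a i n : ℕ) :
    blockMax σ (fun k => if k < i then d k else 0) a n ≤ blockMax σ d a i := by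
  refine runMax_le fun j _ => ?_
  have : blockSum σ (fun k => if k < i then d k else 0) a j = blockSum σ d a (min j i) := by
    unfold blockSum
    have hsub : Finset.range (min j i) ⊆ Finset.range j :=
      Finset.range_subset_range.2 (min_le_left _ _)
    rw [← Finset.sum_subset hsub]
    · refine Finset.sum_congr rfl fun k hk => ?_
      simp only [if_pos (show k < i by rw [Finset.mem_range] at hk; omega)]
    · intro k hk hk'
      rw [Finset.mem_range] at hk hk'
      simp only [if_neg (show ¬ k < i by omega), ite_self]
  rw [this]
  exact abs_blockSum_le _ _ _ (min_le_right _ _)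

lemma eq_truncate_add (d : ℕ → ℝ) (i : ℕ) :
    d = (fun k => if k < i then d k else 0) + fun k => if i ≤ k then d k else 0 := by
  ext k
  rcases lt_or_ge k i with h | h
  · simp [h, not_le.2 h]
  · simp [h, not_lt.2 h]

/-- By subadditivity the growth after time `i` is bounded by the same functional of the tail. This
gives the conditional hypothesis of the Garsia–Neveu lemma from the unconditional bound for
restarted differences. -/
lemma blockTotal_le_add_tail (i n : ℕ) :
    blockTotal K σ d n ≤ blockTotal K σ d i
      + blockTotal K σ (fun k => if i ≤ k then d k else 0) n := by
  conv_lhs => rw [eq_truncate_add d i]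
  refine (blockTotal_add_le n).trans (add_le_add ?_ le_rfl)
  exact Finset.sum_le_sum fun a _ => blockMax_truncate_le a i n

lemma blockNorm_le_add_tail (i n : ℕ) :
    blockNorm K σ d n ≤ blockNorm K σ d i
      + blockNorm K σ (fun k => if i ≤ k then d k else 0) n := by
  conv_lhs => rw [eq_truncate_add d i]
  refine (blockNorm_add_le n).trans (add_le_add ?_ le_rfl)
  exact Real.sqrt_le_sqrt (Finset.sum_le_sum fun a _ =>
    pow_le_pow_left₀ (blockMax_nonneg _ _ _ _) (blockMax_truncate_le a i n) 2)

/-! ### Predictable weights and the normalized transform -/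

/-- Summation by parts against a nonnegative nondecreasing weight. -/
lemma abs_sum_mul_le_of_monotone {w y : ℕ → ℝ} (hw : Monotone w) (hw0 : 0 ≤ w 0) {m : ℝ} (n : ℕ)
    (hm : ∀ k ≤ n, |∑ i ∈ Finset.range k, y i| ≤ m) :
    |∑ i ∈ Finset.range n, w i * y i| ≤ 2 * w n * m := by
  have key : ∀ n, (∑ i ∈ Finset.range n, w i * y i) = w n * ∑ i ∈ Finset.range n, y i
      - ∑ i ∈ Finset.range n, (w (i + 1) - w i) * ∑ j ∈ Finset.range (i + 1), y j := by
    intro n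
    induction n with
    | zero => simp
    | succ n ih =>
      rw [Finset.sum_range_succ, ih, Finset.sum_range_succ _ n, Finset.sum_range_succ _ n,
        Finset.sum_range_succ _ n]
      ring
  have hwn : ∀ k, 0 ≤ w k := fun k => hw0.trans (hw (Nat.zero_le k))
  have hm0 : 0 ≤ m := by simpa using hm 0 (Nat.zero_le n)
  have h1 : |w n * ∑ i ∈ Finset.range n, y i| ≤ w n * m := by
    rw [abs_mul, abs_of_nonneg (hwn n)]
    exact mul_le_mul_of_nonneg_left (hm n le_rfl) (hwn n)
  have h2 : |∑ i ∈ Finset.range n, (w (i + 1) - w i) * ∑ j ∈ Finset.range (i + 1), y j| ≤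
      ∑ i ∈ Finset.range n, (w (i + 1) - w i) * m := by
    refine (Finset.abs_sum_le_sum_abs _ _).trans (Finset.sum_le_sum fun i hi => ?_)
    have h3 : 0 ≤ w (i + 1) - w i := sub_nonneg.2 (hw i.le_succ)
    rw [abs_mul, abs_of_nonneg h3]
    exact mul_le_mul_of_nonneg_left (hm _ (Finset.mem_range.1 hi)) h3
  rw [← Finset.sum_mul, Finset.sum_range_sub] at h2
  rw [key]
  have h3 := abs_sub (w n * ∑ i ∈ Finset.range n, y i)
    (∑ i ∈ Finset.range n, (w (i + 1) - w i) * ∑ j ∈ Finset.range (i + 1), y j)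
  have h4 := mul_nonneg hw0 hm0
  linarith

lemma blockTotal_mul_le {w : ℕ → ℝ} (hw : Monotone w) (hw0 : 0 ≤ w 0) (n : ℕ) :
    blockTotal K σ (fun k => w k * d k) n ≤ 2 * w n * blockTotal K σ d n := by
  unfold blockTotal
  rw [Finset.mul_sum]
  refine Finset.sum_le_sum fun a _ => runMax_le fun i hi => ?_
  have h : blockSum σ (fun k => w k * d k) a i =
      ∑ j ∈ Finset.range i, w j * if σ j = a then d j else 0 := by
    simp only [blockSum, mul_ite, mul_zero]
  rw [h]
  refine (abs_sum_mul_le_of_monotone hw hw0 i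
    fun k hk => abs_blockSum_le σ d a (hk.trans hi)).trans ?_
  have := blockMax_nonneg σ d a n
  gcongr
  exact hw hi

/-- The left side is a lower Riemann sum of the integral of `τ ^ (-s)` over `[y, x]`; the proof is
the concavity of the power `1 - s`. -/
lemma sub_mul_rpow_neg_le {x y s : ℝ} (hy : 0 ≤ y) (hyx : y ≤ x) (hs0 : 0 < s) (hs1 : s < 1) :
    (x - y) * x ^ (-s) ≤ (1 - s)⁻¹ * (x ^ (1 - s) - y ^ (1 - s)) := by
  rcases (hy.trans hyx).eq_or_lt with h | h
  · have : y = 0 := le_antisymm (hyx.trans h.ge) hy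
    simp [← h, this]
  have h1 : (1 + (y / x - 1)) ^ (1 - s) ≤ 1 + (1 - s) * (y / x - 1) :=
    rpow_one_add_le_one_add_mul_self (by have := div_nonneg hy h.le; linarith)
      (by linarith) (by linarith)
  rw [add_sub_cancel, Real.div_rpow hy h.le, div_le_iff₀ (by positivity)] at h1
  have h2 : x ^ (1 - s) = x * x ^ (-s) := by
    rw [sub_eq_add_neg, Real.rpow_add h, Real.rpow_one]
  have h3 : (1 + (1 - s) * (y / x - 1)) * x ^ (1 - s)
      = x ^ (1 - s) - (1 - s) * ((x - y) * x ^ (-s)) := by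
    rw [h2]; field_simp; ring
  rw [h3] at h1
  have hs : 0 < 1 - s := by linarith
  rw [inv_mul_eq_div, le_div_iff₀ hs]
  linarith

/-- The square functions of the blocks of a transform by the normalized integrand
`F ^ (-s) * u`, where `u` is the current block value of `d` and `F = blockNorm K σ d`. -/
lemma sum_block_square_le {s : ℝ} (hs0 : 0 < s) (hs1 : s < 1) (N : ℕ) :
    ∑ a ∈ Finset.range K, √(∑ i ∈ Finset.range N, (if σ i = a then
        blockNorm K σ d i ^ (-s) * blockSum σ d (σ i) i * e i else 0) ^ 2) ≤
      √((1 - s)⁻¹) * (blockNorm K σ d N ^ (1 - s) * √(∑ i ∈ Finset.range N, e i ^ 2)) := by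
  set z : ℕ → ℕ → ℝ := fun a n => blockMax σ d a n ^ 2 with hz
  set v : ℕ → ℝ := fun n => blockNorm K σ d n ^ 2 with hv
  have hvz : ∀ n, v n = ∑ a ∈ Finset.range K, z a n := blockNorm_sq K σ d
  have hv0 : ∀ n, 0 ≤ v n := fun n => sq_nonneg _
  have hvm : Monotone v := fun i j h =>
    pow_le_pow_left₀ (blockNorm_nonneg _ _ _ _) (blockNorm_mono K σ d h) 2
  have hzm : ∀ a, Monotone (z a) := fun a i j h =>
    pow_le_pow_left₀ (blockMax_nonneg _ _ _ _) (blockMax_mono σ d a h) 2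
  -- `β a` is a Stieltjes sum of `v ^ (-s)` against the squared maximum `z a`. It dominates `v n ^
  -- (-s) * z a n` at all times, because `v ^ (-s)` decreases, and unlike a supremum over `n` it can
  -- be summed over `a`: the total is a Stieltjes sum against `v` itself. Cauchy–Schwarz over the
  -- blocks then finishes.
  set β : ℕ → ℝ := fun a => ∑ i ∈ Finset.range N, (z a (i + 1) - z a i) * v (i + 1) ^ (-s) with hβ
  have hβterm : ∀ a i, 0 ≤ (z a (i + 1) - z a i) * v (i + 1) ^ (-s) := fun a i =>
    mul_nonneg (sub_nonneg.2 (hzm a i.le_succ)) (Real.rpow_nonneg (hv0 _) _)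
  have hβ0 : ∀ a, 0 ≤ β a := fun a => Finset.sum_nonneg fun i _ => hβterm a i
  have hzv : ∀ a < K, ∀ n ≤ N, v n ^ (-s) * z a n ≤ β a := by
    intro a ha n hn
    have hzn : z a n ≤ v n := by
      rw [hvz]
      exact Finset.single_le_sum (f := fun a => z a n) (fun _ _ => sq_nonneg _)
        (Finset.mem_range.2 ha)
    rcases (hv0 n).eq_or_lt with h | h
    · have : z a n = 0 := le_antisymm (hzn.trans h.ge) (sq_nonneg _)
      rw [this, mul_zero]
      exact hβ0 a
    have h1 : z a n = ∑ i ∈ Finset.range n, (z a (i + 1) - z a i) := by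
      rw [Finset.sum_range_sub]
      simp [hz, blockMax_zero]
    calc v n ^ (-s) * z a n = ∑ i ∈ Finset.range n, (z a (i + 1) - z a i) * v n ^ (-s) := by
          conv_lhs => rw [h1]
          rw [Finset.mul_sum]
          exact Finset.sum_congr rfl fun _ _ => mul_comm _ _
      _ ≤ ∑ i ∈ Finset.range n, (z a (i + 1) - z a i) * v (i + 1) ^ (-s) := by
          refine Finset.sum_le_sum fun i hi => ?_
          have hin : i + 1 ≤ n := Finset.mem_range.1 hi
          -- The power `0 ^ (-s)` is `0`, so antitonicity of the negative power fails at the origin;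
          -- there the increment of `z a` vanishes.
          rcases (hv0 (i + 1)).eq_or_lt with h2 | h2
          · have h3 : z a (i + 1) ≤ 0 := by
              rw [h2, hvz]
              exact Finset.single_le_sum (f := fun a => z a (i + 1)) (fun _ _ => sq_nonneg _)
                (Finset.mem_range.2 ha)
            have h4 : z a i ≤ z a (i + 1) := hzm a i.le_succ
            have h5 : 0 ≤ z a i := sq_nonneg _
            have h6 : z a (i + 1) - z a i = 0 := by linarith
            rw [h6]; simp
          · exact mul_le_mul_of_nonneg_left
              (Real.rpow_le_rpow_of_nonpos h2 (hvm hin) (by linarith))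
              (sub_nonneg.2 (hzm a i.le_succ))
      _ ≤ β a := Finset.sum_le_sum_of_subset_of_nonneg (Finset.range_subset_range.2 hn)
          fun i _ _ => hβterm a i
  have hβsum : ∑ a ∈ Finset.range K, β a ≤ (1 - s)⁻¹ * v N ^ (1 - s) := by
    rw [hβ, Finset.sum_comm]
    calc ∑ i ∈ Finset.range N, ∑ a ∈ Finset.range K, (z a (i + 1) - z a i) * v (i + 1) ^ (-s)
        = ∑ i ∈ Finset.range N, (v (i + 1) - v i) * v (i + 1) ^ (-s) := by
          refine Finset.sum_congr rfl fun i _ => ?_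
          rw [← Finset.sum_mul, Finset.sum_sub_distrib, ← hvz, ← hvz]
      _ ≤ ∑ i ∈ Finset.range N, (1 - s)⁻¹ * (v (i + 1) ^ (1 - s) - v i ^ (1 - s)) :=
          Finset.sum_le_sum fun i _ => sub_mul_rpow_neg_le (hv0 i) (hvm i.le_succ) hs0 hs1
      _ = (1 - s)⁻¹ * v N ^ (1 - s) := by
          rw [← Finset.mul_sum, Finset.sum_range_sub (fun i => v i ^ (1 - s))]
          have : v 0 = 0 := by simp [hv, blockNorm_zero]
          rw [this, Real.zero_rpow (by linarith), sub_zero]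
  set ε : ℕ → ℝ := fun a => ∑ i ∈ Finset.range N, (if σ i = a then e i ^ 2 else 0) with hε
  have hε0 : ∀ a, 0 ≤ ε a := fun a => Finset.sum_nonneg fun i _ => by split_ifs <;> positivity
  have hεsum : ∑ a ∈ Finset.range K, ε a ≤ ∑ i ∈ Finset.range N, e i ^ 2 := by
    rw [hε, Finset.sum_comm]
    refine Finset.sum_le_sum fun i _ => ?_
    rw [Finset.sum_ite_eq]
    split_ifs
    exacts [le_rfl, sq_nonneg _]
  have hS : ∀ a ∈ Finset.range K, √(∑ i ∈ Finset.range N, (if σ i = a then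
        blockNorm K σ d i ^ (-s) * blockSum σ d (σ i) i * e i else 0) ^ 2) ≤ √(β a) * √(ε a) := by
    intro a ha
    rw [← Real.sqrt_mul (hβ0 a), hε, Finset.mul_sum]
    refine Real.sqrt_le_sqrt (Finset.sum_le_sum fun i hi => ?_)
    split_ifs with h
    · have h1 : (blockNorm K σ d i ^ (-s)) ^ 2 = v i ^ (-s) := by
        change _ = (blockNorm K σ d i ^ 2) ^ (-s)
        rw [← Real.rpow_natCast, ← Real.rpow_natCast, ← Real.rpow_mul (blockNorm_nonneg _ _ _ _),
          ← Real.rpow_mul (blockNorm_nonneg _ _ _ _), mul_comm]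
      rw [mul_pow, mul_pow, h1]
      refine mul_le_mul_of_nonneg_right ?_ (sq_nonneg _)
      refine le_trans ?_ (hzv a (Finset.mem_range.1 ha) i (Finset.mem_range.1 hi).le)
      refine mul_le_mul_of_nonneg_left ?_ (Real.rpow_nonneg (hv0 _) _)
      rw [h, ← sq_abs]
      exact pow_le_pow_left₀ (abs_nonneg _) (abs_blockSum_le _ _ _ le_rfl) 2
    · simp
  refine (Finset.sum_le_sum hS).trans ?_
  refine (Real.sum_sqrt_mul_sqrt_le _ hβ0 hε0).trans ?_
  have h1 : √(v N ^ (1 - s)) = blockNorm K σ d N ^ (1 - s) := by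
    change √((blockNorm K σ d N ^ 2) ^ (1 - s)) = _
    rw [Real.sqrt_eq_rpow, ← Real.rpow_natCast, ← Real.rpow_mul (blockNorm_nonneg _ _ _ _),
      ← Real.rpow_mul (blockNorm_nonneg _ _ _ _)]
    congr 1
    push_cast
    ring
  rw [← h1, ← mul_assoc, ← Real.sqrt_mul (inv_nonneg.2 (by linarith))]
  exact mul_le_mul (Real.sqrt_le_sqrt hβsum) (Real.sqrt_le_sqrt hεsum) (Real.sqrt_nonneg _)
    (Real.sqrt_nonneg _)

/-- With singleton blocks, `blockNorm` is the square function. -/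
lemma sqrt_sum_sq_le_blockNorm (d : ℕ → ℝ) (N : ℕ) :
    √(∑ i ∈ Finset.range N, d i ^ 2) ≤ blockNorm N id d N := by
  refine Real.sqrt_le_sqrt (Finset.sum_le_sum fun a ha => ?_)
  rw [← sq_abs]
  refine pow_le_pow_left₀ (abs_nonneg _) ?_ 2
  have h : blockSum id d a (a + 1) = d a := by
    simp [blockSum]
  have h1 := abs_blockSum_le id d a (show a + 1 ≤ N from Finset.mem_range.1 ha)
  rwa [h] at h1

end Blocks

/-! ### Measurability of the block functionals -/

section Measurability

variable {Ω : Type*} {m : MeasurableSpace Ω}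

lemma measurable_runMax {x : ℕ → Ω → ℝ} {n : ℕ} (hx : ∀ i ≤ n, Measurable (x i)) :
    Measurable fun ω => runMax (fun i => x i ω) n := by
  induction n with
  | zero => exact (hx 0 le_rfl).abs
  | succ n ih => exact (ih fun i hi => hx i (by omega)).max (hx _ le_rfl).abs

lemma measurable_blockSum {σ : ℕ → Ω → ℕ} {d : ℕ → Ω → ℝ} {n : ℕ} {a : Ω → ℕ} (ha : Measurable a)
    (hσ : ∀ i < n, Measurable (σ i)) (hd : ∀ i < n, Measurable (d i)) :
    Measurable fun ω => blockSum (fun i => σ i ω) (fun i => d i ω) (a ω) n := by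
  refine Finset.measurable_sum _ fun i hi => ?_
  have hi := Finset.mem_range.1 hi
  exact Measurable.ite (measurableSet_eq_fun (hσ i hi) ha) (hd i hi) measurable_const

lemma measurable_blockMax {σ : ℕ → Ω → ℕ} {d : ℕ → Ω → ℝ} {n : ℕ} {a : Ω → ℕ} (ha : Measurable a)
    (hσ : ∀ i < n, Measurable (σ i)) (hd : ∀ i < n, Measurable (d i)) :
    Measurable fun ω => blockMax (fun i => σ i ω) (fun i => d i ω) (a ω) n :=
  measurable_runMax (x := fun i ω => blockSum (fun i => σ i ω) (fun i => d i ω) (a ω) i)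
    fun i hi => measurable_blockSum ha (fun j hj => hσ j (by omega)) fun j hj => hd j (by omega)

lemma measurable_blockNorm (K : ℕ) {σ : ℕ → Ω → ℕ} {d : ℕ → Ω → ℝ} {n : ℕ}
    (hσ : ∀ i < n, Measurable (σ i)) (hd : ∀ i < n, Measurable (d i)) :
    Measurable fun ω => blockNorm K (fun i => σ i ω) (fun i => d i ω) n :=
  (Finset.measurable_sum _ fun _ _ =>
    (measurable_blockMax measurable_const hσ hd).pow_const 2).sqrt

lemma measurable_blockTotal (K : ℕ) {σ : ℕ → Ω → ℕ} {d : ℕ → Ω → ℝ} {n : ℕ}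
    (hσ : ∀ i < n, Measurable (σ i)) (hd : ∀ i < n, Measurable (d i)) :
    Measurable fun ω => blockTotal K (fun i => σ i ω) (fun i => d i ω) n :=
  Finset.measurable_sum _ fun _ _ => measurable_blockMax measurable_const hσ hd

lemma measurable_partialSum {d : ℕ → Ω → ℝ} {n : ℕ} (hd : ∀ i < n, Measurable (d i)) :
    Measurable fun ω => ∑ i ∈ Finset.range n, d i ω :=
  Finset.measurable_sum _ fun i hi => hd i (Finset.mem_range.1 hi)

lemma measurable_blockIntegrand (K : ℕ) {σ : ℕ → Ω → ℕ} {d : ℕ → Ω → ℝ} {n : ℕ}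
    (hσ : ∀ i ≤ n, Measurable (σ i)) (hd : ∀ i < n, Measurable (d i)) :
    Measurable fun ω => blockIntegrand K (fun i => σ i ω) (fun i => d i ω) n := by
  have hσ' : ∀ i < n, Measurable (σ i) := fun i hi => hσ i hi.le
  have h1 := measurable_blockSum (hσ n le_rfl) hσ' hd
  have h2 := measurable_blockMax (hσ n le_rfl) hσ' hd
  have h3 := measurable_blockNorm K hσ' hd
  have h4 := measurable_runMax (n := n) (x := fun k ω => ∑ i ∈ Finset.range k, d i ω)
    fun k hk => measurable_partialSum fun i hi => hd i (by omega)
  unfold blockIntegrand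
  exact (((h1.const_mul 4).sub ((h2.const_mul 2).mul (h1.div h1.abs))).sub
    ((measurable_partialSum hd).const_mul 4)).div (h3.max (h4.const_mul 4))

lemma measurable_davisIntegrand {d : ℕ → Ω → ℝ} {n : ℕ} (hd : ∀ i < n, Measurable (d i)) :
    Measurable fun ω => davisIntegrand (fun i => d i ω) n := by
  have h4 := measurable_runMax (n := n) (x := fun k ω => ∑ i ∈ Finset.range k, d i ω)
    fun k hk => measurable_partialSum fun i hi => hd i (by omega)
  unfold davisIntegrand
  exact (measurable_partialSum hd).div
    (h4.max (measurable_partialSum fun i hi => (hd i hi).pow_const 2).sqrt)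

end Measurability

/-! ### Martingale differences and `L^1` bounds -/

/-- A martingale difference sequence; `d n` is the increment from time `n` to time `n + 1`. -/
structure IsMartingaleDiff {Ω : Type*} {mΩ : MeasurableSpace Ω} (ℱ : Filtration ℕ mΩ)
    (μ : Measure Ω) (d : ℕ → Ω → ℝ) : Prop where
  measurable' : ∀ n, Measurable[ℱ (n + 1)] (d n)
  integrable : ∀ n, Integrable (d n) μ
  condExp_eq_zero : ∀ n, μ[d n | ℱ n] =ᵐ[μ] 0

section Probability

variable {Ω : Type*} {mΩ : MeasurableSpace Ω} {μ : Measure Ω}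
  {ℱ : Filtration ℕ mΩ} {d : ℕ → Ω → ℝ}

lemma IsMartingaleDiff.measurable_of_lt (hd : IsMartingaleDiff ℱ μ d) {i n : ℕ} (h : i < n) :
    Measurable[ℱ n] (d i) :=
  (hd.measurable' i).mono (ℱ.mono h) le_rfl

lemma IsMartingaleDiff.measurable (hd : IsMartingaleDiff ℱ μ d) (i : ℕ) : Measurable (d i) :=
  (hd.measurable' i).mono (ℱ.le _) le_rfl

lemma IsMartingaleDiff.transform (hd : IsMartingaleDiff ℱ μ d) {h : ℕ → Ω → ℝ}
    (hh : ∀ n, Measurable[ℱ n] (h n)) (hi : ∀ n, Integrable (fun ω => h n ω * d n ω) μ) :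
    IsMartingaleDiff ℱ μ (fun n ω => h n ω * d n ω) where
  measurable' n := ((hh n).mono (ℱ.mono n.le_succ) le_rfl).mul (hd.measurable' n)
  integrable := hi
  condExp_eq_zero n := by
    have h1 := condExp_mul_of_stronglyMeasurable_left (μ := μ) (hh n).stronglyMeasurable
      (hi n) (hd.integrable n)
    filter_upwards [h1, hd.condExp_eq_zero n] with ω h1 h2
    have h3 : (fun ω => h n ω * d n ω) = h n * d n := rfl
    rw [h3, h1, Pi.mul_apply, h2]
    simp

lemma IsMartingaleDiff.integrable_bdd_mul (hd : IsMartingaleDiff ℱ μ d) {n : ℕ} {h : Ω → ℝ}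
    (hh : Measurable[ℱ n] h) {C : ℝ} (hC : ∀ ω, |h ω| ≤ C) :
    Integrable (fun ω => h ω * d n ω) μ :=
  (hd.integrable n).bdd_mul (c := C) (hh.mono (ℱ.le n) le_rfl).aestronglyMeasurable
    (ae_of_all _ hC)

/-- The transform of a martingale by a bounded predictable integrand has mean zero, so pathwise
inequalities integrate. -/
lemma IsMartingaleDiff.integral_le [IsProbabilityMeasure μ]
    (hd : IsMartingaleDiff ℱ μ d) {N : ℕ} {h : ℕ → Ω → ℝ}
    (hh : ∀ n < N, Measurable[ℱ n] (h n)) {C c : ℝ} (hC : ∀ n < N, ∀ ω, |h n ω| ≤ C)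
    {X Y : Ω → ℝ} (hX : Integrable X μ) (hY : Integrable Y μ)
    (hXY : ∀ ω, X ω ≤ c * (∑ n ∈ Finset.range N, h n ω * d n ω) + Y ω) :
    ∫ ω, X ω ∂μ ≤ ∫ ω, Y ω ∂μ := by
  have hterm : ∀ n ∈ Finset.range N, Integrable (fun ω => h n ω * d n ω) μ := fun n hn =>
    hd.integrable_bdd_mul (hh n (Finset.mem_range.1 hn)) (hC n (Finset.mem_range.1 hn))
  have hsum := integrable_finsetSum _ hterm
  have hzero : ∀ n ∈ Finset.range N, ∫ ω, h n ω * d n ω ∂μ = 0 := by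
    intro n hn
    have h1 := condExp_mul_of_stronglyMeasurable_left (μ := μ)
      (hh n (Finset.mem_range.1 hn)).stronglyMeasurable (hterm n hn) (hd.integrable n)
    rw [← integral_condExp (ℱ.le n)]
    refine (integral_congr_ae (g := fun _ => 0) ?_).trans (by simp)
    filter_upwards [h1, hd.condExp_eq_zero n] with ω h1 h2
    have h3 : (fun ω => h n ω * d n ω) = h n * d n := rfl
    rw [h3, h1, Pi.mul_apply, h2]
    simp
  calc ∫ ω, X ω ∂μ ≤ ∫ ω, (c * (∑ n ∈ Finset.range N, h n ω * d n ω) + Y ω) ∂μ :=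
        integral_mono hX ((hsum.const_mul c).add hY) hXY
    _ = ∫ ω, Y ω ∂μ := by
        rw [integral_add (hsum.const_mul c) hY, integral_const_mul, integral_finsetSum _ hterm,
          Finset.sum_eq_zero hzero]
        simp

lemma runMax_le_sum_abs (d : ℕ → ℝ) (N : ℕ) :
    runMax (fun k => ∑ i ∈ Finset.range k, d i) N ≤ ∑ i ∈ Finset.range N, |d i| :=
  runMax_le fun _ hi => (Finset.abs_sum_le_sum_abs _ _).trans
    (Finset.sum_le_sum_of_subset_of_nonneg (Finset.range_subset_range.2 hi)
      fun _ _ _ => abs_nonneg _)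

lemma sqrt_sum_sq_le_sum_abs (d : ℕ → ℝ) (N : ℕ) :
    √(∑ i ∈ Finset.range N, d i ^ 2) ≤ ∑ i ∈ Finset.range N, |d i| := by
  refine Real.sqrt_le_iff.2 ⟨Finset.sum_nonneg fun _ _ => abs_nonneg _, ?_⟩
  simp only [← sq_abs (d _)]
  exact Finset.sum_sq_le_sq_sum_of_nonneg fun _ _ => abs_nonneg _

lemma blockTotal_le_sum_abs (K : ℕ) {σ : ℕ → ℕ} (d : ℕ → ℝ) {N : ℕ} (hN : ∀ n < N, σ n < K) :
    blockTotal K σ d N ≤ ∑ i ∈ Finset.range N, |d i| := by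
  induction N with
  | zero => simp [blockTotal_zero]
  | succ n ih =>
    rw [Finset.sum_range_succ]
    have h1 := ih fun k hk => hN k (by omega)
    have h2 := blockTotal_succ_le (d := d) (hN n (by omega))
    linarith

lemma blockNorm_le_sum_abs (K : ℕ) {σ : ℕ → ℕ} (d : ℕ → ℝ) {N : ℕ} (hN : ∀ n < N, σ n < K) :
    blockNorm K σ d N ≤ ∑ i ∈ Finset.range N, |d i| := by
  induction N with
  | zero => simp [blockNorm_zero]
  | succ n ih =>
    rw [Finset.sum_range_succ]
    have h1 := ih fun k hk => hN k (by omega)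
    have h2 := blockNorm_succ_le (d := d) (hN n (by omega))
    linarith

lemma integrable_of_le_sum_abs (hd : ∀ n, Integrable (d n) μ) {X : Ω → ℝ} {N : ℕ}
    (hX : Measurable X) (h0 : ∀ ω, 0 ≤ X ω) (h : ∀ ω, X ω ≤ ∑ i ∈ Finset.range N, |d i ω|) :
    Integrable X μ := by
  refine (integrable_finsetSum (Finset.range N) fun i _ => (hd i).abs).mono'
    hX.aestronglyMeasurable (ae_of_all _ fun ω => ?_)
  rw [Real.norm_eq_abs, abs_of_nonneg (h0 ω)]
  exact h ω

/-- Davis' inequality. -/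
lemma IsMartingaleDiff.integral_runMax_le [IsProbabilityMeasure μ]
    (hd : IsMartingaleDiff ℱ μ d) (N : ℕ) :
    ∫ ω, runMax (fun k => ∑ i ∈ Finset.range k, d i ω) N ∂μ ≤
      18 * ∫ ω, √(∑ i ∈ Finset.range N, d i ω ^ 2) ∂μ := by
  rw [← integral_const_mul]
  refine hd.integral_le (N := N) (C := 1) (c := 2)
    (h := fun n ω => davisIntegrand (fun i => d i ω) n)
    (fun n _ => measurable_davisIntegrand fun i hi => hd.measurable_of_lt hi)
    (fun n _ ω => abs_davisIntegrand_le _ _) ?_ ?_ fun ω => runMax_le_davis _ N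
  · exact integrable_of_le_sum_abs (N := N) hd.integrable
      (measurable_runMax fun k _ => measurable_partialSum fun i _ => hd.measurable i)
      (fun ω => runMax_nonneg _ _) fun ω => runMax_le_sum_abs _ N
  · exact (integrable_of_le_sum_abs (N := N) hd.integrable
      (measurable_partialSum fun i _ => (hd.measurable i).pow_const 2).sqrt
      (fun ω => Real.sqrt_nonneg _) fun ω => sqrt_sum_sq_le_sum_abs _ N).const_mul 18

lemma IsMartingaleDiff.integral_blockNorm_le [IsProbabilityMeasure μ]
    (hd : IsMartingaleDiff ℱ μ d) {K N : ℕ}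
    {σ : ℕ → Ω → ℕ} (hσ : ∀ n, Measurable[ℱ n] (σ n)) (hσK : ∀ n < N, ∀ ω, σ n ω < K) :
    ∫ ω, blockNorm K (fun i => σ i ω) (fun i => d i ω) N ∂μ ≤
      144 * ∫ ω, runMax (fun k => ∑ i ∈ Finset.range k, d i ω) N ∂μ := by
  rw [← integral_const_mul]
  refine hd.integral_le (N := N) (C := 7) (c := 4)
    (h := fun n ω => blockIntegrand K (fun i => σ i ω) (fun i => d i ω) n)
    (fun n _ => measurable_blockIntegrand K (fun i hi => (hσ i).mono (ℱ.mono hi) le_rfl)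
      fun i hi => hd.measurable_of_lt hi)
    (fun n hn ω => abs_blockIntegrand_le (hσK n hn ω)) ?_ ?_
    fun ω => blockNorm_le_runMax fun n hn => hσK n hn ω
  · exact integrable_of_le_sum_abs (N := N) hd.integrable
      (measurable_blockNorm K (fun i _ => (hσ i).mono (ℱ.le i) le_rfl) fun i _ => hd.measurable i)
      (fun ω => blockNorm_nonneg _ _ _ _) fun ω => blockNorm_le_sum_abs _ _ fun n hn => hσK n hn ω
  · exact (integrable_of_le_sum_abs (N := N) hd.integrable
      (measurable_runMax fun k _ => measurable_partialSum fun i _ => hd.measurable i)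
      (fun ω => runMax_nonneg _ _) fun ω => runMax_le_sum_abs _ N).const_mul 144

end Probability

/-! ### The Garsia–Neveu lemma and Doob's inequality -/

section Garsia

variable {Ω : Type*} {mΩ : MeasurableSpace Ω} {μ : Measure Ω}

/-- The hypothesis compares the measures with densities `X` and `Y` on the smaller σ-algebra, and
nonnegative measurable functions integrate monotonically in the measure. -/
lemma lintegral_mul_le_of_setLIntegral_le {Ω : Type*} {m mΩ : MeasurableSpace Ω} {μ : Measure Ω}
    (hm : m ≤ mΩ) {X Y : Ω → ℝ≥0∞}
    (hX : Measurable X) (hY : Measurable Y)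
    (h : ∀ E, MeasurableSet[m] E → ∫⁻ ω in E, X ω ∂μ ≤ ∫⁻ ω in E, Y ω ∂μ)
    {φ : Ω → ℝ≥0∞} (hφ : Measurable[m] φ) :
    ∫⁻ ω, φ ω * X ω ∂μ ≤ ∫⁻ ω, φ ω * Y ω ∂μ := by
  have key : ∀ Z : Ω → ℝ≥0∞, Measurable Z →
      ∫⁻ ω, φ ω * Z ω ∂μ = ∫⁻ ω, φ ω ∂((μ.withDensity Z).trim hm) := by
    intro Z hZ
    rw [lintegral_trim hm hφ, lintegral_withDensity_eq_lintegral_mul _ hZ (hφ.mono hm le_rfl)]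
    exact lintegral_congr fun ω => mul_comm _ _
  rw [key X hX, key Y hY]
  refine lintegral_mono' ?_ le_rfl
  rw [Measure.le_iff]
  intro E hE
  rw [trim_measurableSet_eq hm hE, trim_measurableSet_eq hm hE, withDensity_apply _ (hm _ hE),
    withDensity_apply _ (hm _ hE)]
  exact h E hE

lemma setLIntegral_ofReal_le {X Y : Ω → ℝ} (hX : Integrable X μ) (hY : Integrable Y μ)
    (hX0 : ∀ ω, 0 ≤ X ω) (hY0 : ∀ ω, 0 ≤ Y ω) {E : Set Ω}
    (h : ∫ ω in E, X ω ∂μ ≤ ∫ ω in E, Y ω ∂μ) :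
    ∫⁻ ω in E, ENNReal.ofReal (X ω) ∂μ ≤ ∫⁻ ω in E, ENNReal.ofReal (Y ω) ∂μ := by
  rw [← ofReal_integral_eq_lintegral_ofReal hX.integrableOn (ae_of_all _ hX0),
    ← ofReal_integral_eq_lintegral_ofReal hY.integrableOn (ae_of_all _ hY0)]
  exact ENNReal.ofReal_le_ofReal h

lemma eLpNorm_ofReal_eq {r : ℝ} (hr : 0 < r) {A : Ω → ℝ} (hA0 : ∀ ω, 0 ≤ A ω) :
    eLpNorm A (ENNReal.ofReal r) μ = (∫⁻ ω, ENNReal.ofReal (A ω) ^ r ∂μ) ^ (1 / r) := by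
  rw [eLpNorm_eq_lintegral_rpow_enorm_toReal (by simpa using hr) ENNReal.ofReal_ne_top,
    ENNReal.toReal_ofReal hr.le]
  congr 1
  refine lintegral_congr fun ω => ?_
  rw [Real.enorm_eq_ofReal (hA0 ω)]

/-- Hölder with exponents `r / (r - 1)` and `r`, followed by division by the `(r - 1)`-st power of
the norm of `A`; the finiteness of that norm is what permits the division. -/
lemma eLpNorm_le_of_lintegral_rpow_le {r : ℝ} (hr : 1 ≤ r) {A B : Ω → ℝ} (hA : Measurable A)
    (hB : Measurable B) (hA0 : ∀ ω, 0 ≤ A ω) (hB0 : ∀ ω, 0 ≤ B ω)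
    (hfin : eLpNorm A (ENNReal.ofReal r) μ ≠ ∞) {c : ℝ≥0∞}
    (h : ∫⁻ ω, ENNReal.ofReal (A ω) ^ r ∂μ ≤
      c * ∫⁻ ω, ENNReal.ofReal (A ω) ^ (r - 1) * ENNReal.ofReal (B ω) ∂μ) :
    eLpNorm A (ENNReal.ofReal r) μ ≤ c * eLpNorm B (ENNReal.ofReal r) μ := by
  have hr0 : 0 < r := by linarith
  rw [eLpNorm_ofReal_eq hr0 hA0] at hfin ⊢
  rw [eLpNorm_ofReal_eq hr0 hB0]
  rcases hr.eq_or_lt with rfl | hr1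
  · simpa using h
  set I := ∫⁻ ω, ENNReal.ofReal (A ω) ^ r ∂μ with hI
  have hconj : (r / (r - 1)).HolderConjugate r :=
    (Real.HolderConjugate.conjExponent hr1).symm
  have h1 := ENNReal.lintegral_mul_le_Lp_mul_Lq μ hconj
    (f := fun ω => ENNReal.ofReal (A ω) ^ (r - 1)) (g := fun ω => ENNReal.ofReal (B ω))
    (hA.ennreal_ofReal.pow_const _).aemeasurable hB.ennreal_ofReal.aemeasurable
  have h2 : ∀ ω, (ENNReal.ofReal (A ω) ^ (r - 1)) ^ (r / (r - 1)) = ENNReal.ofReal (A ω) ^ r := by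
    intro ω
    rw [← ENNReal.rpow_mul, mul_div_cancel₀ _ (by linarith : r - 1 ≠ 0)]
  simp only [Pi.mul_apply, h2, ← hI] at h1
  have h3 : 1 / (r / (r - 1)) = 1 - 1 / r := by field_simp
  rw [h3] at h1
  have hItop : I ≠ ∞ := by
    intro htop
    rw [htop, ENNReal.top_rpow_of_pos (by positivity)] at hfin
    exact hfin rfl
  rcases eq_or_ne I 0 with h0 | h0
  · rw [h0, ENNReal.zero_rpow_of_pos (by positivity)]
    exact bot_le
  set b := (∫⁻ ω, ENNReal.ofReal (B ω) ^ r ∂μ) ^ (1 / r)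
  have h4 : I ≤ (c * b) * I ^ (1 - 1 / r) := by
    refine h.trans ((mul_le_mul_right h1 c).trans (le_of_eq ?_))
    ring
  have h5 : I ^ (1 / r) * I ^ (1 - 1 / r) = I := by
    rw [← ENNReal.rpow_add _ _ h0 hItop]
    simp
  have h6 : I ^ (1 - 1 / r) ≠ 0 := by
    simp [ENNReal.rpow_eq_zero_iff, h0, hItop]
  have h7 : I ^ (1 - 1 / r) ≠ ∞ := by
    simp [ENNReal.rpow_eq_top_iff, h0, hItop]
  conv at h4 => lhs; rw [← h5]
  exact (ENNReal.mul_le_mul_iff_left h6 h7).1 h4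

lemma rpow_sub_rpow_le {x y r : ℝ} (hy : 0 ≤ y) (hyx : y ≤ x) (hr : 1 ≤ r) :
    x ^ r - y ^ r ≤ r * (x ^ (r - 1) * (x - y)) := by
  rcases (hy.trans hyx).eq_or_lt with h | h
  · have : y = 0 := le_antisymm (hyx.trans h.ge) hy
    simp [← h, this]
  have h1 : 1 + r * (y / x - 1) ≤ (1 + (y / x - 1)) ^ r :=
    one_add_mul_self_le_rpow_one_add (by have := div_nonneg hy h.le; linarith) hr
  rw [add_sub_cancel, Real.div_rpow hy h.le, le_div_iff₀ (by positivity)] at h1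
  have h2 : x ^ r = x * x ^ (r - 1) := by
    conv_rhs => rw [← Real.rpow_one_add' h.le (by linarith)]
    congr 1
    ring
  have h3 : (1 + r * (y / x - 1)) * x ^ r = x ^ r - r * (x ^ (r - 1) * (x - y)) := by
    rw [h2]; field_simp; ring
  linarith

variable {ℱ : Filtration ℕ mΩ}

/-- The Garsia–Neveu inequality for a nondecreasing adapted process with controlled jumps. -/
lemma eLpNorm_le_of_garsia {r : ℝ} (hr : 1 ≤ r) {A : ℕ → Ω → ℝ} {B : Ω → ℝ} {N : ℕ}
    (hA : ∀ n, Measurable[ℱ n] (A n)) (hB : Measurable B) (hmono : ∀ ω, Monotone fun n => A n ω)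
    (hzero : ∀ ω, A 0 ω = 0) (hB0 : ∀ ω, 0 ≤ B ω) (hAi : ∀ n ≤ N, Integrable (A n) μ)
    (hBi : Integrable B μ) (hfin : eLpNorm (A N) (ENNReal.ofReal r) μ ≠ ∞)
    (hjump : ∀ n < N, ∀ ω, A (n + 1) ω - A n ω ≤ B ω)
    (hcond : ∀ n ≤ N, ∀ E, MeasurableSet[ℱ n] E →
      ∫ ω in E, (A N ω - A n ω) ∂μ ≤ ∫ ω in E, B ω ∂μ) :
    eLpNorm (A N) (ENNReal.ofReal r) μ ≤
      ENNReal.ofReal (2 * r) * eLpNorm B (ENNReal.ofReal r) μ := by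
  have hA0 : ∀ n ω, 0 ≤ A n ω := fun n ω => (hzero ω).symm.le.trans (hmono ω (Nat.zero_le n))
  have hAm : ∀ n, Measurable (A n) := fun n => (hA n).mono (ℱ.le n) le_rfl
  refine eLpNorm_le_of_lintegral_rpow_le hr (hAm N) hB (hA0 N) hB0 hfin ?_
  -- For `r = 1` the initial weight `θ 0` is `0 ^ 0 = 1`, so its term has to be carried along; for
  -- `r > 1` it is zero.
  set θ : ℕ → Ω → ℝ := fun n ω => A n ω ^ (r - 1) with hθ
  have hθm : ∀ n, Measurable[ℱ n] (θ n) := fun n => (hA n).pow_const _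
  have hθmono : ∀ ω, Monotone fun n => θ n ω := fun ω i j hij =>
    Real.rpow_le_rpow (hA0 i ω) (hmono ω hij) (by linarith)
  have hθ0 : ∀ n ω, 0 ≤ θ n ω := fun n ω => Real.rpow_nonneg (hA0 n ω) _
  have hsum : ∀ n ω, ∑ i ∈ Finset.range n, θ (i + 1) ω * (A (i + 1) ω - A i ω) =
      θ 0 ω * A n ω + ∑ i ∈ Finset.range n, (θ (i + 1) ω - θ i ω) * (A n ω - A i ω) := by
    intro n ω
    induction n with
    | zero => simp [hzero]
    | succ n ih =>
      have h1 : ∑ i ∈ Finset.range n, (θ (i + 1) ω - θ i ω) * (A (n + 1) ω - A i ω) =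
          ∑ i ∈ Finset.range n, (θ (i + 1) ω - θ i ω) * (A n ω - A i ω)
          + (θ n ω - θ 0 ω) * (A (n + 1) ω - A n ω) := by
        rw [← Finset.sum_range_sub (fun i => θ i ω), Finset.sum_mul, ← Finset.sum_add_distrib]
        exact Finset.sum_congr rfl fun i _ => by ring
      rw [Finset.sum_range_succ, Finset.sum_range_succ, ih, h1]
      ring
  -- The weight `θ (i + 1) - θ i` is known only at time `i + 1`, so `A N - A i` is split into `A N -
  -- A (i + 1)`, controlled conditionally, and a jump, controlled pointwise by `B`.
  have hpt : ∀ ω, A N ω ^ r ≤ r * (θ 0 ω * (A N ω - A 0 ω) +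
      ∑ i ∈ Finset.range N, (θ (i + 1) ω - θ i ω) * (A N ω - A (i + 1) ω + B ω)) := by
    intro ω
    have h1 : A N ω ^ r = ∑ i ∈ Finset.range N, (A (i + 1) ω ^ r - A i ω ^ r) := by
      rw [Finset.sum_range_sub (fun i => A i ω ^ r), hzero, Real.zero_rpow (by linarith), sub_zero]
    calc A N ω ^ r ≤ ∑ i ∈ Finset.range N, r * (θ (i + 1) ω * (A (i + 1) ω - A i ω)) := by
          rw [h1]
          exact Finset.sum_le_sum fun i _ =>
            rpow_sub_rpow_le (hA0 i ω) (hmono ω i.le_succ) hr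
      _ = r * (θ 0 ω * A N ω + ∑ i ∈ Finset.range N, (θ (i + 1) ω - θ i ω) * (A N ω - A i ω)) := by
          rw [← Finset.mul_sum, hsum]
      _ ≤ _ := by
          rw [hzero, sub_zero]
          gcongr with i hi
          · exact sub_nonneg.2 (hθmono ω i.le_succ)
          · linarith [hjump i (Finset.mem_range.1 hi) ω]
  set b : Ω → ℝ≥0∞ := fun ω => ENNReal.ofReal (B ω) with hb
  have hbm : Measurable b := hB.ennreal_ofReal
  have hstep : ∀ n ≤ N, ∀ φ : Ω → ℝ≥0∞, Measurable[ℱ n] φ →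
      ∫⁻ ω, φ ω * ENNReal.ofReal (A N ω - A n ω) ∂μ ≤ ∫⁻ ω, φ ω * b ω ∂μ := by
    intro n hn φ hφ
    refine lintegral_mul_le_of_setLIntegral_le (ℱ.le n) ((hAm N).sub (hAm n)).ennreal_ofReal hbm
      (fun E hE => ?_) hφ
    exact setLIntegral_ofReal_le ((hAi N le_rfl).sub (hAi n hn)) hBi
      (fun ω => sub_nonneg.2 (hmono ω hn)) hB0 (hcond n hn E hE)
  set η : ℕ → Ω → ℝ≥0∞ := fun i ω => ENNReal.ofReal (θ (i + 1) ω - θ i ω) with hη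
  have hηm : ∀ i, Measurable[ℱ (i + 1)] (η i) := fun i =>
    ((hθm (i + 1)).sub ((hθm i).mono (ℱ.mono i.le_succ) le_rfl)).ennreal_ofReal
  have hηm' : ∀ i, Measurable (η i) := fun i => (hηm i).mono (ℱ.le _) le_rfl
  have hθm' : Measurable fun ω => ENNReal.ofReal (θ 0 ω) :=
    ((hθm 0).mono (ℱ.le _) le_rfl).ennreal_ofReal
  have hηb : ∀ i, Measurable fun ω => η i ω * b ω := fun i => (hηm' i).mul hbm
  have hη2b : ∀ i, Measurable fun ω => η i ω * (2 * b ω) := fun i =>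
    (hηm' i).mul (hbm.const_mul 2)
  have hθ2b : Measurable fun ω => ENNReal.ofReal (θ 0 ω) * (2 * b ω) :=
    hθm'.mul (hbm.const_mul 2)
  have hone : ∀ i ∈ Finset.range N,
      ∫⁻ ω, η i ω * ENNReal.ofReal (A N ω - A (i + 1) ω + B ω) ∂μ ≤ ∫⁻ ω, η i ω * (2 * b ω) ∂μ := by
    intro i hi
    have hi' : i + 1 ≤ N := Finset.mem_range.1 hi
    calc ∫⁻ ω, η i ω * ENNReal.ofReal (A N ω - A (i + 1) ω + B ω) ∂μ
        = ∫⁻ ω, η i ω * ENNReal.ofReal (A N ω - A (i + 1) ω) ∂μ + ∫⁻ ω, η i ω * b ω ∂μ := by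
          rw [← lintegral_add_right _ (hηb i)]
          refine lintegral_congr fun ω => ?_
          rw [ENNReal.ofReal_add (sub_nonneg.2 (hmono ω hi')) (hB0 ω), mul_add]
      _ ≤ ∫⁻ ω, η i ω * b ω ∂μ + ∫⁻ ω, η i ω * b ω ∂μ :=
          add_le_add (hstep (i + 1) hi' _ (hηm i)) le_rfl
      _ = ∫⁻ ω, η i ω * (2 * b ω) ∂μ := by
          rw [← lintegral_add_right _ (hηb i)]
          refine lintegral_congr fun ω => ?_
          ring
  calc ∫⁻ ω, ENNReal.ofReal (A N ω) ^ r ∂μ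
      ≤ ∫⁻ ω, ENNReal.ofReal r * (ENNReal.ofReal (θ 0 ω) * ENNReal.ofReal (A N ω - A 0 ω) +
          ∑ i ∈ Finset.range N, η i ω * ENNReal.ofReal (A N ω - A (i + 1) ω + B ω)) ∂μ := by
        refine lintegral_mono fun ω => ?_
        rw [ENNReal.ofReal_rpow_of_nonneg (hA0 N ω) (by linarith)]
        refine (ENNReal.ofReal_le_ofReal (hpt ω)).trans ?_
        rw [ENNReal.ofReal_mul (by linarith)]
        gcongr
        refine ENNReal.ofReal_add_le.trans ?_
        rw [ENNReal.ofReal_mul (hθ0 0 ω), ENNReal.ofReal_sum_of_nonneg]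
        · gcongr with i hi
          rw [ENNReal.ofReal_mul (sub_nonneg.2 (hθmono ω i.le_succ))]
        · intro i hi
          exact mul_nonneg (sub_nonneg.2 (hθmono ω i.le_succ)) (add_nonneg
            (sub_nonneg.2 (hmono ω (Finset.mem_range.1 hi))) (hB0 ω))
    _ = ENNReal.ofReal r * (∫⁻ ω, ENNReal.ofReal (θ 0 ω) * ENNReal.ofReal (A N ω - A 0 ω) ∂μ +
          ∑ i ∈ Finset.range N, ∫⁻ ω, η i ω * ENNReal.ofReal (A N ω - A (i + 1) ω + B ω) ∂μ) := by
        have hterm : ∀ i ∈ Finset.range N, Measurable fun ω =>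
            η i ω * ENNReal.ofReal (A N ω - A (i + 1) ω + B ω) := fun i _ =>
          (hηm' i).mul (((hAm N).sub (hAm (i + 1))).add hB).ennreal_ofReal
        rw [lintegral_const_mul' _ _ ENNReal.ofReal_ne_top,
          lintegral_add_right _ (Finset.measurable_sum _ hterm), lintegral_finsetSum _ hterm]
    _ ≤ ENNReal.ofReal r * (∫⁻ ω, ENNReal.ofReal (θ 0 ω) * (2 * b ω) ∂μ +
          ∑ i ∈ Finset.range N, ∫⁻ ω, η i ω * (2 * b ω) ∂μ) := by
        refine mul_le_mul' le_rfl (add_le_add ?_ (Finset.sum_le_sum fun i hi => ?_))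
        · refine (hstep 0 (Nat.zero_le N) _ (hθm 0).ennreal_ofReal).trans ?_
          refine lintegral_mono fun ω => ?_
          gcongr
          exact le_mul_of_one_le_left bot_le one_le_two
        · exact hone i hi
    _ = ENNReal.ofReal (2 * r) * ∫⁻ ω, ENNReal.ofReal (A N ω) ^ (r - 1) * b ω ∂μ := by
        rw [← lintegral_finsetSum _ fun i _ => hη2b i, ← lintegral_add_left hθ2b, mul_comm 2 r, ENNReal.ofReal_mul (by linarith),
          mul_assoc]
        congr 1
        rw [← lintegral_const_mul' _ _ (by simp)]
        refine lintegral_congr fun ω => ?_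
        have : ENNReal.ofReal (A N ω) ^ (r - 1) =
            ENNReal.ofReal (θ 0 ω) + ∑ i ∈ Finset.range N, η i ω := by
          rw [ENNReal.ofReal_rpow_of_nonneg (hA0 N ω) (by linarith),
            ← ENNReal.ofReal_sum_of_nonneg fun i _ => sub_nonneg.2 (hθmono ω i.le_succ),
            Finset.sum_range_sub (fun i => θ i ω),
            ← ENNReal.ofReal_add (hθ0 0 ω) (sub_nonneg.2 (hθmono ω (Nat.zero_le N)))]
          congr 1
          ring
        rw [this, add_mul, Finset.sum_mul, mul_add, Finset.mul_sum, ENNReal.ofReal_ofNat]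
        congr 1
        · ring
        · exact Finset.sum_congr rfl fun i _ => by ring

/-- Convexity of the power `p / (p - 1)` applied to `x ^ (p - 1)`; this form puts the increment on
the power `p - 1`, as Doob's argument needs. -/
lemma rpow_sub_rpow_le_of_one_lt {x y p : ℝ} (hy : 0 ≤ y) (hyx : y ≤ x) (hp : 1 < p) :
    x ^ p - y ^ p ≤ p / (p - 1) * ((x ^ (p - 1) - y ^ (p - 1)) * x) := by
  have hx := hy.trans hyx
  have hp1 : 0 < p - 1 := by linarith
  have h := rpow_sub_rpow_le (x := x ^ (p - 1)) (y := y ^ (p - 1)) (r := p / (p - 1))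
    (Real.rpow_nonneg hy _) (Real.rpow_le_rpow hy hyx hp1.le) (by
      rw [le_div_iff₀ hp1]; linarith)
  have e1 : ∀ z : ℝ, 0 ≤ z → (z ^ (p - 1)) ^ (p / (p - 1)) = z ^ p := by
    intro z hz
    rw [← Real.rpow_mul hz, mul_div_cancel₀ _ hp1.ne']
  have e2 : (x ^ (p - 1)) ^ (p / (p - 1) - 1) = x := by
    rw [← Real.rpow_mul hx]
    have : (p - 1) * (p / (p - 1) - 1) = 1 := by field_simp; ring
    rw [this, Real.rpow_one]
  rw [e1 x hx, e1 y hy, e2] at h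
  linarith

lemma measurable_div_abs {Ω : Type*} {m : MeasurableSpace Ω} {x : Ω → ℝ} (hx : Measurable x) :
    Measurable fun ω => x ω / |x ω| :=
  hx.div hx.abs

/-- Doob's maximal inequality in `L^p`. -/
lemma IsMartingaleDiff.eLpNorm_runMax_le [IsProbabilityMeasure μ] {d : ℕ → Ω → ℝ}
    (hd : IsMartingaleDiff ℱ μ d) {p : ℝ} (hp : 1 < p) (N : ℕ)
    (hfin : eLpNorm (fun ω => runMax (fun k => ∑ i ∈ Finset.range k, d i ω) N)
      (ENNReal.ofReal p) μ ≠ ∞) :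
    eLpNorm (fun ω => runMax (fun k => ∑ i ∈ Finset.range k, d i ω) N) (ENNReal.ofReal p) μ ≤
      ENNReal.ofReal (p / (p - 1)) *
        eLpNorm (fun ω => ∑ i ∈ Finset.range N, d i ω) (ENNReal.ofReal p) μ := by
  have hp1 : 0 < p - 1 := by linarith
  set x : ℕ → Ω → ℝ := fun k ω => ∑ i ∈ Finset.range k, d i ω with hx
  set M : ℕ → Ω → ℝ := fun n ω => runMax (fun k => x k ω) n with hM
  have hxm : ∀ n, Measurable[ℱ n] (x n) := fun n =>
    measurable_partialSum fun i hi => hd.measurable_of_lt hi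
  have hMm : ∀ n, Measurable[ℱ n] (M n) := fun n =>
    measurable_runMax fun i hi => (hxm i).mono (ℱ.mono hi) le_rfl
  have hxi : ∀ n, Integrable (x n) μ := fun n =>
    integrable_finsetSum _ fun i _ => hd.integrable i
  have hM0 : ∀ n ω, 0 ≤ M n ω := fun n ω => runMax_nonneg _ _
  have hMmono : ∀ ω, Monotone fun n => M n ω := fun ω => runMax_mono _
  rw [← eLpNorm_norm (x N)]
  refine eLpNorm_le_of_lintegral_rpow_le hp.le ((hMm N).mono (ℱ.le N) le_rfl)
    ((hxm N).mono (ℱ.le N) le_rfl).norm (hM0 N) (fun ω => norm_nonneg _) hfin ?_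
  set θ : ℕ → Ω → ℝ := fun n ω => M n ω ^ (p - 1) with hθ
  have hθm : ∀ n, Measurable[ℱ n] (θ n) := fun n => (hMm n).pow_const _
  have hθmono : ∀ ω, Monotone fun n => θ n ω := fun ω i j hij =>
    Real.rpow_le_rpow (hM0 i ω) (hMmono ω hij) hp1.le
  have hMzero : ∀ ω, M 0 ω = 0 := fun ω => by simp [hM, runMax, hx]
  have hpt : ∀ ω, M N ω ^ p ≤ p / (p - 1) *
      ∑ i ∈ Finset.range N, (θ (i + 1) ω - θ i ω) * |x (i + 1) ω| := by
    intro ω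
    have h1 : M N ω ^ p = ∑ i ∈ Finset.range N, (M (i + 1) ω ^ p - M i ω ^ p) := by
      rw [Finset.sum_range_sub (fun i => M i ω ^ p), hMzero, Real.zero_rpow (by linarith), sub_zero]
    rw [h1, Finset.mul_sum]
    refine Finset.sum_le_sum fun i _ => ?_
    have h2 := rpow_sub_rpow_le_of_one_lt (hM0 i ω) (hMmono ω i.le_succ) hp
    refine h2.trans (le_of_eq ?_)
    congr 1
    -- The weight `θ` grows only when a new maximum is attained, and then the maximum equals `|x (i
    -- + 1) ω|`.
    have h3 : M (i + 1) ω = max (M i ω) |x (i + 1) ω| := rfl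
    rcases max_choice (M i ω) |x (i + 1) ω| with h | h
    · simp only [hθ, h3, h, sub_self, zero_mul]
    · simp only [hθ, h3, h]
  have hstep : ∀ n ≤ N, ∀ φ : Ω → ℝ≥0∞, Measurable[ℱ n] φ →
      ∫⁻ ω, φ ω * ENNReal.ofReal |x n ω| ∂μ ≤ ∫⁻ ω, φ ω * ENNReal.ofReal ‖x N ω‖ ∂μ := by
    intro n hn φ hφ
    refine lintegral_mul_le_of_setLIntegral_le (ℱ.le n)
      ((hxm n).mono (ℱ.le n) le_rfl).abs.ennreal_ofReal
      ((hxm N).mono (ℱ.le N) le_rfl).norm.ennreal_ofReal (fun E hE => ?_) hφ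
    refine setLIntegral_ofReal_le (hxi n).abs (hxi N).norm (fun ω => abs_nonneg _)
      (fun ω => norm_nonneg _) ?_
    -- The submartingale property of the modulus: testing the increments after time `n` with the
    -- sign of `x n` on `E` bounds `|x n|` by `|x N|` in mean.
    set ψ : Ω → ℝ := fun ω => E.indicator (fun ω => x n ω / |x n ω|) ω with hψ
    have hψm : Measurable[ℱ n] ψ := (measurable_div_abs (hxm n)).indicator hE
    have hψ1 : ∀ ω, |ψ ω| ≤ E.indicator 1 ω := by
      intro ω
      by_cases h : ω ∈ E
      · simp only [hψ, Set.indicator_of_mem h, Pi.one_apply]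
        rw [abs_div, abs_abs]; exact div_self_le_one _
      · simp [hψ, Set.indicator_of_notMem h]
    have hE' := ℱ.le n _ hE
    rw [← integral_indicator hE', ← integral_indicator hE']
    refine hd.integral_le (N := N) (C := 1) (c := -1)
      (h := fun k ω => if n ≤ k then ψ ω else 0) ?_ ?_ ((hxi n).abs.indicator hE')
      ((hxi N).norm.indicator hE') ?_
    · intro k _
      by_cases h : n ≤ k
      · simpa only [h, if_true] using hψm.mono (ℱ.mono h) le_rfl
      · simp only [h, if_false]
        exact measurable_const
    · intro k _ ω
      have h1 := hψ1 ω
      have h2 : E.indicator (1 : Ω → ℝ) ω ≤ 1 := Set.indicator_le_self' (by simp) ω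
      split_ifs
      · exact h1.trans h2
      · simp
    · intro ω
      have h1 : ∑ k ∈ Finset.range N, (if n ≤ k then ψ ω else 0) * d k ω =
          ψ ω * (x N ω - x n ω) := by
        have h2 : x N ω - x n ω = ∑ k ∈ Finset.Ico n N, d k ω :=
          (Finset.sum_Ico_eq_sub (fun k => d k ω) hn).symm
        rw [h2, Finset.mul_sum, Finset.range_eq_Ico,
          ← Finset.sum_Ico_consecutive _ (Nat.zero_le n) hn]
        rw [Finset.sum_eq_zero, zero_add]
        · exact Finset.sum_congr rfl fun k hk => by rw [if_pos (Finset.mem_Ico.1 hk).1]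
        · intro k hk
          rw [if_neg (by have := (Finset.mem_Ico.1 hk).2; omega), zero_mul]
      rw [h1]
      by_cases h : ω ∈ E
      · have h3 : ψ ω * x n ω = |x n ω| := by
          simp only [hψ, Set.indicator_of_mem h]
          rcases eq_or_ne (x n ω) 0 with h0 | h0
          · simp [h0]
          · have := abs_ne_zero.2 h0
            field_simp
            rw [sq_abs]
        have h4 : |ψ ω * x N ω| ≤ 1 * |x N ω| := by
          rw [abs_mul]
          gcongr
          simpa [h] using hψ1 ω
        rw [Set.indicator_of_mem h, Set.indicator_of_mem h, Real.norm_eq_abs]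
        linarith [le_abs_self (ψ ω * x N ω)]
      · simp [hψ, Set.indicator_of_notMem h]
  set η : ℕ → Ω → ℝ≥0∞ := fun i ω => ENNReal.ofReal (θ (i + 1) ω - θ i ω) with hη
  have hηm : ∀ i, Measurable[ℱ (i + 1)] (η i) := fun i =>
    ((hθm (i + 1)).sub ((hθm i).mono (ℱ.mono i.le_succ) le_rfl)).ennreal_ofReal
  have hηm' : ∀ i, Measurable (η i) := fun i => (hηm i).mono (ℱ.le _) le_rfl
  have hxm' : ∀ n, Measurable (x n) := fun n => (hxm n).mono (ℱ.le n) le_rfl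
  calc ∫⁻ ω, ENNReal.ofReal (M N ω) ^ p ∂μ
      ≤ ∫⁻ ω, ENNReal.ofReal (p / (p - 1)) *
          ∑ i ∈ Finset.range N, η i ω * ENNReal.ofReal |x (i + 1) ω| ∂μ := by
        refine lintegral_mono fun ω => ?_
        rw [ENNReal.ofReal_rpow_of_nonneg (hM0 N ω) (by linarith)]
        refine (ENNReal.ofReal_le_ofReal (hpt ω)).trans ?_
        rw [ENNReal.ofReal_mul (by positivity), ENNReal.ofReal_sum_of_nonneg]
        · gcongr with i hi
          rw [ENNReal.ofReal_mul (sub_nonneg.2 (hθmono ω i.le_succ))]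
        · exact fun i _ => mul_nonneg (sub_nonneg.2 (hθmono ω i.le_succ)) (abs_nonneg _)
    _ = ENNReal.ofReal (p / (p - 1)) *
          ∑ i ∈ Finset.range N, ∫⁻ ω, η i ω * ENNReal.ofReal |x (i + 1) ω| ∂μ := by
        rw [lintegral_const_mul' _ _ ENNReal.ofReal_ne_top, lintegral_finsetSum]
        exact fun i _ => (hηm' i).mul (hxm' (i + 1)).abs.ennreal_ofReal
    _ ≤ ENNReal.ofReal (p / (p - 1)) *
          ∑ i ∈ Finset.range N, ∫⁻ ω, η i ω * ENNReal.ofReal ‖x N ω‖ ∂μ := by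
        refine mul_le_mul' le_rfl (Finset.sum_le_sum fun i hi => ?_)
        exact hstep (i + 1) (Finset.mem_range.1 hi) _ (hηm i)
    _ = ENNReal.ofReal (p / (p - 1)) *
          ∫⁻ ω, ENNReal.ofReal (M N ω) ^ (p - 1) * ENNReal.ofReal ‖x N ω‖ ∂μ := by
        have hηx : ∀ i, Measurable fun ω => η i ω * ENNReal.ofReal ‖x N ω‖ := fun i =>
          (hηm' i).mul (hxm' N).norm.ennreal_ofReal
        rw [← lintegral_finsetSum _ fun i _ => hηx i]
        congr 1
        refine lintegral_congr fun ω => ?_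
        rw [← Finset.sum_mul, ← ENNReal.ofReal_sum_of_nonneg
          fun i _ => sub_nonneg.2 (hθmono ω i.le_succ), Finset.sum_range_sub (fun i => θ i ω),
          ENNReal.ofReal_rpow_of_nonneg (hM0 N ω) hp1.le]
        simp only [hθ, hMzero, Real.zero_rpow hp1.ne', sub_zero]

end Garsia

/-! ### Moment bounds for block maxima -/

/-- The sum of the square functions of the first `K` blocks. -/
noncomputable def blockSquare (K : ℕ) (σ : ℕ → ℕ) (d : ℕ → ℝ) (N : ℕ) : ℝ :=
  ∑ a ∈ Finset.range K, √(∑ i ∈ Finset.range N, (if σ i = a then d i else 0) ^ 2)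

section BlockSquare

variable {K : ℕ} {σ : ℕ → ℕ} {d e : ℕ → ℝ} {N : ℕ}

lemma blockSquare_nonneg : 0 ≤ blockSquare K σ d N :=
  Finset.sum_nonneg fun _ _ => Real.sqrt_nonneg _

lemma blockSquare_mono_of_abs_le (h : ∀ i < N, |d i| ≤ |e i|) :
    blockSquare K σ d N ≤ blockSquare K σ e N := by
  refine Finset.sum_le_sum fun a _ => Real.sqrt_le_sqrt (Finset.sum_le_sum fun i hi => ?_)
  split_ifs
  · exact sq_le_sq.2 (h i (Finset.mem_range.1 hi))
  · exact le_rfl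

lemma abs_le_blockSquare {n : ℕ} (hn : n < N) (hσ : σ n < K) : |d n| ≤ blockSquare K σ d N := by
  refine le_trans ?_ (Finset.single_le_sum
    (f := fun a => √(∑ i ∈ Finset.range N, (if σ i = a then d i else 0) ^ 2))
    (fun _ _ => Real.sqrt_nonneg _) (Finset.mem_range.2 hσ))
  apply Real.le_sqrt_of_sq_le
  rw [sq_abs]
  refine le_trans (by simp) (Finset.single_le_sum
    (f := fun i => (if σ i = σ n then d i else 0) ^ 2) (fun _ _ => sq_nonneg _)
    (Finset.mem_range.2 hn))

lemma blockTotal_congr (h : ∀ i < N, d i = e i) : blockTotal K σ d N = blockTotal K σ e N := by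
  have key : ∀ d e : ℕ → ℝ, (∀ i < N, d i = e i) → blockTotal K σ d N ≤ blockTotal K σ e N := by
    intro d e h
    refine Finset.sum_le_sum fun a _ => runMax_le fun i hi => ?_
    have : blockSum σ d a i = blockSum σ e a i := by
      refine Finset.sum_congr rfl fun j hj => ?_
      rw [h j (by rw [Finset.mem_range] at hj; omega)]
    rw [this]
    exact abs_blockSum_le σ e a hi
  exact le_antisymm (key d e h) (key e d fun i hi => (h i hi).symm)

end BlockSquare

section MaximalBounds

variable {Ω : Type*} {mΩ : MeasurableSpace Ω} {μ : Measure Ω} [IsProbabilityMeasure μ]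
  {ℱ : Filtration ℕ mΩ} {d : ℕ → Ω → ℝ}

/-- The increments after time `n`, restricted to an event known at time `n`. -/
noncomputable def restartedDiff (n : ℕ) (E : Set Ω) (d : ℕ → Ω → ℝ) (k : ℕ) (ω : Ω) : ℝ :=
  (if n ≤ k then E.indicator 1 ω else 0) * d k ω

omit [IsProbabilityMeasure μ] in
lemma IsMartingaleDiff.restart (hd : IsMartingaleDiff ℱ μ d) {n : ℕ} {E : Set Ω}
    (hE : MeasurableSet[ℱ n] E) : IsMartingaleDiff ℱ μ (restartedDiff n E d) := by
  have h1 : ∀ k, Measurable[ℱ k] fun ω => if n ≤ k then E.indicator (1 : Ω → ℝ) ω else 0 := by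
    intro k
    by_cases h : n ≤ k
    · simp only [h, if_true]
      exact (@measurable_const _ _ _ (ℱ k) (1 : ℝ)).indicator (ℱ.mono h _ hE)
    · simp only [h, if_false]
      exact measurable_const
  refine hd.transform (h := fun k ω => if n ≤ k then E.indicator 1 ω else 0) h1
    fun k => hd.integrable_bdd_mul (C := 1) (h1 k) fun ω => ?_
  by_cases h : ω ∈ E <;> split_ifs <;> simp [h]

omit mΩ in
lemma restartedDiff_of_mem {n : ℕ} {E : Set Ω} {ω : Ω} (h : ω ∈ E) :
    (fun k => restartedDiff n E d k ω) = fun k => if n ≤ k then d k ω else 0 := by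
  ext k
  simp [restartedDiff, h]

omit mΩ in
lemma restartedDiff_of_notMem {n : ℕ} {E : Set Ω} {ω : Ω} (h : ω ∉ E) :
    (fun k => restartedDiff n E d k ω) = fun _ => 0 := by
  ext k
  simp [restartedDiff, h]

lemma runMax_tail_le (d : ℕ → ℝ) (n N : ℕ) :
    runMax (fun k => ∑ i ∈ Finset.range k, if n ≤ i then d i else 0) N ≤
      2 * runMax (fun k => ∑ i ∈ Finset.range k, d i) N := by
  refine runMax_le fun k hk => ?_
  have h0 := runMax_nonneg (fun k => ∑ i ∈ Finset.range k, d i) N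
  rcases le_total k n with h | h
  · rw [Finset.sum_eq_zero fun i hi => if_neg (by rw [Finset.mem_range] at hi; omega)]
    simpa using h0
  · have h1 : ∑ i ∈ Finset.range k, (if n ≤ i then d i else 0) =
        ∑ i ∈ Finset.range k, d i - ∑ i ∈ Finset.range n, d i := by
      rw [← Finset.sum_Ico_eq_sub _ h, Finset.range_eq_Ico,
        ← Finset.sum_Ico_consecutive _ (Nat.zero_le n) h, Finset.sum_eq_zero, zero_add]
      · exact Finset.sum_congr rfl fun i hi => if_pos (Finset.mem_Ico.1 hi).1
      · exact fun i hi => if_neg (by have := (Finset.mem_Ico.1 hi).2; omega)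
    rw [h1]
    refine (abs_sub _ _).trans ?_
    have h2 := abs_le_runMax (fun k => ∑ i ∈ Finset.range k, d i) hk
    have h3 := abs_le_runMax (fun k => ∑ i ∈ Finset.range k, d i) (h.trans hk)
    linarith

omit [IsProbabilityMeasure μ] in
lemma memLp_of_le_sum_abs {r : ℝ≥0∞} (hd : ∀ n, MemLp (d n) r μ) {X : Ω → ℝ} {N : ℕ}
    (hX : Measurable X) (h0 : ∀ ω, 0 ≤ X ω) (h : ∀ ω, X ω ≤ ∑ i ∈ Finset.range N, |d i ω|) :
    MemLp X r μ := by
  refine (memLp_finsetSum (Finset.range N) fun i _ => (hd i).abs).mono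
    hX.aestronglyMeasurable (ae_of_all _ fun ω => ?_)
  rw [Real.norm_eq_abs, abs_of_nonneg (h0 ω)]
  exact (h ω).trans (le_abs_self _)

/-- Garsia–Neveu with `B = 288 * M`, where `288 = 2 * 144`: the maximum of a restarted martingale is
at most twice the original one. Doob's inequality then removes the maximum. With singleton blocks
this also bounds the square function. -/
lemma IsMartingaleDiff.eLpNorm_blockNorm_le (hd : IsMartingaleDiff ℱ μ d) {p : ℝ} (hp : 1 < p)
    (hdp : ∀ n, MemLp (d n) (ENNReal.ofReal p) μ) {K N : ℕ} {σ : ℕ → Ω → ℕ}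
    (hσ : ∀ n, Measurable[ℱ n] (σ n)) (hσK : ∀ n < N, ∀ ω, σ n ω < K) :
    eLpNorm (fun ω => blockNorm K (fun i => σ i ω) (fun i => d i ω) N) (ENNReal.ofReal p) μ ≤
      ENNReal.ofReal (2 * p * 288 * (p / (p - 1))) *
        eLpNorm (fun ω => ∑ i ∈ Finset.range N, d i ω) (ENNReal.ofReal p) μ := by
  have hσ' : ∀ n, Measurable (σ n) := fun n => (hσ n).mono (ℱ.le n) le_rfl
  set M : Ω → ℝ := fun ω => runMax (fun k => ∑ i ∈ Finset.range k, d i ω) N with hM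
  have hMm : Measurable M :=
    measurable_runMax fun k _ => measurable_partialSum fun i _ => hd.measurable i
  have hM0 : ∀ ω, 0 ≤ M ω := fun ω => runMax_nonneg _ _
  have hMi : Integrable M μ := integrable_of_le_sum_abs (N := N) hd.integrable hMm hM0
    fun ω => runMax_le_sum_abs _ N
  have hMp : MemLp M (ENNReal.ofReal p) μ := memLp_of_le_sum_abs (N := N) hdp hMm hM0
    fun ω => runMax_le_sum_abs _ N
  have hNm : ∀ n, Measurable fun ω => blockNorm K (fun i => σ i ω) (fun i => d i ω) n := fun n =>
    measurable_blockNorm K (fun i _ => hσ' i) fun i _ => hd.measurable i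
  have hNle : ∀ n ≤ N, ∀ ω, blockNorm K (fun i => σ i ω) (fun i => d i ω) n ≤
      ∑ i ∈ Finset.range n, |d i ω| := fun n hn ω =>
    blockNorm_le_sum_abs K _ fun k hk => hσK k (by omega) ω
  have h1 := eLpNorm_le_of_garsia (μ := μ) (ℱ := ℱ) (r := p) hp.le (N := N)
    (A := fun n ω => blockNorm K (fun i => σ i ω) (fun i => d i ω) n)
    (B := fun ω => 288 * M ω)
    (fun n => measurable_blockNorm K (fun i hi => (hσ i).mono (ℱ.mono hi.le) le_rfl)
      fun i hi => hd.measurable_of_lt hi)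
    (hMm.const_mul 288) (fun ω => blockNorm_mono _ _ _) (fun ω => blockNorm_zero _ _ _)
    (fun ω => mul_nonneg (by norm_num) (hM0 ω))
    (fun n hn => integrable_of_le_sum_abs (N := n) hd.integrable (hNm n)
      (fun ω => blockNorm_nonneg _ _ _ _) (hNle n hn))
    (hMi.const_mul 288)
    (memLp_of_le_sum_abs (N := N) hdp (hNm N) (fun ω => blockNorm_nonneg _ _ _ _)
      (hNle N le_rfl)).eLpNorm_ne_top ?_ ?_
  · have h2 := hd.eLpNorm_runMax_le hp N hMp.eLpNorm_ne_top
    have h3 : eLpNorm (fun ω => 288 * M ω) (ENNReal.ofReal p) μ =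
        ENNReal.ofReal 288 * eLpNorm M (ENNReal.ofReal p) μ := by
      have := eLpNorm_const_smul (288 : ℝ) M (ENNReal.ofReal p) μ
      rw [Real.enorm_eq_ofReal (by norm_num)] at this
      exact this
    rw [h3] at h1
    refine h1.trans ((mul_le_mul' le_rfl (mul_le_mul' le_rfl h2)).trans (le_of_eq ?_))
    rw [ENNReal.ofReal_mul (p := 2 * p * 288) (by positivity),
      ENNReal.ofReal_mul (p := 2 * p) (by positivity), mul_assoc, mul_assoc]
  · intro n hn ω
    have h2 := blockNorm_succ_le (K := K) (σ := fun i => σ i ω) (d := fun i => d i ω) (hσK n hn ω)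
    have h3 : |d n ω| ≤ 2 * M ω := by
      have h4 := abs_le_runMax (fun k => ∑ i ∈ Finset.range k, d i ω) (show n + 1 ≤ N from hn)
      have h5 := abs_le_runMax (fun k => ∑ i ∈ Finset.range k, d i ω) (show n ≤ N from hn.le)
      have h6 : d n ω = ∑ i ∈ Finset.range (n + 1), d i ω - ∑ i ∈ Finset.range n, d i ω := by
        rw [Finset.sum_range_succ]; ring
      rw [h6]
      exact (abs_sub _ _).trans (by linarith)
    linarith [hM0 ω]
  · intro n hn E hE
    have hE' := ℱ.le n _ hE
    -- The conditional bound on `E` is the `L^1` bound for the differences after time `n` multiplied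
    -- by the indicator of `E`, again a martingale difference sequence.
    have hr := hd.restart hE
    rw [← integral_indicator hE', ← integral_indicator hE']
    have hXi : ∀ m ≤ N, Integrable
        (fun ω => blockNorm K (fun i => σ i ω) (fun i => d i ω) m) μ := fun m hm =>
      integrable_of_le_sum_abs (N := m) hd.integrable (hNm m)
        (fun ω => blockNorm_nonneg _ _ _ _) (hNle m hm)
    have hYi : Integrable
        (fun ω => blockNorm K (fun i => σ i ω) (fun i => restartedDiff n E d i ω) N) μ :=
      integrable_of_le_sum_abs (N := N) hr.integrable
        (measurable_blockNorm K (fun i _ => hσ' i) fun i _ => hr.measurable i)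
        (fun ω => blockNorm_nonneg _ _ _ _)
        fun ω => blockNorm_le_sum_abs K _ fun k hk => hσK k (by omega) ω
    calc _ ≤ ∫ ω, blockNorm K (fun i => σ i ω) (fun i => restartedDiff n E d i ω) N ∂μ := by
          refine integral_mono (((hXi N le_rfl).sub (hXi n hn)).indicator hE') hYi fun ω => ?_
          by_cases h : ω ∈ E
          · simp only [Set.indicator_of_mem h]
            rw [restartedDiff_of_mem h]
            linarith [blockNorm_le_add_tail (K := K) (σ := fun i => σ i ω)
              (d := fun i => d i ω) n N]
          · simp only [Set.indicator_of_notMem h]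
            exact blockNorm_nonneg _ _ _ _
      _ ≤ 144 * ∫ ω, runMax (fun k => ∑ i ∈ Finset.range k, restartedDiff n E d i ω) N ∂μ :=
          hr.integral_blockNorm_le hσ hσK
      _ ≤ ∫ ω, E.indicator (fun ω => 288 * M ω) ω ∂μ := by
          rw [← integral_const_mul]
          refine integral_mono ((integrable_of_le_sum_abs (N := N) hr.integrable
            (measurable_runMax fun k _ => measurable_partialSum fun i _ => hr.measurable i)
            (fun ω => runMax_nonneg _ _) fun ω => runMax_le_sum_abs _ N).const_mul 144)
            ((hMi.const_mul 288).indicator hE') fun ω => ?_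
          by_cases h : ω ∈ E
          · have h1 := runMax_tail_le (fun i => d i ω) n N
            have h2 : ∀ i, restartedDiff n E d i ω = if n ≤ i then d i ω else 0 :=
              fun i => congrFun (restartedDiff_of_mem h) i
            simp only [Set.indicator_of_mem h, h2, hM]
            linarith
          · have h2 : ∀ i, restartedDiff n E d i ω = 0 := fun i => congrFun (restartedDiff_of_notMem h) i
            simp only [Set.indicator_of_notMem h, h2, Finset.sum_const_zero]
            have : runMax (fun _ => 0) N ≤ 0 := runMax_le fun i _ => by simp
            linarith

/-- Labels are predictable, so the increments of one block form a martingale difference sequence,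
and Davis' inequality applies to each block separately. -/
lemma IsMartingaleDiff.integral_blockTotal_le (hd : IsMartingaleDiff ℱ μ d) (K N : ℕ)
    {σ : ℕ → Ω → ℕ} (hσ : ∀ n, Measurable[ℱ n] (σ n)) :
    ∫ ω, blockTotal K (fun i => σ i ω) (fun i => d i ω) N ∂μ ≤
      18 * ∫ ω, blockSquare K (fun i => σ i ω) (fun i => d i ω) N ∂μ := by
  have hpiece : ∀ a, IsMartingaleDiff ℱ μ fun i ω => (if σ i ω = a then 1 else 0) * d i ω := by
    intro a
    have h1 : ∀ i, Measurable[ℱ i] fun ω => if σ i ω = a then (1 : ℝ) else 0 := fun i =>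
      Measurable.ite ((hσ i) (measurableSet_singleton a)) measurable_const measurable_const
    refine hd.transform (h := fun i ω => if σ i ω = a then 1 else 0) h1 fun i =>
      hd.integrable_bdd_mul (C := 1) (h1 i) fun ω => by split_ifs <;> simp
  have e : ∀ a i ω, (if σ i ω = a then 1 else 0) * d i ω = if σ i ω = a then d i ω else 0 :=
    fun a i ω => by split_ifs <;> simp
  simp only [e] at hpiece
  have hX : ∀ a ∈ Finset.range K, Integrable
      (fun ω => blockMax (fun i => σ i ω) (fun i => d i ω) a N) μ := fun a _ =>
    integrable_of_le_sum_abs (N := N) (hpiece a).integrable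
      (measurable_blockMax measurable_const (fun i _ => (hσ i).mono (ℱ.le i) le_rfl)
        fun i _ => hd.measurable i) (fun ω => blockMax_nonneg _ _ _ _)
      fun ω => runMax_le_sum_abs (fun i => if σ i ω = a then d i ω else 0) N
  have hY : ∀ a ∈ Finset.range K, Integrable
      (fun ω => √(∑ i ∈ Finset.range N, (if σ i ω = a then d i ω else 0) ^ 2)) μ := fun a _ =>
    integrable_of_le_sum_abs (N := N) (hpiece a).integrable
      (measurable_partialSum fun i _ => ((hpiece a).measurable i).pow_const 2).sqrt
      (fun ω => Real.sqrt_nonneg _) fun ω => sqrt_sum_sq_le_sum_abs _ N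
  unfold blockTotal blockSquare
  rw [integral_finsetSum _ hX, integral_finsetSum _ hY, Finset.mul_sum]
  exact Finset.sum_le_sum fun a _ => (hpiece a).integral_runMax_le N

lemma IsMartingaleDiff.eLpNorm_blockTotal_le (hd : IsMartingaleDiff ℱ μ d) {r : ℝ} (hr : 1 ≤ r)
    (hdr : ∀ n, MemLp (d n) (ENNReal.ofReal r) μ) {K N : ℕ} {σ : ℕ → Ω → ℕ}
    (hσ : ∀ n, Measurable[ℱ n] (σ n)) (hσK : ∀ n < N, ∀ ω, σ n ω < K) :
    eLpNorm (fun ω => blockTotal K (fun i => σ i ω) (fun i => d i ω) N) (ENNReal.ofReal r) μ ≤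
      ENNReal.ofReal (2 * r * 18) *
        eLpNorm (fun ω => blockSquare K (fun i => σ i ω) (fun i => d i ω) N)
          (ENNReal.ofReal r) μ := by
  have hσ' : ∀ n, Measurable (σ n) := fun n => (hσ n).mono (ℱ.le n) le_rfl
  have hSq : ∀ e : ℕ → Ω → ℝ, IsMartingaleDiff ℱ μ e →
      Measurable (fun ω => blockSquare K (fun i => σ i ω) (fun i => e i ω) N) ∧
      Integrable (fun ω => blockSquare K (fun i => σ i ω) (fun i => e i ω) N) μ := by
    intro e he
    have hm : ∀ a, Measurable
        fun ω => √(∑ i ∈ Finset.range N, (if σ i ω = a then e i ω else 0) ^ 2) := fun a =>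
      (measurable_partialSum fun i _ => (Measurable.ite (hσ' i (measurableSet_singleton a))
        (he.measurable i) measurable_const).pow_const 2).sqrt
    refine ⟨Finset.measurable_sum _ fun a _ => hm a, integrable_finsetSum _ fun a _ => ?_⟩
    refine integrable_of_le_sum_abs (N := N) he.integrable (hm a) (fun ω => Real.sqrt_nonneg _)
      fun ω => (sqrt_sum_sq_le_sum_abs _ N).trans (Finset.sum_le_sum fun i _ => ?_)
    split_ifs <;> simp
  obtain ⟨hSm, hSi⟩ := hSq d hd
  have hTm : ∀ n, Measurable fun ω => blockTotal K (fun i => σ i ω) (fun i => d i ω) n := fun n =>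
    measurable_blockTotal K (fun i _ => hσ' i) fun i _ => hd.measurable i
  have hTle : ∀ n ≤ N, ∀ ω, blockTotal K (fun i => σ i ω) (fun i => d i ω) n ≤
      ∑ i ∈ Finset.range n, |d i ω| := fun n hn ω =>
    blockTotal_le_sum_abs K _ fun k hk => hσK k (by omega) ω
  have hTi : ∀ n ≤ N, Integrable
      (fun ω => blockTotal K (fun i => σ i ω) (fun i => d i ω) n) μ := fun n hn =>
    integrable_of_le_sum_abs (N := n) hd.integrable (hTm n)
      (fun ω => blockTotal_nonneg _ _ _ _) (hTle n hn)
  have h1 := eLpNorm_le_of_garsia (μ := μ) (ℱ := ℱ) (r := r) hr (N := N)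
    (A := fun n ω => blockTotal K (fun i => σ i ω) (fun i => d i ω) n)
    (B := fun ω => 18 * blockSquare K (fun i => σ i ω) (fun i => d i ω) N)
    (fun n => measurable_blockTotal K (fun i hi => (hσ i).mono (ℱ.mono hi.le) le_rfl)
      fun i hi => hd.measurable_of_lt hi)
    (hSm.const_mul 18) (fun ω => blockTotal_mono _ _ _) (fun ω => blockTotal_zero _ _ _)
    (fun ω => mul_nonneg (by norm_num) blockSquare_nonneg) hTi (hSi.const_mul 18)
    (memLp_of_le_sum_abs (N := N) hdr (hTm N) (fun ω => blockTotal_nonneg _ _ _ _)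
      (hTle N le_rfl)).eLpNorm_ne_top ?_ ?_
  · have h3 := eLpNorm_const_smul (18 : ℝ)
      (fun ω => blockSquare K (fun i => σ i ω) (fun i => d i ω) N) (ENNReal.ofReal r) μ
    rw [Real.enorm_eq_ofReal (by norm_num)] at h3
    refine h1.trans (le_of_eq ?_)
    rw [ENNReal.ofReal_mul (p := 2 * r) (by positivity), mul_assoc, ← h3]
    rfl
  · intro n hn ω
    have h2 := blockTotal_succ_le (K := K) (σ := fun i => σ i ω) (d := fun i => d i ω) (hσK n hn ω)
    have h3 := abs_le_blockSquare (K := K) (σ := fun i => σ i ω) (d := fun i => d i ω) hn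
      (hσK n hn ω)
    linarith [abs_nonneg (d n ω)]
  · intro n hn E hE
    have hE' := ℱ.le n _ hE
    have hr := hd.restart hE
    rw [← integral_indicator hE', ← integral_indicator hE']
    have hYi : Integrable
        (fun ω => blockTotal K (fun i => σ i ω) (fun i => restartedDiff n E d i ω) N) μ :=
      integrable_of_le_sum_abs (N := N) hr.integrable
        (measurable_blockTotal K (fun i _ => hσ' i) fun i _ => hr.measurable i)
        (fun ω => blockTotal_nonneg _ _ _ _)
        fun ω => blockTotal_le_sum_abs K _ fun k hk => hσK k (by omega) ω
    calc _ ≤ ∫ ω, blockTotal K (fun i => σ i ω) (fun i => restartedDiff n E d i ω) N ∂μ := by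
          refine integral_mono (((hTi N le_rfl).sub (hTi n hn)).indicator hE') hYi fun ω => ?_
          by_cases h : ω ∈ E
          · simp only [Set.indicator_of_mem h]
            rw [restartedDiff_of_mem h]
            linarith [blockTotal_le_add_tail (K := K) (σ := fun i => σ i ω)
              (d := fun i => d i ω) n N]
          · simp only [Set.indicator_of_notMem h]
            exact blockTotal_nonneg _ _ _ _
      _ ≤ 18 * ∫ ω, blockSquare K (fun i => σ i ω) (fun i => restartedDiff n E d i ω) N ∂μ :=
          hr.integral_blockTotal_le K N hσ
      _ ≤ _ := by
          rw [← integral_const_mul]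
          refine integral_mono ((hSq _ hr).2.const_mul 18) ((hSi.const_mul 18).indicator hE')
            fun ω => ?_
          by_cases h : ω ∈ E
          · simp only [Set.indicator_of_mem h]
            rw [restartedDiff_of_mem h]
            gcongr
            exact blockSquare_mono_of_abs_le fun i _ => by split_ifs <;> simp
          · simp only [Set.indicator_of_notMem h]
            rw [restartedDiff_of_notMem h]
            simp [blockSquare]

end MaximalBounds

/-! ### Block paraproducts below the exponent 1 -/

section BlockParaproduct

variable {Ω : Type*} {mΩ : MeasurableSpace Ω} {μ : Measure Ω}

lemma eLpNorm_rpow_eq {p s : ℝ} (hs : 0 < s) {F : Ω → ℝ} (hF : ∀ ω, 0 ≤ F ω) :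
    eLpNorm (fun ω => F ω ^ s) (ENNReal.ofReal (p / s)) μ =
      eLpNorm F (ENNReal.ofReal p) μ ^ s := by
  have h := eLpNorm_norm_rpow F hs (p := ENNReal.ofReal (p / s)) (μ := μ)
  rw [← ENNReal.ofReal_mul' hs.le, div_mul_cancel₀ _ hs.ne'] at h
  rw [← h]
  congr 1
  ext ω
  rw [Real.norm_eq_abs, abs_of_nonneg (hF ω)]

lemma eLpNorm_mul_le_of_holder {p q r : ℝ} (h : p.HolderTriple q r) {F G : Ω → ℝ}
    (hF : AEStronglyMeasurable F μ) (hG : AEStronglyMeasurable G μ) :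
    eLpNorm (fun ω => F ω * G ω) (ENNReal.ofReal r) μ ≤
      eLpNorm F (ENNReal.ofReal p) μ * eLpNorm G (ENNReal.ofReal q) μ := by
  have := h.ennrealOfReal
  have h1 := eLpNorm_le_eLpNorm_mul_eLpNorm_of_nnnorm (p := ENNReal.ofReal p)
    (q := ENNReal.ofReal q) (r := ENNReal.ofReal r) hF hG (fun a b => a * b) 1
    (ae_of_all _ fun ω => by rw [nnnorm_mul, one_mul])
  rwa [ENNReal.coe_one, one_mul] at h1

lemma holderTriple_of_add {p q r : ℝ} (hp : 0 < p) (hq : 0 < q) (h : 1 / p + 1 / q = 1 / r) :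
    p.HolderTriple q r := by
  have := Real.HolderTriple.of_pos hp hq
  simp only [one_div] at h
  rwa [h, inv_inv] at this

lemma eLpNorm_const_mul_eq {c : ℝ} (hc : 0 ≤ c) (F : Ω → ℝ) (p : ℝ≥0∞) :
    eLpNorm (fun ω => c * F ω) p μ = ENNReal.ofReal c * eLpNorm F p μ := by
  have h := eLpNorm_const_smul c F p μ
  rw [Real.enorm_eq_ofReal hc] at h
  exact h

lemma eLpNorm_mono_nonneg {F G : Ω → ℝ} (hF : ∀ ω, 0 ≤ F ω) (h : ∀ ω, F ω ≤ G ω) (p : ℝ≥0∞) :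
    eLpNorm F p μ ≤ eLpNorm G p μ :=
  eLpNorm_mono_real fun ω => by rw [Real.norm_eq_abs, abs_of_nonneg (hF ω)]; exact h ω

/-- The exponents satisfy `1 / t = (1 - s) / p + 1 / q` and `1 / r = s / p + 1 / t`. Since `q > 1`,
a small enough `1 - s` makes `1 / t ≤ 1`. -/
lemma exists_interpolation_exponents {p q r : ℝ} (hp : 1 < p) (hq : 1 < q)
    (hpqr : 1 / p + 1 / q = 1 / r) :
    ∃ s t : ℝ, 0 < s ∧ s < 1 ∧ 1 ≤ t ∧ (p / (1 - s)).HolderTriple q t ∧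
      (p / s).HolderTriple t r := by
  have hp0 : 0 < p := by linarith
  have hq0 : 0 < q := by linarith
  have hq1 : 1 / q < 1 := by rw [div_lt_one hq0]; exact hq
  have hq2 : 0 < 1 / q := by positivity
  set v := min (1 / 2) (p * (1 - 1 / q)) with hv
  have hv0 : 0 < v := lt_min (by norm_num) (mul_pos hp0 (by linarith))
  have hv1 : v ≤ 1 / 2 := min_le_left _ _
  have hv2 : v / p ≤ 1 - 1 / q := by
    rw [div_le_iff₀ hp0, mul_comm]
    exact min_le_right _ _
  have hvp : 0 < v / p := by positivity
  have hs : 0 < 1 - v := by linarith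
  refine ⟨1 - v, 1 / (v / p + 1 / q), hs, by linarith, ?_, ?_, ?_⟩
  · rw [le_div_iff₀ (by positivity)]
    linarith
  · rw [sub_sub_cancel]
    apply holderTriple_of_add (by positivity) hq0
    rw [one_div_div, one_div_one_div]
  · apply holderTriple_of_add (by positivity) (by positivity)
    rw [one_div_div, one_div_one_div, ← hpqr]
    field_simp
    ring

/-- The vector-valued estimate for the block paraproduct whose increments are
`u n * e n`, with `u n` the current block value of `d`. -/
lemma exists_eLpNorm_blockTotal_paraproduct_le {p q r : ℝ} (hp : 1 < p) (hq : 1 < q)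
    (hpqr : 1 / p + 1 / q = 1 / r) :
    ∃ C : ℝ, 0 ≤ C ∧ ∀ (Ω : Type*) (mΩ : MeasurableSpace Ω) (μ : Measure Ω)
      (_ : IsProbabilityMeasure μ) (ℱ : Filtration ℕ mΩ) (d e : ℕ → Ω → ℝ),
      IsMartingaleDiff ℱ μ d → IsMartingaleDiff ℱ μ e →
      (∀ n, MemLp (d n) (ENNReal.ofReal p) μ) → (∀ n, MemLp (e n) (ENNReal.ofReal q) μ) →
      ∀ (K N : ℕ) (σ : ℕ → Ω → ℕ), (∀ n, Measurable[ℱ n] (σ n)) → (∀ n < N, ∀ ω, σ n ω < K) →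
      eLpNorm (fun ω => blockTotal K (fun i => σ i ω) (fun n =>
        blockSum (fun i => σ i ω) (fun i => d i ω) (σ n ω) n * e n ω) N) (ENNReal.ofReal r) μ ≤
      ENNReal.ofReal C * eLpNorm (fun ω => ∑ i ∈ Finset.range N, d i ω) (ENNReal.ofReal p) μ *
        eLpNorm (fun ω => ∑ i ∈ Finset.range N, e i ω) (ENNReal.ofReal q) μ := by
  obtain ⟨s, t, hs0, hs1, ht, hH1, hH2⟩ := exists_interpolation_exponents hp hq hpqr
  refine ⟨2 * (2 * t * 18) * √((1 - s)⁻¹) * (2 * p * 288 * (p / (p - 1))) *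
    (2 * q * 288 * (q / (q - 1))), ?_, ?_⟩
  · have h1 : 0 < p - 1 := by linarith
    have h2 : 0 < q - 1 := by linarith
    positivity
  intro Ω mΩ μ _ ℱ d e hd he hdp heq K N σ hσ hσK
  have hs1' : 0 < 1 - s := by linarith
  have hσ' : ∀ n, Measurable (σ n) := fun n => (hσ n).mono (ℱ.le n) le_rfl
  set F : ℕ → Ω → ℝ := fun n ω => blockNorm K (fun i => σ i ω) (fun i => d i ω) n with hF
  set u : ℕ → Ω → ℝ := fun n ω => blockSum (fun i => σ i ω) (fun i => d i ω) (σ n ω) n with hu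
  have hFm : ∀ n, Measurable[ℱ n] (F n) := fun n =>
    measurable_blockNorm K (fun i hi => (hσ i).mono (ℱ.mono hi.le) le_rfl)
      fun i hi => hd.measurable_of_lt hi
  have hFm' : ∀ n, Measurable (F n) := fun n => (hFm n).mono (ℱ.le n) le_rfl
  have hum : ∀ n, Measurable[ℱ n] (u n) := fun n =>
    measurable_blockSum (hσ n) (fun i hi => (hσ i).mono (ℱ.mono hi.le) le_rfl)
      fun i hi => hd.measurable_of_lt hi
  have hF0 : ∀ n ω, 0 ≤ F n ω := fun n ω => blockNorm_nonneg _ _ _ _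
  have huF : ∀ n < N, ∀ ω, |u n ω| ≤ F n ω := fun n hn ω =>
    (abs_blockSum_le _ _ _ le_rfl).trans (blockMax_le_blockNorm _ _ _ (hσK n hn ω) n)
  -- Cut off at `N` because labels are known to lie below `K`, and `|u|` below `F`, only for `n <
  -- N`.
  set b : ℕ → Ω → ℝ := fun n ω => if n < N then F n ω ^ (-s) * u n ω else 0 with hb
  have hbm : ∀ n, Measurable[ℱ n] (b n) := by
    intro n
    by_cases h : n < N
    · simp only [hb, h, if_true]
      exact ((hFm n).pow_const _).mul (hum n)
    · simp only [hb, h, if_false]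
      exact measurable_const
  have hbF : ∀ n ω, |b n ω| ≤ F N ω ^ (1 - s) := by
    intro n ω
    by_cases h : n < N
    · simp only [hb, h, if_true]
      rw [abs_mul, abs_of_nonneg (Real.rpow_nonneg (hF0 n ω) _)]
      have h1 : F n ω ^ (-s) * |u n ω| ≤ F n ω ^ (-s) * F n ω :=
        mul_le_mul_of_nonneg_left (huF n h ω) (Real.rpow_nonneg (hF0 n ω) _)
      refine h1.trans ?_
      have h2 : F n ω ^ (-s) * F n ω = F n ω ^ (1 - s) := by
        rw [mul_comm, ← Real.rpow_one_add' (hF0 n ω) (by linarith)]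
        congr 1
      rw [h2]
      exact Real.rpow_le_rpow (hF0 n ω) (blockNorm_mono _ _ _ h.le) hs1'.le
    · simp only [hb, h, if_false, abs_zero]
      exact Real.rpow_nonneg (hF0 N ω) _
  have hNle : ∀ ω, F N ω ≤ ∑ i ∈ Finset.range N, |d i ω| := fun ω =>
    blockNorm_le_sum_abs K _ fun k hk => hσK k hk ω
  have hFp : MemLp (F N) (ENNReal.ofReal p) μ :=
    memLp_of_le_sum_abs (N := N) hdp (hFm' N) (hF0 N) hNle
  have hbe : ∀ n, MemLp (fun ω => b n ω * e n ω) (ENNReal.ofReal t) μ := by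
    intro n
    have hm : Measurable fun ω => b n ω * e n ω :=
      ((hbm n).mono (ℱ.le n) le_rfl).mul (he.measurable n)
    refine ⟨hm.aestronglyMeasurable, ?_⟩
    have h1 : eLpNorm (fun ω => b n ω * e n ω) (ENNReal.ofReal t) μ ≤
        eLpNorm (fun ω => F N ω ^ (1 - s) * e n ω) (ENNReal.ofReal t) μ := by
      refine eLpNorm_mono fun ω => ?_
      rw [norm_mul, norm_mul]
      gcongr
      exact (hbF n ω).trans (le_abs_self _)
    refine h1.trans_lt ((eLpNorm_mul_le_of_holder hH1
      ((hFm' N).pow_const _).aestronglyMeasurable (he.measurable n).aestronglyMeasurable).trans_lt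
      (ENNReal.mul_lt_top ?_ (heq n).eLpNorm_lt_top))
    rw [eLpNorm_rpow_eq hs1' (hF0 N)]
    exact ENNReal.rpow_lt_top_of_nonneg hs1'.le hFp.eLpNorm_ne_top
  have hy : IsMartingaleDiff ℱ μ (fun n ω => b n ω * e n ω) :=
    he.transform hbm fun n => (hbe n).integrable (by
      rw [← ENNReal.ofReal_one]; exact ENNReal.ofReal_le_ofReal ht)
  set T : Ω → ℝ := fun ω => blockTotal K (fun i => σ i ω) (fun n => b n ω * e n ω) N with hT
  have hTm : Measurable T := measurable_blockTotal K (fun i _ => hσ' i) fun i _ => hy.measurable i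
  have hT0 : ∀ ω, 0 ≤ T ω := fun ω => blockTotal_nonneg _ _ _ _
  set S : Ω → ℝ := fun ω => √(∑ i ∈ Finset.range N, e i ω ^ 2) with hS
  have hSm : Measurable S :=
    (measurable_partialSum fun i _ => (he.measurable i).pow_const 2).sqrt
  -- The increments are `F ^ s * (b * e)` with `F ^ s` nondecreasing in time, so the weight leaves
  -- every block maximum at the cost of a factor `2`.
  have hpt : ∀ ω, blockTotal K (fun i => σ i ω) (fun n => u n ω * e n ω) N ≤
      2 * (F N ω ^ s * T ω) := by
    intro ω
    have h1 : blockTotal K (fun i => σ i ω) (fun n => u n ω * e n ω) N =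
        blockTotal K (fun i => σ i ω) (fun n => F n ω ^ s * (b n ω * e n ω)) N := by
      refine blockTotal_congr fun i hi => ?_
      simp only [hb, hi, if_true]
      -- Where `F` vanishes so does `u`, and normalizing loses nothing.
      rcases (hF0 i ω).eq_or_lt with h | h
      · have h2 := huF i hi ω
        rw [← h] at h2
        rw [abs_nonpos_iff.1 h2]
        simp
      · have h2 : F i ω ^ s * F i ω ^ (-s) = 1 := by
          rw [← Real.rpow_add h]; simp
        calc u i ω * e i ω = (F i ω ^ s * F i ω ^ (-s)) * (u i ω * e i ω) := by rw [h2, one_mul]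
          _ = _ := by ring
    rw [h1, ← mul_assoc]
    exact blockTotal_mul_le (w := fun n => F n ω ^ s) (fun i j hij =>
      Real.rpow_le_rpow (hF0 i ω) (blockNorm_mono _ _ _ hij) hs0.le)
      (Real.rpow_nonneg (hF0 0 ω) _) N
  have hsq : ∀ ω, blockSquare K (fun i => σ i ω) (fun n => b n ω * e n ω) N ≤
      √((1 - s)⁻¹) * (F N ω ^ (1 - s) * S ω) := by
    intro ω
    refine le_trans (le_of_eq ?_) (sum_block_square_le (K := K) (σ := fun i => σ i ω)
      (d := fun i => d i ω) (e := fun i => e i ω) hs0 hs1 N)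
    refine Finset.sum_congr rfl fun a _ => ?_
    congr 1
    refine Finset.sum_congr rfl fun i hi => ?_
    simp only [hb, Finset.mem_range.1 hi, if_true, hF, hu]
  -- The square function is dominated by the block norm for the labelling `σ n = n`.
  have hSq : eLpNorm S (ENNReal.ofReal q) μ ≤ ENNReal.ofReal (2 * q * 288 * (q / (q - 1))) *
      eLpNorm (fun ω => ∑ i ∈ Finset.range N, e i ω) (ENNReal.ofReal q) μ :=
    (eLpNorm_mono_nonneg (fun ω => Real.sqrt_nonneg _)
      (fun ω => sqrt_sum_sq_le_blockNorm (fun i => e i ω) N) _).trans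
      (he.eLpNorm_blockNorm_le hq heq (K := N) (N := N) (σ := fun n _ => n)
        (fun n => measurable_const) fun n hn _ => hn)
  have hFN := hd.eLpNorm_blockNorm_le hp hdp hσ hσK
  set φ := eLpNorm (F N) (ENNReal.ofReal p) μ with hφ
  have hTt : eLpNorm T (ENNReal.ofReal t) μ ≤ ENNReal.ofReal (2 * t * 18) *
      (ENNReal.ofReal (√((1 - s)⁻¹)) * (φ ^ (1 - s) * eLpNorm S (ENNReal.ofReal q) μ)) := by
    refine (hy.eLpNorm_blockTotal_le ht hbe hσ hσK).trans (mul_le_mul' le_rfl ?_)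
    refine (eLpNorm_mono_nonneg (fun ω => blockSquare_nonneg) hsq _).trans ?_
    rw [eLpNorm_const_mul_eq (Real.sqrt_nonneg _)]
    refine mul_le_mul' le_rfl ((eLpNorm_mul_le_of_holder hH1
      ((hFm' N).pow_const _).aestronglyMeasurable hSm.aestronglyMeasurable).trans ?_)
    rw [eLpNorm_rpow_eq hs1' (hF0 N)]
  calc _ ≤ eLpNorm (fun ω => 2 * (F N ω ^ s * T ω)) (ENNReal.ofReal r) μ :=
        eLpNorm_mono_nonneg (fun ω => blockTotal_nonneg _ _ _ _) hpt _
    _ ≤ ENNReal.ofReal 2 * (φ ^ s * eLpNorm T (ENNReal.ofReal t) μ) := by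
        rw [eLpNorm_const_mul_eq (by norm_num), hφ, ← eLpNorm_rpow_eq hs0 (hF0 N)]
        exact mul_le_mul' le_rfl (eLpNorm_mul_le_of_holder hH2
          ((hFm' N).pow_const _).aestronglyMeasurable hTm.aestronglyMeasurable)
    _ ≤ ENNReal.ofReal 2 * (φ ^ s * (ENNReal.ofReal (2 * t * 18) *
        (ENNReal.ofReal (√((1 - s)⁻¹)) * (φ ^ (1 - s) * eLpNorm S (ENNReal.ofReal q) μ)))) :=
        mul_le_mul' le_rfl (mul_le_mul' le_rfl hTt)
    _ = ENNReal.ofReal 2 * ENNReal.ofReal (2 * t * 18) * ENNReal.ofReal (√((1 - s)⁻¹)) *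
        φ * eLpNorm S (ENNReal.ofReal q) μ := by
        have : φ = φ ^ s * φ ^ (1 - s) := by
          rw [← ENNReal.rpow_add_of_nonneg _ _ hs0.le hs1'.le, add_sub_cancel, ENNReal.rpow_one]
        conv_rhs => rw [this]
        ring
    _ ≤ ENNReal.ofReal 2 * ENNReal.ofReal (2 * t * 18) * ENNReal.ofReal (√((1 - s)⁻¹)) *
        (ENNReal.ofReal (2 * p * 288 * (p / (p - 1))) *
          eLpNorm (fun ω => ∑ i ∈ Finset.range N, d i ω) (ENNReal.ofReal p) μ) *
        (ENNReal.ofReal (2 * q * 288 * (q / (q - 1))) *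
          eLpNorm (fun ω => ∑ i ∈ Finset.range N, e i ω) (ENNReal.ofReal q) μ) :=
        mul_le_mul' (mul_le_mul' le_rfl hFN) hSq
    _ = _ := by
        have h1 : 0 < p - 1 := by linarith
        rw [ENNReal.ofReal_mul (p := 2 * (2 * t * 18) * √((1 - s)⁻¹) * (2 * p * 288 * (p / (p - 1))))
            (by positivity),
          ENNReal.ofReal_mul (p := 2 * (2 * t * 18) * √((1 - s)⁻¹)) (by positivity),
          ENNReal.ofReal_mul (p := 2 * (2 * t * 18)) (by positivity),
          ENNReal.ofReal_mul (p := 2) (by positivity)]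
        ring

end BlockParaproduct

/-! ### Reset sequences and paraproducts within a block -/

/-- A sequence recording the most recent reset time. -/
structure IsResetSeq (σ : ℕ → ℕ) : Prop where
  zero : σ 0 = 0
  succ : ∀ n, σ (n + 1) = σ n ∨ σ (n + 1) = n + 1

namespace IsResetSeq

variable {σ : ℕ → ℕ} (h : IsResetSeq σ)
include h

lemma le (n : ℕ) : σ n ≤ n := by
  induction n with
  | zero => exact h.zero.le
  | succ n ih => rcases h.succ n with h | h <;> omega

lemma monotone : Monotone σ :=
  monotone_nat_of_le_succ fun n => by
    rcases h.succ n with h1 | h1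
    · exact h1.ge
    · rw [h1]; exact (h.le n).trans n.le_succ

lemma apply_apply (n : ℕ) : σ (σ n) = σ n := by
  induction n with
  | zero => rw [h.zero, h.zero]
  | succ n ih =>
    rcases h.succ n with h1 | h1
    · rw [h1, ih]
    · rw [h1, h1]

/-- Blocks are intervals: all times from a reset to the next one carry the same label. -/
lemma eq_of_le {i n : ℕ} (h1 : σ n ≤ i) (h2 : i ≤ n) : σ i = σ n :=
  le_antisymm (h.monotone h2) (by simpa only [h.apply_apply] using h.monotone h1)

lemma blockSum_eq (d : ℕ → ℝ) {n m : ℕ} (hm : σ n ≤ m) (hmn : m ≤ n + 1) :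
    blockSum σ d (σ n) m = ∑ i ∈ Finset.Ico (σ n) m, d i := by
  unfold blockSum
  rw [Finset.range_eq_Ico, ← Finset.sum_Ico_consecutive _ (Nat.zero_le _) hm, Finset.sum_eq_zero,
    zero_add]
  · refine Finset.sum_congr rfl fun i hi => if_pos ?_
    rw [Finset.mem_Ico] at hi
    exact h.eq_of_le hi.1 (by omega)
  · intro i hi
    rw [Finset.mem_Ico] at hi
    have := h.le i
    exact if_neg (by omega)

end IsResetSeq

section Paraproduct

variable {Ω : Type*}

/-- The increments of a process, indexed by the left endpoint. -/
def increment (f : ℕ → Ω → ℝ) (n : ℕ) (ω : Ω) : ℝ := f (n + 1) ω - f n ω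

lemma sum_Ico_increment (f : ℕ → Ω → ℝ) {u v : ℕ} (h : u ≤ v) (ω : Ω) :
    ∑ i ∈ Finset.Ico u v, increment f i ω = f v ω - f u ω :=
  Finset.sum_Ico_sub (fun i => f i ω) h

lemma truncParaproduct_eq_sum (f g : ℕ → Ω → ℝ) {u v : ℕ} (h : u ≤ v) (ω : Ω) :
    truncParaproduct f g u v ω = ∑ n ∈ Finset.Ico u v, (f n ω - f u ω) * increment g n ω := by
  have h1 : ∀ n, u ≤ n → ∑ i ∈ Finset.Ioo u (n + 1), procDiff f i ω = f n ω - f u ω := by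
    intro n hn
    induction n, hn using Nat.le_induction with
    | base =>
      rw [show Finset.Ioo u (u + 1) = ∅ by ext; simp]
      simp
    | succ n hn ih =>
      rw [show Finset.Ioo u (n + 1 + 1) = insert (n + 1) (Finset.Ioo u (n + 1)) by
        ext; simp; omega, Finset.sum_insert (by simp), ih]
      simp [procDiff]
  unfold truncParaproduct
  induction v, h using Nat.le_induction with
  | base => simp
  | succ n hn ih =>
    rw [show Finset.Ioc u (n + 1) = insert (n + 1) (Finset.Ioc u n) by
      ext; simp; omega, Finset.sum_insert (by simp), ih, Finset.sum_Ico_succ_top hn,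
      ← Finset.sum_mul, h1 n hn]
    simp [procDiff, increment]
    ring

/-- Moving the starting point from `a` to `u` replaces `f n - f a` by `f n - f u`, a constant shift
of the integrand on `[u, v)`. -/
lemma truncParaproduct_chasles (f g : ℕ → Ω → ℝ) {a u v : ℕ} (h1 : a ≤ u) (h2 : u ≤ v) (ω : Ω) :
    truncParaproduct f g u v ω = truncParaproduct f g a v ω - truncParaproduct f g a u ω
      - (f u ω - f a ω) * (g v ω - g u ω) := by
  rw [truncParaproduct_eq_sum f g h2, truncParaproduct_eq_sum f g (h1.trans h2),
    truncParaproduct_eq_sum f g h1, ← Finset.sum_Ico_consecutive _ h1 h2,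
    ← sum_Ico_increment g h2 ω, Finset.mul_sum, add_sub_cancel_left, ← Finset.sum_sub_distrib]
  exact Finset.sum_congr rfl fun n _ => by ring

/-- The increments of the block paraproduct. -/
noncomputable def blockParaDiff (σ : ℕ → Ω → ℕ) (f g : ℕ → Ω → ℝ) (n : ℕ) (ω : Ω) : ℝ :=
  blockSum (fun i => σ i ω) (fun i => increment f i ω) (σ n ω) n * increment g n ω

/-- A quantity dominating all truncated paraproducts inside the block `a` up to time `N`. -/
noncomputable def blockWeight (σ : ℕ → Ω → ℕ) (f g : ℕ → Ω → ℝ) (N a : ℕ) (ω : Ω) : ℝ :=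
  2 * blockMax (fun i => σ i ω) (fun i => blockParaDiff σ f g i ω) a N +
    2 * (blockMax (fun i => σ i ω) (fun i => increment f i ω) a N *
      blockMax (fun i => σ i ω) (fun i => increment g i ω) a N)

lemma blockWeight_nonneg (σ : ℕ → Ω → ℕ) (f g : ℕ → Ω → ℝ) (N a : ℕ) (ω : Ω) :
    0 ≤ blockWeight σ f g N a ω := by
  have h1 := blockMax_nonneg (fun i => σ i ω) (fun i => blockParaDiff σ f g i ω) a N
  have h2 := blockMax_nonneg (fun i => σ i ω) (fun i => increment f i ω) a N
  have h3 := blockMax_nonneg (fun i => σ i ω) (fun i => increment g i ω) a N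
  unfold blockWeight
  positivity

lemma blockWeight_mono (σ : ℕ → Ω → ℕ) (f g : ℕ → Ω → ℝ) (a : ℕ) (ω : Ω) :
    Monotone fun N => blockWeight σ f g N a ω := by
  intro M N h
  have h1 := blockMax_mono (fun i => σ i ω) (fun i => blockParaDiff σ f g i ω) a h
  have h2 := blockMax_mono (fun i => σ i ω) (fun i => increment f i ω) a h
  have h3 := blockMax_mono (fun i => σ i ω) (fun i => increment g i ω) a h
  have h4 := blockMax_nonneg (fun i => σ i ω) (fun i => increment f i ω) a N
  have h5 := blockMax_nonneg (fun i => σ i ω) (fun i => increment g i ω) a M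
  simp only [blockWeight]
  gcongr

/-- The sum of the block weights. -/
noncomputable def totalWeight (σ : ℕ → Ω → ℕ) (f g : ℕ → Ω → ℝ) (N : ℕ) (ω : Ω) : ℝ :=
  ∑ a ∈ Finset.range N, blockWeight σ f g N a ω

lemma totalWeight_nonneg (σ : ℕ → Ω → ℕ) (f g : ℕ → Ω → ℝ) (N : ℕ) (ω : Ω) :
    0 ≤ totalWeight σ f g N ω :=
  Finset.sum_nonneg fun _ _ => blockWeight_nonneg _ _ _ _ _ _

lemma totalWeight_mono (σ : ℕ → Ω → ℕ) (f g : ℕ → Ω → ℝ) (ω : Ω) :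
    Monotone fun N => totalWeight σ f g N ω := fun _ _ h =>
  (Finset.sum_le_sum fun a _ => blockWeight_mono σ f g a ω h).trans
    (Finset.sum_le_sum_of_subset_of_nonneg (Finset.range_subset_range.2 h)
      fun _ _ _ => blockWeight_nonneg _ _ _ _ _ _)

lemma totalWeight_le (σ : ℕ → Ω → ℕ) (f g : ℕ → Ω → ℝ) (N : ℕ) (ω : Ω) :
    totalWeight σ f g N ω ≤
      2 * blockTotal N (fun i => σ i ω) (fun i => blockParaDiff σ f g i ω) N +
      2 * (blockNorm N (fun i => σ i ω) (fun i => increment f i ω) N *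
        blockNorm N (fun i => σ i ω) (fun i => increment g i ω) N) := by
  unfold totalWeight blockWeight
  rw [Finset.sum_add_distrib, ← Finset.mul_sum, ← Finset.mul_sum]
  gcongr
  · rfl
  · exact Real.sum_mul_le_sqrt_mul_sqrt _ _ _

/-- Both ends are compared with the start of the block through Chasles' relation. The endpoint `n +
1` may already be a reset time, but the increment leading to it is labelled `σ n`, so the block that
ends there still controls it. -/
lemma abs_truncParaproduct_le_blockWeight {σ : ℕ → Ω → ℕ} (f g : ℕ → Ω → ℝ) {ω : Ω}
    (hσ : IsResetSeq fun i => σ i ω) {u n N : ℕ} (hu : σ n ω ≤ u) (hun : u ≤ n) (hnN : n + 1 ≤ N) :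
    |truncParaproduct f g u (n + 1) ω| ≤ blockWeight σ f g N (σ n ω) ω := by
  set a := σ n ω with ha
  have hsum : ∀ (h : ℕ → Ω → ℝ) m, a ≤ m → m ≤ n + 1 →
      |h m ω - h a ω| ≤ blockMax (fun i => σ i ω) (fun i => increment h i ω) a N := by
    intro h m h1 h2
    rw [← sum_Ico_increment h h1, ha, ← hσ.blockSum_eq (n := n) _ h1 h2]
    exact abs_blockSum_le _ _ _ (h2.trans hnN)
  have hpara : ∀ m, a ≤ m → m ≤ n + 1 → |truncParaproduct f g a m ω| ≤
      blockMax (fun i => σ i ω) (fun i => blockParaDiff σ f g i ω) a N := by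
    intro m h1 h2
    have h3 : truncParaproduct f g a m ω =
        blockSum (fun i => σ i ω) (fun i => blockParaDiff σ f g i ω) a m := by
      rw [truncParaproduct_eq_sum f g h1, ha, hσ.blockSum_eq (n := n) _ h1 h2]
      refine Finset.sum_congr rfl fun i hi => ?_
      rw [Finset.mem_Ico] at hi
      have h4 : σ i ω = σ n ω := hσ.eq_of_le (n := n) hi.1 (by omega)
      unfold blockParaDiff
      rw [h4, hσ.blockSum_eq (n := n) _ hi.1 (by omega), sum_Ico_increment f hi.1]
    rw [h3]
    exact abs_blockSum_le _ _ _ (h2.trans hnN)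
  rw [truncParaproduct_chasles f g hu (hun.trans n.le_succ)]
  have h1 := hpara (n + 1) (hu.trans (hun.trans n.le_succ)) le_rfl
  have h2 := hpara u hu (hun.trans n.le_succ)
  have h3 := hsum f u hu (hun.trans n.le_succ)
  have h4 := hsum g (n + 1) (hu.trans (hun.trans n.le_succ)) le_rfl
  have h5 := hsum g u hu (hun.trans n.le_succ)
  have h6 : |g (n + 1) ω - g u ω| ≤
      2 * blockMax (fun i => σ i ω) (fun i => increment g i ω) a N := by
    rw [show g (n + 1) ω - g u ω = (g (n + 1) ω - g a ω) - (g u ω - g a ω) by ring]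
    exact (abs_sub _ _).trans (by linarith)
  have h7 : |(f u ω - f a ω) * (g (n + 1) ω - g u ω)| ≤
      blockMax (fun i => σ i ω) (fun i => increment f i ω) a N *
      (2 * blockMax (fun i => σ i ω) (fun i => increment g i ω) a N) := by
    rw [abs_mul]
    exact mul_le_mul h3 h6 (abs_nonneg _) (blockMax_nonneg _ _ _ _)
  refine (abs_sub _ _).trans ((add_le_add (abs_sub _ _) le_rfl).trans ?_)
  unfold blockWeight
  linarith

end Paraproduct

/-! ### Counting by resets, and the variation -/

section Resets

open Classical in
/-- The sequence which resets at time `n + 1` as soon as some `P u (n + 1)`, with `u` after the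
previous reset, exceeds the threshold `thr (n + 1)`. -/
noncomputable def resetSeq (P : ℕ → ℕ → ℝ) (thr : ℕ → ℝ) : ℕ → ℕ
  | 0 => 0
  | n + 1 => if ∃ u, resetSeq P thr n ≤ u ∧ u ≤ n ∧ thr (n + 1) ≤ |P u (n + 1)| then n + 1
      else resetSeq P thr n

variable (P : ℕ → ℕ → ℝ) (thr : ℕ → ℝ)

lemma isResetSeq_resetSeq : IsResetSeq (resetSeq P thr) where
  zero := rfl
  succ n := by
    rw [resetSeq]
    split_ifs
    · exact Or.inr rfl
    · exact Or.inl rfl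

variable {P thr}

lemma resetSeq_succ_of_exists {n : ℕ}
    (h : ∃ u, resetSeq P thr n ≤ u ∧ u ≤ n ∧ thr (n + 1) ≤ |P u (n + 1)|) :
    resetSeq P thr (n + 1) = n + 1 := by
  rw [resetSeq, if_pos h]

/-- Without a reset in `(u, v]` the last reset before `v` is at most `u`, so `u` is an admissible
starting point and the rule forces a reset at `v`. -/
lemma exists_reset {u v : ℕ} (huv : u < v) (h : thr v ≤ |P u v|) :
    ∃ n, u ≤ n ∧ n < v ∧
      ∃ w, resetSeq P thr n ≤ w ∧ w ≤ n ∧ thr (n + 1) ≤ |P w (n + 1)| := by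
  by_contra hcon
  push Not at hcon
  have h1 : ∀ n, u ≤ n → n < v → resetSeq P thr n ≤ u := by
    intro n hn
    induction n, hn using Nat.le_induction with
    | base => exact fun _ => (isResetSeq_resetSeq P thr).le u
    | succ n hn ih =>
      intro hv
      rw [resetSeq, if_neg]
      · exact ih (by omega)
      · rintro ⟨w, hw1, hw2, hw3⟩
        exact absurd hw3 (not_le.2 (hcon n hn (by omega) w hw1 hw2))
  obtain ⟨n, rfl⟩ : ∃ n, v = n + 1 := ⟨v - 1, by omega⟩
  exact absurd h (not_le.2 (hcon n (by omega) (by omega) u (h1 n (by omega) (by omega)) (by omega)))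

/-- Each interval in `s` is charged to the block closed by a reset inside it, whose weight is at
least the threshold at that reset and so at least `c k`. -/
lemma sum_le_sum_of_resets {N m : ℕ} {n : Fin (m + 1) → ℕ} (hn : StrictMono n)
    (hN : n (Fin.last m) ≤ N) {W : ℕ → ℝ} (hW0 : ∀ a, 0 ≤ W a)
    (hW : ∀ u k, resetSeq P thr k ≤ u → u ≤ k → k + 1 ≤ N →
      |P u (k + 1)| ≤ W (resetSeq P thr k))
    (s : Finset (Fin m)) (c : Fin m → ℝ)
    (hs : ∀ k ∈ s, thr (n k.succ) ≤ |P (n k.castSucc) (n k.succ)|)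
    (hc : ∀ k ∈ s, ∀ t, n k.castSucc < t → t ≤ n k.succ → c k ≤ thr t) :
    ∑ k ∈ s, c k ≤ ∑ a ∈ Finset.range N, W a := by
  have hlt : ∀ k : Fin m, n k.castSucc < n k.succ := fun k => hn k.castSucc_lt_succ
  have hex : ∀ k : Fin m, ∃ t, k ∈ s → n k.castSucc ≤ t ∧ t < n k.succ ∧
      ∃ w, resetSeq P thr t ≤ w ∧ w ≤ t ∧ thr (t + 1) ≤ |P w (t + 1)| := by
    intro k
    by_cases hk : k ∈ s
    · obtain ⟨t, ht⟩ := exists_reset (hlt k) (hs k hk)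
      exact ⟨t, fun _ => ht⟩
    · exact ⟨0, fun h => absurd h hk⟩
  choose t ht using hex
  have hR := isResetSeq_resetSeq P thr
  have htN : ∀ k ∈ s, t k + 1 ≤ N := fun k hk =>
    (ht k hk).2.1.trans_le ((hn.monotone (Fin.le_last _)).trans hN)
  -- The reset at `t k + 1` separates the two blocks, so no block is charged twice.
  have hlt' : ∀ k ∈ s, ∀ l ∈ s, k < l → resetSeq P thr (t k) < resetSeq P thr (t l) := by
    intro k hk l hl hkl
    have h1 : t k + 1 ≤ t l :=
      (ht k hk).2.1.trans_le ((hn.monotone (Fin.succ_le_castSucc_iff.2 hkl)).trans (ht l hl).1)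
    have h2 := hR.monotone h1
    rw [resetSeq_succ_of_exists (ht k hk).2.2] at h2
    have h3 := hR.le (t k)
    omega
  have hinj : Set.InjOn (fun k => resetSeq P thr (t k)) s := by
    intro k hk l hl hkl
    rcases lt_trichotomy k l with h | h | h
    · exact absurd hkl (hlt' k hk l hl h).ne
    · exact h
    · exact absurd hkl (hlt' l hl k hk h).ne'
  calc ∑ k ∈ s, c k ≤ ∑ k ∈ s, W (resetSeq P thr (t k)) := by
        refine Finset.sum_le_sum fun k hk => ?_
        obtain ⟨h1, h2, w, h3, h4, h5⟩ := ht k hk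
        exact (hc k hk _ (by omega) h2).trans (h5.trans (hW w _ h3 h4 (htN k hk)))
    _ = ∑ a ∈ s.image fun k => resetSeq P thr (t k), W a := (Finset.sum_image hinj).symm
    _ ≤ ∑ a ∈ Finset.range N, W a := by
        refine Finset.sum_le_sum_of_subset_of_nonneg ?_ fun a _ _ => hW0 a
        intro a ha
        obtain ⟨k, hk, rfl⟩ := Finset.mem_image.1 ha
        have h1 := hR.le (t k)
        have h2 := htN k hk
        exact Finset.mem_range.2 (by omega)

lemma sum_fin_succ_sub_castSucc {m : ℕ} (h : Fin (m + 1) → ℝ) :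
    ∑ k : Fin m, (h k.succ - h k.castSucc) = h (Fin.last m) - h 0 := by
  induction m with
  | zero => simp
  | succ m ih =>
    rw [Fin.sum_univ_castSucc]
    have := ih fun k => h k.castSucc
    simp only [Fin.succ_castSucc, Fin.castSucc_zero] at this ⊢
    rw [this, Fin.succ_last]
    ring

/-- Control of the variation by the level sums of the resets at relative heights `2^{-l-1}`. -/
lemma sum_rpow_le_of_levels {ϱ : ℝ} (hϱ : 1 < ϱ) {N m : ℕ} {n : Fin (m + 1) → ℕ}
    (hn : StrictMono n) (hN : n (Fin.last m) ≤ N) {X : ℕ → ℝ} (hX : Monotone X)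
    (hXnn : ∀ t, 0 ≤ X t) (hPX : ∀ u v, u < v → |P u v| ≤ X v) {W : ℕ → ℕ → ℝ} (hW0 : ∀ l a, 0 ≤ W l a)
    (hW : ∀ l u k, resetSeq P (fun t => (1 / 2) ^ (l + 1) * X t) k ≤ u → u ≤ k → k + 1 ≤ N →
      |P u (k + 1)| ≤ W l (resetSeq P (fun t => (1 / 2) ^ (l + 1) * X t) k))
    {κ U : ℝ} (hκ : κ = 2 ^ ((ϱ - 1) / 2)) (hXU : X N ≤ U)
    (hWU : ∀ l, ∑ a ∈ Finset.range N, W l a ≤ κ ^ (l + 1) * U) :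
    ∑ k : Fin m, |P (n k.castSucc) (n k.succ)| ^ ϱ ≤ (2 + 4 * κ * (1 - κ⁻¹)⁻¹) * U ^ ϱ := by
  have hκ1 : 1 < κ := by rw [hκ]; exact Real.one_lt_rpow (by norm_num) (by linarith)
  have hκ0 : 0 < κ := by linarith
  set p : Fin m → ℝ := fun k => |P (n k.castSucc) (n k.succ)| with hp
  have hp0 : ∀ k, 0 ≤ p k := fun k => abs_nonneg _
  have hpX : ∀ k, p k ≤ X (n k.succ) := fun k => hPX _ _ (hn k.castSucc_lt_succ)
  have hXnN : ∀ k, X (n k) ≤ X N := fun k => hX ((hn.monotone (Fin.le_last k)).trans hN)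
  have hU0 : 0 ≤ U := (hXnn N).trans hXU
  have hsplit : ∀ x : ℝ, 0 ≤ x → x ^ ϱ = x ^ (ϱ - 1) * x := by
    intro x hx
    rw [mul_comm, ← Real.rpow_one_add' hx (by linarith)]
    congr 1
    ring
  -- Intervals on which the majorant `X` more than doubles are paid for by telescoping its
  -- increments. On the others the moving threshold changes by at most a factor `2`, so its value at
  -- the unknown reset time can be replaced by its value at the left end.
  set S : Finset (Fin m) := Finset.univ.filter fun k => 2 * X (n k.castSucc) < X (n k.succ) with hS
  set H : Finset (Fin m) := Finset.univ.filter fun k =>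
    ¬ 2 * X (n k.castSucc) < X (n k.succ) with hH
  have hpow : U ^ ϱ = U ^ (ϱ - 1) * U := hsplit U hU0
  have hUp : 0 ≤ U ^ (ϱ - 1) := Real.rpow_nonneg hU0 _
  have hsumS : ∑ k ∈ S, p k ^ ϱ ≤ 2 * U ^ ϱ := by
    have h1 : ∀ k ∈ S, p k ^ ϱ ≤ U ^ (ϱ - 1) * (2 * (X (n k.succ) - X (n k.castSucc))) := by
      intro k hk
      rw [hsplit _ (hp0 k)]
      have h2 : p k ≤ U := (hpX k).trans ((hXnN _).trans hXU)
      have h3 : 2 * X (n k.castSucc) < X (n k.succ) := (Finset.mem_filter.1 hk).2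
      exact mul_le_mul (Real.rpow_le_rpow (hp0 k) h2 (by linarith)) ((hpX k).trans (by linarith))
        (hp0 k) hUp
    refine (Finset.sum_le_sum h1).trans ?_
    have h2 : ∑ k ∈ S, (X (n k.succ) - X (n k.castSucc)) ≤
        ∑ k : Fin m, (X (n k.succ) - X (n k.castSucc)) :=
      Finset.sum_le_sum_of_subset_of_nonneg (Finset.subset_univ _) fun k _ _ =>
        sub_nonneg.2 (hX (hn k.castSucc_lt_succ).le)
    rw [sum_fin_succ_sub_castSucc fun k => X (n k)] at h2
    have h3 : ∑ k ∈ S, (X (n k.succ) - X (n k.castSucc)) ≤ U := by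
      have := hXnn (n 0)
      have := hXnN (Fin.last m)
      linarith
    rw [← Finset.mul_sum, ← Finset.mul_sum, hpow]
    have := mul_le_mul_of_nonneg_left h3 hUp
    linarith
  have hsumH : ∑ k ∈ H, p k ^ ϱ ≤ 4 * κ * (1 - κ⁻¹)⁻¹ * U ^ ϱ := by
    have hlev : ∀ k : Fin m, ∃ l : ℕ, p k ≠ 0 →
        (1 / 2) ^ (l + 1) * X (n k.succ) < p k ∧ p k ≤ (1 / 2) ^ l * X (n k.succ) := by
      intro k
      by_cases hk : p k = 0
      · exact ⟨0, fun h => absurd hk h⟩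
      have hpk : 0 < p k := (hp0 k).lt_of_ne' hk
      have hXk : 0 < X (n k.succ) := hpk.trans_le (hpX k)
      obtain ⟨l, hl1, hl2⟩ := exists_nat_pow_near_of_lt_one (x := p k / X (n k.succ))
        (y := (1 / 2 : ℝ)) (by positivity) (div_le_one_of_le₀ (hpX k) hXk.le) (by norm_num)
        (by norm_num)
      exact ⟨l, fun _ => ⟨(lt_div_iff₀ hXk).1 hl1, (div_le_iff₀ hXk).1 hl2⟩⟩
    choose lev hlev using hlev
    set H' := H.filter fun k => p k ≠ 0 with hH'
    have hHH' : ∑ k ∈ H, p k ^ ϱ = ∑ k ∈ H', p k ^ ϱ := by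
      refine (Finset.sum_filter_of_ne fun k _ hk => ?_).symm
      intro h0
      exact hk (by rw [h0, Real.zero_rpow (by linarith)])
    set L := (Finset.univ.sup lev) + 1 with hL
    have hmaps : ∀ k ∈ H', lev k ∈ Finset.range L := fun k _ =>
      Finset.mem_range.2 (Nat.lt_succ_of_le (Finset.le_sup (f := lev) (Finset.mem_univ k)))
    rw [hHH', ← Finset.sum_fiberwise_of_maps_to hmaps]
    -- `κ ^ 2 = 2 ^ (ϱ - 1)`: at level `l` the spare power `ϱ - 1` gains `κ ^ (-2 * l)`, against the
    -- allowed loss `κ ^ (l + 1)`.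
    have hhalf : ∀ l : ℕ, ((1 / 2 : ℝ) ^ l) ^ (ϱ - 1) = (κ⁻¹ ^ l) ^ 2 := by
      intro l
      have h1 : κ ^ 2 = 2 ^ (ϱ - 1) := by
        rw [hκ, ← Real.rpow_natCast, ← Real.rpow_mul (by norm_num)]
        congr 1
        push_cast
        ring
      have h2 : (1 / 2 : ℝ) ^ (ϱ - 1) = (κ ^ 2)⁻¹ := by
        rw [h1, one_div, Real.inv_rpow (by norm_num)]
      rw [← Real.rpow_natCast, ← Real.rpow_mul (by norm_num), mul_comm, Real.rpow_mul (by norm_num),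
        h2, Real.rpow_natCast, ← pow_mul, mul_comm l 2, pow_mul, inv_pow, inv_pow, inv_pow]
    have hlevel : ∀ l ∈ Finset.range L, ∑ k ∈ H' with lev k = l, p k ^ ϱ ≤
        4 * κ * U ^ ϱ * κ⁻¹ ^ l := by
      intro l _
      have hmem : ∀ k ∈ H'.filter fun k => lev k = l, ¬ 2 * X (n k.castSucc) < X (n k.succ) ∧
          (1 / 2) ^ (l + 1) * X (n k.succ) < p k ∧ p k ≤ (1 / 2) ^ l * X (n k.succ) := by
        intro k hk
        obtain ⟨hk1, rfl⟩ := Finset.mem_filter.1 hk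
        obtain ⟨hk2, hk3⟩ := Finset.mem_filter.1 hk1
        exact ⟨(Finset.mem_filter.1 hk2).2, hlev k hk3⟩
      have hres := sum_le_sum_of_resets hn hN (hW0 l) (hW l)
        (H'.filter fun k => lev k = l) (fun k => (1 / 2) ^ (l + 1) * X (n k.castSucc))
        (fun k hk => (hmem k hk).2.1.le)
        (fun k hk t ht _ => mul_le_mul_of_nonneg_left (hX ht.le) (by positivity))
      -- The `4` is one factor `2` from the width of the dyadic level and one from `X` at most
      -- doubling.
      have hterm : ∀ k ∈ H'.filter fun k => lev k = l, p k ^ ϱ ≤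
          (((1 / 2) ^ l) ^ (ϱ - 1) * U ^ (ϱ - 1)) *
            (4 * ((1 / 2) ^ (l + 1) * X (n k.castSucc))) := by
        intro k hk
        obtain ⟨h1, h2, h3⟩ := hmem k hk
        have h2l : (0 : ℝ) < (1 / 2) ^ l := by positivity
        have h4 : p k ≤ (1 / 2) ^ l * U :=
          h3.trans (mul_le_mul_of_nonneg_left ((hXnN _).trans hXU) h2l.le)
        rw [hsplit _ (hp0 k), ← Real.mul_rpow h2l.le hU0]
        refine mul_le_mul (Real.rpow_le_rpow (hp0 k) h4 (by linarith)) (h3.trans ?_) (hp0 k)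
          (by positivity)
        rw [pow_succ]
        have := mul_le_mul_of_nonneg_left (not_lt.1 h1) h2l.le
        linarith
      refine (Finset.sum_le_sum hterm).trans ?_
      rw [← Finset.mul_sum, ← Finset.mul_sum, hhalf, hpow]
      have h5 := hres.trans (hWU l)
      have h6 : 0 ≤ (κ⁻¹ ^ l) ^ 2 * U ^ (ϱ - 1) := by positivity
      have h7 : κ⁻¹ ^ l * κ ^ l = 1 := by rw [← mul_pow, inv_mul_cancel₀ hκ0.ne', one_pow]
      calc _ ≤ (κ⁻¹ ^ l) ^ 2 * U ^ (ϱ - 1) * (4 * (κ ^ (l + 1) * U)) := by gcongr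
        _ = 4 * κ * (U ^ (ϱ - 1) * U) * κ⁻¹ ^ l * (κ⁻¹ ^ l * κ ^ l) := by ring
        _ = _ := by rw [h7, mul_one]
    refine (Finset.sum_le_sum hlevel).trans ?_
    have hκi : κ⁻¹ < 1 := inv_lt_one_of_one_lt₀ hκ1
    have hκi0 : 0 ≤ κ⁻¹ := by positivity
    have hgeom : ∑ l ∈ Finset.range L, κ⁻¹ ^ l ≤ (1 - κ⁻¹)⁻¹ := by
      rw [← tsum_geometric_of_lt_one hκi0 hκi]
      exact (summable_geometric_of_lt_one hκi0 hκi).sum_le_tsum _ fun _ _ => by positivity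
    rw [← Finset.mul_sum]
    calc _ ≤ 4 * κ * U ^ ϱ * (1 - κ⁻¹)⁻¹ := by gcongr
      _ = _ := by ring
  rw [← Finset.sum_filter_add_sum_filter_not Finset.univ
    (fun k => 2 * X (n k.castSucc) < X (n k.succ)) fun k => p k ^ ϱ]
  rw [add_mul]
  exact add_le_add hsumS hsumH

end Resets

/-! ### Adaptedness of the resets -/

section Adaptedness

variable {Ω : Type*}

lemma measurable_increment {m : MeasurableSpace Ω} {f : ℕ → Ω → ℝ} {n : ℕ}
    (hf : ∀ i ≤ n, Measurable (f i)) {i : ℕ} (hi : i < n) : Measurable (increment f i) :=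
  (hf (i + 1) hi).sub (hf i hi.le)

lemma measurable_blockParaDiff {m : MeasurableSpace Ω} {σ : ℕ → Ω → ℕ} {f g : ℕ → Ω → ℝ} {n : ℕ}
    (hσ : ∀ i < n, Measurable (σ i)) (hf : ∀ i ≤ n, Measurable (f i))
    (hg : ∀ i ≤ n, Measurable (g i)) {i : ℕ} (hi : i < n) :
    Measurable (blockParaDiff σ f g i) :=
  (measurable_blockSum (hσ i hi) (fun j hj => hσ j (by omega))
    fun j hj => measurable_increment hf (by omega)).mul (measurable_increment hg hi)

lemma measurable_blockWeight {m : MeasurableSpace Ω} {σ : ℕ → Ω → ℕ} {f g : ℕ → Ω → ℝ} {n : ℕ}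
    (hσ : ∀ i < n, Measurable (σ i)) (hf : ∀ i ≤ n, Measurable (f i))
    (hg : ∀ i ≤ n, Measurable (g i)) (a : ℕ) : Measurable (blockWeight σ f g n a) :=
  ((measurable_blockMax measurable_const hσ
      fun _ hi => measurable_blockParaDiff hσ hf hg hi).const_mul 2).add
    (((measurable_blockMax measurable_const hσ fun _ hi => measurable_increment hf hi).mul
      (measurable_blockMax measurable_const hσ fun _ hi => measurable_increment hg hi)).const_mul 2)

lemma measurable_truncParaproduct {m : MeasurableSpace Ω} {f g : ℕ → Ω → ℝ} {v : ℕ}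
    (hf : ∀ i ≤ v, Measurable (f i)) (hg : ∀ i ≤ v, Measurable (g i)) (u : ℕ) :
    Measurable fun ω => truncParaproduct f g u v ω := by
  refine Finset.measurable_sum _ fun j hj => Finset.measurable_sum _ fun i hi => ?_
  rw [Finset.mem_Ioc] at hj
  rw [Finset.mem_Ioo] at hi
  exact ((hf i (by omega)).sub (hf (i - 1) (by omega))).mul
    ((hg j (by omega)).sub (hg (j - 1) (by omega)))

lemma measurable_resetSeq_step {m : MeasurableSpace Ω} {s : Ω → ℕ} (hs : Measurable s) {n : ℕ}
    {Q : ℕ → Ω → ℝ} (hQ : ∀ u, Measurable (Q u)) {θ : Ω → ℝ} (hθ : Measurable θ) :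
    MeasurableSet {ω | ∃ u, s ω ≤ u ∧ u ≤ n ∧ θ ω ≤ |Q u ω|} := by
  rw [Set.ofPred_exists]
  refine MeasurableSet.iUnion fun u => ?_
  exact (measurableSet_le hs measurable_const).inter
    ((MeasurableSet.const _).inter (measurableSet_le hθ (hQ u).abs))

lemma measurable_resetSeq {mΩ : MeasurableSpace Ω} {ℱ : Filtration ℕ mΩ} {P : ℕ → ℕ → Ω → ℝ}
    {thr : ℕ → Ω → ℝ} (hP : ∀ u v, Measurable[ℱ v] (P u v)) (hthr : ∀ n, Measurable[ℱ n] (thr n))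
    (n : ℕ) :
    Measurable[ℱ n] fun ω => resetSeq (fun u v => P u v ω) (fun t => thr t ω) n := by
  classical
  induction n with
  | zero => exact measurable_const
  | succ n ih =>
    have ih' := ih.mono (ℱ.mono n.le_succ) le_rfl
    have h1 := measurable_resetSeq_step ih' (n := n) (fun u => hP u (n + 1)) (hthr (n + 1))
    simp only [resetSeq]
    exact Measurable.ite h1 measurable_const ih'

end Adaptedness

/-! ### The block estimate for martingales -/

section Martingale

variable {Ω : Type*} {mΩ : MeasurableSpace Ω} {μ : Measure Ω}
  {ℱ : Filtration ℕ mΩ} {f : ℕ → Ω → ℝ}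

lemma measurable_martingale_of_le (hf : Martingale f ℱ μ) {i n : ℕ} (h : i ≤ n) :
    Measurable[ℱ n] (f i) :=
  (hf.1 i).measurable.mono (ℱ.mono h) le_rfl

lemma isMartingaleDiff_increment (hf : Martingale f ℱ μ) :
    IsMartingaleDiff ℱ μ (increment f) where
  measurable' n := (measurable_martingale_of_le hf le_rfl).sub
    (measurable_martingale_of_le hf n.le_succ)
  integrable n := (hf.integrable (n + 1)).sub (hf.integrable n)
  condExp_eq_zero n := by
    have h1 : increment f n = f (n + 1) - f n := rfl
    rw [h1]
    filter_upwards [condExp_sub (hf.integrable (n + 1)) (hf.integrable n) (ℱ n),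
      hf.2 n (n + 1) n.le_succ, hf.2 n n le_rfl] with ω h1 h2 h3
    rw [h1, Pi.sub_apply, h2, h3]
    simp

lemma memLp_of_martingaleLpNorm_ne_top (hf : Martingale f ℱ μ) {p : ℝ}
    (hfp : martingaleLpNorm μ p f ≠ ∞) (n : ℕ) : MemLp (f n) (ENNReal.ofReal p) μ :=
  ⟨((hf.1 n).mono (ℱ.le n)).aestronglyMeasurable,
    (le_iSup (fun n => eLpNorm (f n) (ENNReal.ofReal p) μ) n).trans_lt hfp.lt_top⟩

lemma eLpNorm_sum_increment_le (hf : Martingale f ℱ μ) {p : ℝ} (hp : 1 ≤ p) (N : ℕ) :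
    eLpNorm (fun ω => ∑ i ∈ Finset.range N, increment f i ω) (ENNReal.ofReal p) μ ≤
      2 * martingaleLpNorm μ p f := by
  have h1 : (fun ω => ∑ i ∈ Finset.range N, increment f i ω) = f N - f 0 := by
    ext ω
    rw [Finset.range_eq_Ico, sum_Ico_increment f (Nat.zero_le N), Pi.sub_apply]
  have hm : ∀ n, AEStronglyMeasurable (f n) μ := fun n =>
    ((hf.1 n).mono (ℱ.le n)).aestronglyMeasurable
  rw [h1, two_mul]
  refine (eLpNorm_sub_le (hm N) (hm 0) (by simpa using ENNReal.ofReal_le_ofReal hp)).trans ?_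
  exact add_le_add (le_iSup (fun n => eLpNorm (f n) (ENNReal.ofReal p) μ) N)
    (le_iSup (fun n => eLpNorm (f n) (ENNReal.ofReal p) μ) 0)

end Martingale

/-- The block estimate: the sum over blocks of the maximal paraproduct in each block. -/
lemma exists_eLpNorm_totalWeight_le {p q r : ℝ} (hp : 1 < p) (hq : 1 < q)
    (hpqr : 1 / p + 1 / q = 1 / r) :
    ∃ C : ℝ≥0∞, C ≠ ∞ ∧ ∀ (Ω : Type*) (mΩ : MeasurableSpace Ω) (μ : Measure Ω)
      (_ : IsProbabilityMeasure μ) (ℱ : Filtration ℕ mΩ) (f g : ℕ → Ω → ℝ),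
      Martingale f ℱ μ → Martingale g ℱ μ →
      martingaleLpNorm μ p f ≠ ∞ → martingaleLpNorm μ q g ≠ ∞ →
      ∀ (σ : ℕ → Ω → ℕ), (∀ n, Measurable[ℱ n] (σ n)) → (∀ n ω, σ n ω ≤ n) → ∀ N,
      eLpNorm (totalWeight σ f g N) (ENNReal.ofReal r) μ ≤
        C * (martingaleLpNorm μ p f * martingaleLpNorm μ q g) := by
  obtain ⟨C, -, hC⟩ := exists_eLpNorm_blockTotal_paraproduct_le hp hq hpqr
  set Cp := ENNReal.ofReal (2 * p * 288 * (p / (p - 1)))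
  set Cq := ENNReal.ofReal (2 * q * 288 * (q / (q - 1)))
  -- For `r < 1` the triangle inequality holds only up to this constant. The factors `2` next to
  -- `C`, `Cp` and `Cq` come from passing from `f N - f 0` to `f N` and `f 0`, and likewise for `g`.
  refine ⟨ENNReal.LpAddConst (ENNReal.ofReal r) *
    (ENNReal.ofReal 2 * (ENNReal.ofReal C * 2 * 2) + ENNReal.ofReal 2 * (Cp * 2 * (Cq * 2))),
    ?_, ?_⟩
  · refine ENNReal.mul_ne_top (ENNReal.LpAddConst_lt_top _).ne ?_
    finiteness
  intro Ω mΩ μ _ ℱ f g hf hg hfp hgq σ hσ hσn N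
  have hσN : ∀ n < N, ∀ ω, σ n ω < N := fun n hn ω => (hσn n ω).trans_lt hn
  have hd := isMartingaleDiff_increment hf
  have he := isMartingaleDiff_increment hg
  have hdp : ∀ n, MemLp (increment f n) (ENNReal.ofReal p) μ := fun n =>
    (memLp_of_martingaleLpNorm_ne_top hf hfp (n + 1)).sub
      (memLp_of_martingaleLpNorm_ne_top hf hfp n)
  have heq : ∀ n, MemLp (increment g n) (ENNReal.ofReal q) μ := fun n =>
    (memLp_of_martingaleLpNorm_ne_top hg hgq (n + 1)).sub
      (memLp_of_martingaleLpNorm_ne_top hg hgq n)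
  have hσ' : ∀ n, Measurable (σ n) := fun n => (hσ n).mono (ℱ.le n) le_rfl
  have hf' : ∀ n, Measurable (f n) := fun n => (hf.1 n).measurable.mono (ℱ.le n) le_rfl
  have hg' : ∀ n, Measurable (g n) := fun n => (hg.1 n).measurable.mono (ℱ.le n) le_rfl
  have hfN := eLpNorm_sum_increment_le hf hp.le N
  have hgN := eLpNorm_sum_increment_le hg hq.le N
  have hT := (hC Ω mΩ μ inferInstance ℱ _ _ hd he hdp heq N N σ hσ hσN).trans
    (mul_le_mul' (mul_le_mul' le_rfl hfN) hgN)
  set T : Ω → ℝ := fun ω => blockTotal N (fun i => σ i ω) (fun i => blockParaDiff σ f g i ω) N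
  set F : Ω → ℝ := fun ω => blockNorm N (fun i => σ i ω) (fun i => increment f i ω) N
  set G : Ω → ℝ := fun ω => blockNorm N (fun i => σ i ω) (fun i => increment g i ω) N
  have hTm : Measurable T := measurable_blockTotal N (fun i _ => hσ' i)
    fun i hi => measurable_blockParaDiff (fun i _ => hσ' i) (fun i _ => hf' i)
      (fun i _ => hg' i) hi
  have hFm : Measurable F := measurable_blockNorm N (fun i _ => hσ' i) fun i _ => hd.measurable i
  have hGm : Measurable G := measurable_blockNorm N (fun i _ => hσ' i) fun i _ => he.measurable i
  have hF := (hd.eLpNorm_blockNorm_le hp hdp hσ hσN).trans (mul_le_mul' le_rfl hfN)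
  have hG := (he.eLpNorm_blockNorm_le hq heq hσ hσN).trans (mul_le_mul' le_rfl hgN)
  have hFG := (eLpNorm_mul_le_of_holder (holderTriple_of_add (by linarith) (by linarith) hpqr)
    hFm.aestronglyMeasurable hGm.aestronglyMeasurable).trans (mul_le_mul' hF hG)
  calc eLpNorm (totalWeight σ f g N) (ENNReal.ofReal r) μ
      ≤ eLpNorm ((fun ω => 2 * T ω) + fun ω => 2 * (F ω * G ω)) (ENNReal.ofReal r) μ :=
        eLpNorm_mono_nonneg (fun ω => totalWeight_nonneg _ _ _ _ _)
          (fun ω => totalWeight_le σ f g N ω) _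
    _ ≤ ENNReal.LpAddConst (ENNReal.ofReal r) *
        (eLpNorm (fun ω => 2 * T ω) (ENNReal.ofReal r) μ +
          eLpNorm (fun ω => 2 * (F ω * G ω)) (ENNReal.ofReal r) μ) :=
        eLpNorm_add_le' (hTm.const_mul 2).aestronglyMeasurable
          ((hFm.mul hGm).const_mul 2).aestronglyMeasurable _
    _ ≤ ENNReal.LpAddConst (ENNReal.ofReal r) *
        (ENNReal.ofReal 2 * (ENNReal.ofReal C * (2 * martingaleLpNorm μ p f) *
            (2 * martingaleLpNorm μ q g)) +
          ENNReal.ofReal 2 * (Cp * (2 * martingaleLpNorm μ p f) *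
            (Cq * (2 * martingaleLpNorm μ q g)))) := by
        rw [eLpNorm_const_mul_eq (by norm_num), eLpNorm_const_mul_eq (by norm_num)]
        exact mul_le_mul' le_rfl (add_le_add (mul_le_mul' le_rfl hT) (mul_le_mul' le_rfl hFG))
    _ = _ := by ring

/-! ### Passage to infinite time and to infinitely many levels -/

section Limits

variable {Ω : Type*} {mΩ : MeasurableSpace Ω} {μ : Measure Ω}

lemma eLpNorm_ennreal_eq {r : ℝ} (hr : 0 < r) (Z : Ω → ℝ≥0∞) :
    eLpNorm Z (ENNReal.ofReal r) μ = (∫⁻ ω, Z ω ^ r ∂μ) ^ (1 / r) := by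
  rw [eLpNorm_eq_lintegral_rpow_enorm_toReal (by simpa using hr) ENNReal.ofReal_ne_top,
    ENNReal.toReal_ofReal hr.le]
  simp only [enorm_eq_self]

/-- Monotone convergence for the measurable majorants `Z`; no measurability of `X` itself enters. -/
lemma eLpNorm_le_of_le_const_mul_iSup {r : ℝ} (hr : 0 < r) {X : Ω → ℝ≥0∞} {Z : ℕ → Ω → ℝ≥0∞}
    (hZm : ∀ N, Measurable (Z N)) (hZ : ∀ ω, Monotone fun N => Z N ω) {c D : ℝ≥0∞} (hc : c ≠ ∞)
    (hX : ∀ ω, X ω ≤ c * ⨆ N, Z N ω) (hD : ∀ N, eLpNorm (Z N) (ENNReal.ofReal r) μ ≤ D) :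
    eLpNorm X (ENNReal.ofReal r) μ ≤ c * D := by
  rw [eLpNorm_ennreal_eq hr, one_div, ENNReal.rpow_inv_le_iff hr]
  calc ∫⁻ ω, X ω ^ r ∂μ ≤ ∫⁻ ω, c ^ r * ⨆ N, Z N ω ^ r ∂μ := by
        refine lintegral_mono fun ω => ?_
        refine (ENNReal.rpow_le_rpow (hX ω) hr.le).trans (le_of_eq ?_)
        rw [ENNReal.mul_rpow_of_nonneg _ _ hr.le]
        congr 1
        exact (ENNReal.orderIsoRpow r hr).map_iSup fun N => Z N ω
    _ = c ^ r * ⨆ N, ∫⁻ ω, Z N ω ^ r ∂μ := by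
        rw [lintegral_const_mul' _ _ (ENNReal.rpow_ne_top_of_nonneg hr.le hc),
          lintegral_iSup (fun N => (hZm N).pow_const r)]
        exact fun i j hij ω => ENNReal.rpow_le_rpow (hZ ω hij) hr.le
    _ ≤ (c * D) ^ r := by
        rw [ENNReal.mul_rpow_of_nonneg _ _ hr.le]
        refine mul_le_mul' le_rfl (iSup_le fun N => ?_)
        have := hD N
        rwa [eLpNorm_ennreal_eq hr, one_div, ENNReal.rpow_inv_le_iff hr] at this

/-- The `r`-th power of a supremum is at most the sum of the `r`-th powers, so every `r > 0` is
allowed. -/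
lemma eLpNorm_iSup_mul_le {r : ℝ} (hr : 0 < r) {B : ℕ → Ω → ℝ≥0∞} (hB : ∀ l, Measurable (B l))
    (w : ℕ → ℝ≥0∞) {D : ℝ≥0∞} (hD : ∀ l, eLpNorm (B l) (ENNReal.ofReal r) μ ≤ D) :
    eLpNorm (fun ω => ⨆ l, w l * B l ω) (ENNReal.ofReal r) μ ≤ (∑' l, w l ^ r) ^ (1 / r) * D := by
  rw [eLpNorm_ennreal_eq hr, one_div, ENNReal.rpow_inv_le_iff hr,
    ENNReal.mul_rpow_of_nonneg _ _ hr.le, ENNReal.rpow_inv_rpow hr.ne']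
  calc ∫⁻ ω, (⨆ l, w l * B l ω) ^ r ∂μ ≤ ∫⁻ ω, ∑' l, w l ^ r * B l ω ^ r ∂μ := by
        refine lintegral_mono fun ω => ?_
        have h : (⨆ l, w l * B l ω) ^ r = ⨆ l, (w l * B l ω) ^ r :=
          (ENNReal.orderIsoRpow r hr).map_iSup fun l => w l * B l ω
        rw [h]
        refine iSup_le fun l => ?_
        rw [ENNReal.mul_rpow_of_nonneg _ _ hr.le]
        exact ENNReal.le_tsum l
    _ = ∑' l, ∫⁻ ω, w l ^ r * B l ω ^ r ∂μ :=
        lintegral_tsum fun l => (((hB l).pow_const r).const_mul _).aemeasurable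
    _ ≤ ∑' l, w l ^ r * D ^ r := by
        refine ENNReal.tsum_le_tsum fun l => ?_
        rw [lintegral_const_mul _ ((hB l).pow_const r)]
        refine mul_le_mul' le_rfl ?_
        have := hD l
        rwa [eLpNorm_ennreal_eq hr, one_div, ENNReal.rpow_inv_le_iff hr] at this
    _ = (∑' l, w l ^ r) * D ^ r := ENNReal.tsum_mul_right

lemma eLpNorm_ofReal_comp_eq {r : ℝ} (hr : 0 < r) {A : Ω → ℝ} (hA0 : ∀ ω, 0 ≤ A ω) :
    eLpNorm (fun ω => ENNReal.ofReal (A ω)) (ENNReal.ofReal r) μ =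
      eLpNorm A (ENNReal.ofReal r) μ := by
  rw [eLpNorm_ennreal_eq hr, eLpNorm_ofReal_eq hr hA0]

end Limits

/-! ### Assembly of the two estimates -/

section Assembly

variable {Ω : Type*} {mΩ : MeasurableSpace Ω} {μ : Measure Ω} {ℱ : Filtration ℕ mΩ}
  {f g : ℕ → Ω → ℝ}

lemma martingale_ae_eq_zero (hf : Martingale f ℱ μ) {p : ℝ} (hp : 0 < p)
    (h : martingaleLpNorm μ p f = 0) : ∀ᵐ ω ∂μ, ∀ n, f n ω = 0 := by
  rw [ae_all_iff]
  intro n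
  have h1 : eLpNorm (f n) (ENNReal.ofReal p) μ = 0 := by
    have := le_iSup (fun n => eLpNorm (f n) (ENNReal.ofReal p) μ) n
    exact le_antisymm (this.trans h.le) bot_le
  exact (eLpNorm_eq_zero_iff ((hf.1 n).mono (ℱ.le n)).aestronglyMeasurable
    (by simpa using hp)).1 h1

lemma ae_truncParaproduct_eq_zero (hf : Martingale f ℱ μ) (hg : Martingale g ℱ μ) {p q : ℝ}
    (hp : 0 < p) (hq : 0 < q) (h : martingaleLpNorm μ p f = 0 ∨ martingaleLpNorm μ q g = 0) :
    ∀ᵐ ω ∂μ, ∀ u v, truncParaproduct f g u v ω = 0 := by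
  rcases h with h | h
  · filter_upwards [martingale_ae_eq_zero hf hp h] with ω hω u v
    simp [truncParaproduct, procDiff, hω]
  · filter_upwards [martingale_ae_eq_zero hg hq h] with ω hω u v
    simp [truncParaproduct, procDiff, hω]

/-- Reduction of an `L^r` bound to martingales with finite norms. -/
lemma eLpNorm_le_of_finite_case (hf : Martingale f ℱ μ) (hg : Martingale g ℱ μ) {p q r : ℝ}
    (hp : 0 < p) (hq : 0 < q) {X : Ω → ℝ≥0∞} {K : ℝ≥0∞} (hK : K ≠ 0)
    (hzero : ∀ ω, (∀ u v, truncParaproduct f g u v ω = 0) → X ω = 0)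
    (hmain : martingaleLpNorm μ p f ≠ ∞ → martingaleLpNorm μ q g ≠ ∞ →
      eLpNorm X (ENNReal.ofReal r) μ ≤ K * (martingaleLpNorm μ p f * martingaleLpNorm μ q g)) :
    eLpNorm X (ENNReal.ofReal r) μ ≤ K * (martingaleLpNorm μ p f * martingaleLpNorm μ q g) := by
  -- Because `0 * ∞ = 0`, a vanishing norm of one martingale demands a zero left side even if the
  -- other norm is infinite; the paraproducts then vanish almost surely.
  by_cases h0 : martingaleLpNorm μ p f = 0 ∨ martingaleLpNorm μ q g = 0
  · have h1 : X =ᵐ[μ] fun _ => 0 := by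
      filter_upwards [ae_truncParaproduct_eq_zero hf hg hp hq h0] with ω hω
      exact hzero ω hω
    rw [eLpNorm_congr_ae h1]
    simp
  · push Not at h0
    by_cases h1 : martingaleLpNorm μ p f = ∞
    · rw [h1, ENNReal.top_mul h0.2, ENNReal.mul_top hK]
      exact le_top
    by_cases h2 : martingaleLpNorm μ q g = ∞
    · rw [h2, ENNReal.mul_top h0.1, ENNReal.mul_top hK]
      exact le_top
    exact hmain h1 h2

lemma paraproductVariation_eq_zero {ϱ : ℝ} (hϱ : 0 < ϱ) {ω : Ω}
    (h : ∀ u v, truncParaproduct f g u v ω = 0) : paraproductVariation ϱ f g ω = 0 := by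
  simp [paraproductVariation, h, ENNReal.zero_rpow_of_pos hϱ, hϱ]

lemma paraproductJumpCount_eq_zero {lam : ℝ} (hlam : 0 < lam) {ω : Ω}
    (h : ∀ u v, truncParaproduct f g u v ω = 0) : paraproductJumpCount lam f g ω = 0 := by
  simp [paraproductJumpCount, h, not_le.2 hlam]

lemma measurable_totalWeight {σ : ℕ → Ω → ℕ} (hσ : ∀ n, Measurable[ℱ n] (σ n))
    (hf : Martingale f ℱ μ) (hg : Martingale g ℱ μ) (N : ℕ) :
    Measurable (totalWeight σ f g N) :=
  Finset.measurable_sum _ fun a _ => measurable_blockWeight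
    (fun i _ => (hσ i).mono (ℱ.le i) le_rfl) (fun i _ => (hf.1 i).measurable.mono (ℱ.le i) le_rfl)
    (fun i _ => (hg.1 i).measurable.mono (ℱ.le i) le_rfl) a

lemma measurable_resets (hf : Martingale f ℱ μ) (hg : Martingale g ℱ μ) {thr : ℕ → Ω → ℝ}
    (hthr : ∀ n, Measurable[ℱ n] (thr n)) (n : ℕ) :
    Measurable[ℱ n] fun ω => resetSeq (fun u v => truncParaproduct f g u v ω)
      (fun t => thr t ω) n :=
  measurable_resetSeq (P := fun u v ω => truncParaproduct f g u v ω)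
    (fun u _ => measurable_truncParaproduct (fun _ hi => measurable_martingale_of_le hf hi)
      (fun _ hi => measurable_martingale_of_le hg hi) u) hthr n

variable (f g) in
/-- The resets of the paraproduct at height `lam`. -/
noncomputable def jumpResets (lam : ℝ) (n : ℕ) (ω : Ω) : ℕ :=
  resetSeq (fun u v => truncParaproduct f g u v ω) (fun _ => lam) n

lemma paraproductJumpCount_le {lam : ℝ} (hlam : 0 < lam) (ω : Ω) :
    paraproductJumpCount lam f g ω ≤ ENNReal.ofReal lam⁻¹ *
      ⨆ N, ENNReal.ofReal (totalWeight (jumpResets f g lam) f g N ω) := by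
  refine iSup_le fun m => iSup_le fun n => iSup_le fun hn => ?_
  set s := Finset.univ.filter fun k : Fin m =>
    lam ≤ |truncParaproduct f g (n k.castSucc) (n k.succ) ω| with hs
  have h1 := sum_le_sum_of_resets (P := fun u v => truncParaproduct f g u v ω)
    (thr := fun _ => lam) hn (le_refl (n (Fin.last m)))
    (W := fun a => blockWeight (jumpResets f g lam) f g (n (Fin.last m)) a ω)
    (fun a => blockWeight_nonneg _ _ _ _ _ _)
    (fun u k h1 h2 h3 => abs_truncParaproduct_le_blockWeight (σ := jumpResets f g lam) f g
      (isResetSeq_resetSeq _ _) h1 h2 h3)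
    s (fun _ => lam) (fun k hk => (Finset.mem_filter.1 hk).2) (fun _ _ _ _ _ => le_rfl)
  rw [Finset.sum_const, nsmul_eq_mul] at h1
  have h2 : (s.card : ℝ) ≤ lam⁻¹ * totalWeight (jumpResets f g lam) f g (n (Fin.last m)) ω := by
    rw [inv_mul_eq_div, le_div_iff₀ hlam]
    exact h1
  calc (s.card : ℝ≥0∞) = ENNReal.ofReal (s.card : ℝ) := (ENNReal.ofReal_natCast _).symm
    _ ≤ ENNReal.ofReal lam⁻¹ * ENNReal.ofReal
        (totalWeight (jumpResets f g lam) f g (n (Fin.last m)) ω) := by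
      rw [← ENNReal.ofReal_mul (inv_nonneg.2 hlam.le)]
      exact ENNReal.ofReal_le_ofReal h2
    _ ≤ _ := mul_le_mul' le_rfl
      (le_iSup (fun N => ENNReal.ofReal (totalWeight (jumpResets f g lam) f g N ω)) _)

variable (f g) in
/-- An adapted nondecreasing majorant of all truncated paraproducts. -/
noncomputable def paraproductBound (n : ℕ) (ω : Ω) : ℝ := blockWeight (fun _ _ => 0) f g n 0 ω

lemma abs_truncParaproduct_le_paraproductBound {u v : ℕ} (huv : u < v) (ω : Ω) :
    |truncParaproduct f g u v ω| ≤ paraproductBound f g v ω := by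
  obtain ⟨n, rfl⟩ : ∃ n, v = n + 1 := ⟨v - 1, by omega⟩
  exact abs_truncParaproduct_le_blockWeight (σ := fun _ _ => 0) f g ⟨rfl, fun _ => Or.inl rfl⟩
    (Nat.zero_le u) (by omega) le_rfl

variable (f g) in
/-- No resets for `l = 0`, and the resets at relative height `2^{-l}` of the majorant otherwise. -/
noncomputable def levelResets : ℕ → ℕ → Ω → ℕ
  | 0 => fun _ _ => 0
  | l + 1 => fun n ω => resetSeq (fun u v => truncParaproduct f g u v ω)
      (fun t => (1 / 2) ^ (l + 1) * paraproductBound f g t ω) n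

lemma measurable_levelResets (hf : Martingale f ℱ μ) (hg : Martingale g ℱ μ) (l n : ℕ) :
    Measurable[ℱ n] (levelResets f g l n) := by
  cases l with
  | zero => exact measurable_const
  | succ l =>
    refine measurable_resets (thr := fun t ω => (1 / 2) ^ (l + 1) * paraproductBound f g t ω)
      hf hg (fun t => ?_) n
    exact (measurable_blockWeight (fun _ _ => measurable_const)
      (fun _ hi => measurable_martingale_of_le hf hi)
      (fun _ hi => measurable_martingale_of_le hg hi) 0).const_mul _

lemma levelResets_le (l n : ℕ) (ω : Ω) : levelResets f g l n ω ≤ n := by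
  cases l with
  | zero => exact Nat.zero_le n
  | succ l => exact (isResetSeq_resetSeq _ _).le n

variable (f g) in
/-- The weighted supremum of the level sums. -/
noncomputable def levelSup (κ : ℝ) (N : ℕ) (ω : Ω) : ℝ≥0∞ :=
  ⨆ l, ENNReal.ofReal (κ⁻¹ ^ l) * ENNReal.ofReal (totalWeight (levelResets f g l) f g (N + 1) ω)

lemma paraproductVariation_le {ϱ κ : ℝ} (hϱ : 1 < ϱ) (hκ : κ = 2 ^ ((ϱ - 1) / 2)) (ω : Ω) :
    paraproductVariation ϱ f g ω ≤ ENNReal.ofReal (2 + 4 * κ * (1 - κ⁻¹)⁻¹) ^ (1 / ϱ) *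
      ⨆ N, levelSup f g κ N ω := by
  have hκ1 : 1 < κ := by rw [hκ]; exact Real.one_lt_rpow (by norm_num) (by linarith)
  have hκ0 : 0 < κ := by linarith
  have hκi : 0 < (1 - κ⁻¹)⁻¹ := inv_pos.2 (sub_pos.2 (inv_lt_one_of_one_lt₀ hκ1))
  have hϱ0 : 0 < ϱ := by linarith
  set c := 2 + 4 * κ * (1 - κ⁻¹)⁻¹ with hc
  have hc0 : 0 < c := by positivity
  refine iSup_le fun m => iSup_le fun n => iSup_le fun hn => ?_
  set N := n (Fin.last m) with hN
  refine le_trans ?_ (mul_le_mul' le_rfl (le_iSup (fun N => levelSup f g κ N ω) N))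
  by_cases htop : levelSup f g κ N ω = ∞
  · rw [htop, ENNReal.mul_top]
    · exact le_top
    · exact (ENNReal.rpow_pos (by simpa using hc0) ENNReal.ofReal_ne_top).ne'
  set U := (levelSup f g κ N ω).toReal with hU
  have hlev : ∀ l, totalWeight (levelResets f g l) f g (N + 1) ω ≤ κ ^ l * U := by
    intro l
    have h1 : ENNReal.ofReal (κ⁻¹ ^ l * totalWeight (levelResets f g l) f g (N + 1) ω) ≤
        levelSup f g κ N ω := by
      rw [ENNReal.ofReal_mul (by positivity)]
      exact le_iSup (fun l => ENNReal.ofReal (κ⁻¹ ^ l) *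
        ENNReal.ofReal (totalWeight (levelResets f g l) f g (N + 1) ω)) l
    have h2 := (ENNReal.ofReal_le_iff_le_toReal htop).1 h1
    rwa [inv_pow, inv_mul_le_iff₀ (by positivity)] at h2
  -- Level zero has the single block `0`, whose weight is the majorant. The horizon `N + 1` ensures
  -- that this block is among those summed even if `N = 0`.
  have hX : paraproductBound f g (N + 1) ω ≤ U := by
    have h1 := hlev 0
    rw [pow_zero, one_mul] at h1
    refine le_trans ?_ h1
    exact Finset.single_le_sum (f := fun a => blockWeight (fun _ _ => 0) f g (N + 1) a ω)
      (fun a _ => blockWeight_nonneg _ _ _ _ _ _) (Finset.mem_range.2 N.succ_pos)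
  have hsum := sum_rpow_le_of_levels (P := fun u v => truncParaproduct f g u v ω) hϱ hn
    (N := N + 1) (by omega) (X := fun t => paraproductBound f g t ω)
    (blockWeight_mono _ _ _ _ _) (fun t => blockWeight_nonneg _ _ _ _ _ _)
    (fun u v huv => abs_truncParaproduct_le_paraproductBound huv ω)
    (W := fun l a => blockWeight (levelResets f g (l + 1)) f g (N + 1) a ω)
    (fun l a => blockWeight_nonneg _ _ _ _ _ _)
    (fun l u k h1 h2 h3 => abs_truncParaproduct_le_blockWeight
      (σ := levelResets f g (l + 1)) f g (isResetSeq_resetSeq _ _) h1 h2 h3)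
    hκ hX (fun l => hlev (l + 1))
  have hU0 : 0 ≤ U := ENNReal.toReal_nonneg
  have hterm : ∀ k : Fin m,
      ENNReal.ofReal |truncParaproduct f g (n k.castSucc) (n k.succ) ω| ^ ϱ =
        ENNReal.ofReal (|truncParaproduct f g (n k.castSucc) (n k.succ) ω| ^ ϱ) := fun k =>
    ENNReal.ofReal_rpow_of_nonneg (abs_nonneg _) hϱ0.le
  simp only [hterm]
  rw [← ENNReal.ofReal_sum_of_nonneg fun k _ => Real.rpow_nonneg (abs_nonneg _) _]
  calc _ ≤ ENNReal.ofReal (c * U ^ ϱ) ^ (1 / ϱ) :=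
        ENNReal.rpow_le_rpow (ENNReal.ofReal_le_ofReal hsum) (by positivity)
    _ = ENNReal.ofReal c ^ (1 / ϱ) * levelSup f g κ N ω := by
        rw [ENNReal.ofReal_mul hc0.le, ENNReal.mul_rpow_of_nonneg _ _ (by positivity),
          ← ENNReal.ofReal_rpow_of_nonneg hU0 hϱ0.le, ← ENNReal.rpow_mul,
          mul_one_div_cancel hϱ0.ne', ENNReal.rpow_one, hU, ENNReal.ofReal_toReal htop]

end Assembly

theorem theorem1p1 (p q r : ℝ) (hp : 1 < p) (hq : 1 < q) (hr : 1 / 2 < r)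
    (hpqr : 1 / p + 1 / q = 1 / r) :
    (∀ ϱ : ℝ, 1 < ϱ → ∃ C : ℝ≥0,
      ∀ (Ω : Type*) (mΩ : MeasurableSpace Ω) (μ : Measure Ω) (_ : IsProbabilityMeasure μ)
        (ℱ : Filtration ℕ mΩ) (f g : ℕ → Ω → ℝ), Martingale f ℱ μ → Martingale g ℱ μ →
        eLpNorm (paraproductVariation ϱ f g) (ENNReal.ofReal r) μ
          ≤ C * martingaleLpNorm μ p f * martingaleLpNorm μ q g) ∧
    (∃ C : ℝ≥0,
      ∀ (Ω : Type*) (mΩ : MeasurableSpace Ω) (μ : Measure Ω) (_ : IsProbabilityMeasure μ)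
        (ℱ : Filtration ℕ mΩ) (f g : ℕ → Ω → ℝ), Martingale f ℱ μ → Martingale g ℱ μ →
        ∀ lam : ℝ, 0 < lam →
          eLpNorm (paraproductJumpCount lam f g) (ENNReal.ofReal r) μ
            ≤ C * ENNReal.ofReal lam⁻¹ * martingaleLpNorm μ p f * martingaleLpNorm μ q g) := by
  have hr0 : 0 < r := by linarith
  have hp0 : 0 < p := by linarith
  have hq0 : 0 < q := by linarith
  constructor
  · intro ϱ hϱ
    obtain ⟨C, hCtop, hC⟩ := exists_eLpNorm_totalWeight_le hp hq hpqr
    set κ : ℝ := 2 ^ ((ϱ - 1) / 2) with hκ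
    have hκ1 : 1 < κ := Real.one_lt_rpow (by norm_num) (by linarith)
    have hκ0 : 0 < κ := by linarith
    set c := ENNReal.ofReal (2 + 4 * κ * (1 - κ⁻¹)⁻¹) ^ (1 / ϱ) with hc
    have hctop : c ≠ ∞ := ENNReal.rpow_ne_top_of_nonneg (by positivity) ENNReal.ofReal_ne_top
    set w := (∑' l : ℕ, ENNReal.ofReal (κ⁻¹ ^ l) ^ r) ^ (1 / r) with hw
    have hwtop : w ≠ ∞ := by
      refine ENNReal.rpow_ne_top_of_nonneg (by positivity) ?_
      have h1 : ∀ l : ℕ, ENNReal.ofReal (κ⁻¹ ^ l) ^ r = (ENNReal.ofReal κ⁻¹ ^ r) ^ l := by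
        intro l
        rw [ENNReal.ofReal_pow (by positivity), ← ENNReal.rpow_natCast, ← ENNReal.rpow_natCast,
          ← ENNReal.rpow_mul, ← ENNReal.rpow_mul, mul_comm]
      simp only [h1]
      rw [ENNReal.tsum_geometric]
      have h2 : ENNReal.ofReal κ⁻¹ ^ r < 1 := by
        refine ENNReal.rpow_lt_one ?_ hr0
        rw [← ENNReal.ofReal_one]
        exact (ENNReal.ofReal_lt_ofReal_iff one_pos).2 (inv_lt_one_of_one_lt₀ hκ1)
      exact ENNReal.inv_ne_top.2 (tsub_pos_of_lt h2).ne'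
    -- The added `1` keeps the constant nonzero, so that the bound is trivially true when a norm is
    -- infinite and the other nonzero.
    have hKtop : c * (w * C) + 1 ≠ ∞ := by finiteness
    refine ⟨(c * (w * C) + 1).toNNReal, ?_⟩
    intro Ω mΩ μ _ ℱ f g hf hg
    rw [ENNReal.coe_toNNReal hKtop, mul_assoc]
    refine eLpNorm_le_of_finite_case hf hg hp0 hq0 (by simp)
      (fun ω => paraproductVariation_eq_zero (by linarith)) fun hfp hgq => ?_
    have hAm : ∀ l N, Measurable fun ω =>
        ENNReal.ofReal (totalWeight (levelResets f g l) f g N ω) := fun l N =>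
      (measurable_totalWeight (measurable_levelResets hf hg l) hf hg N).ennreal_ofReal
    have hlevel : ∀ N, eLpNorm (levelSup f g κ N) (ENNReal.ofReal r) μ ≤
        w * (C * (martingaleLpNorm μ p f * martingaleLpNorm μ q g)) := fun N =>
      eLpNorm_iSup_mul_le hr0 (fun l => hAm l (N + 1)) _ fun l => by
        rw [eLpNorm_ofReal_comp_eq hr0 fun ω => totalWeight_nonneg _ _ _ _ _]
        exact hC Ω mΩ μ inferInstance ℱ f g hf hg hfp hgq _ (measurable_levelResets hf hg l)
          (levelResets_le l) (N + 1)
    have hfin := eLpNorm_le_of_le_const_mul_iSup hr0 (Z := levelSup f g κ)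
      (fun N => Measurable.iSup fun l => (hAm l (N + 1)).const_mul _)
      (fun ω M N hMN => iSup_mono fun l => mul_le_mul' le_rfl
        (ENNReal.ofReal_le_ofReal (totalWeight_mono _ _ _ _ (Nat.succ_le_succ hMN))))
      hctop (paraproductVariation_le hϱ hκ) hlevel
    refine hfin.trans ?_
    rw [← mul_assoc w, ← mul_assoc c]
    exact mul_le_mul' le_self_add le_rfl
  · obtain ⟨C, hCtop, hC⟩ := exists_eLpNorm_totalWeight_le hp hq hpqr
    have hKtop : C + 1 ≠ ∞ := by finiteness
    refine ⟨(C + 1).toNNReal, ?_⟩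
    intro Ω mΩ μ _ ℱ f g hf hg lam hlam
    rw [ENNReal.coe_toNNReal hKtop, mul_assoc]
    have hlam' : ENNReal.ofReal lam⁻¹ ≠ 0 := by simpa using hlam
    refine eLpNorm_le_of_finite_case hf hg hp0 hq0 (mul_ne_zero (by simp) hlam')
      (fun ω => paraproductJumpCount_eq_zero hlam) fun hfp hgq => ?_
    have hm : ∀ n, Measurable[ℱ n] (jumpResets f g lam n) := fun n =>
      measurable_resets (thr := fun _ _ => lam) hf hg (fun _ => measurable_const) n
    have hfin := eLpNorm_le_of_le_const_mul_iSup (μ := μ) hr0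
      (Z := fun N ω => ENNReal.ofReal (totalWeight (jumpResets f g lam) f g N ω))
      (fun N => (measurable_totalWeight hm hf hg N).ennreal_ofReal)
      (fun ω M N hMN => ENNReal.ofReal_le_ofReal (totalWeight_mono _ _ _ _ hMN))
      ENNReal.ofReal_ne_top (paraproductJumpCount_le hlam)
      (D := C * (martingaleLpNorm μ p f * martingaleLpNorm μ q g)) fun N => by
        rw [eLpNorm_ofReal_comp_eq hr0 fun ω => totalWeight_nonneg _ _ _ _ _]
        exact hC Ω mΩ μ inferInstance ℱ f g hf hg hfp hgq _ hm
          (fun n ω => (isResetSeq_resetSeq _ _).le n) N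
    refine hfin.trans ?_
    rw [← mul_assoc, mul_comm (ENNReal.ofReal lam⁻¹)]
    exact mul_le_mul' (mul_le_mul' le_self_add le_rfl) le_rfl
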